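/- Let $L\subset\mathbb R^2$ be any lattice of full rank, let $T^2=\mathbb R^2/L$ carry the flat metric induced from the Euclidean metric of $\mathbb R^2$, and let $h$ be the standard round metric on the unit sphere $S^2\subset\mathbb R^3$. Let $Z_1,Z_2$ be the standard basis of $\mathbb R^2$ and let $c,c'$ be the linear maps from $\mathbb R^2$ to the symmetric traceless real $3\times3$ matrices with $$c_{Z_1}=c'_{Z_1}=\begin{pmatrix}-1&0&0\\0&0&0\\0&0&1\end{pmatrix},\quad c_{Z_2}=\begin{pmatrix}0&1&0\\1&0&1\\0&1&0\end{pmatrix},\quad c'_{Z_2}=\begin{pmatrix}0&0&\sqrt2\\0&0&0\\\sqrt2&0&0\end{pmatrix}.$$ Let $\lambda$ be the $\mathbb R^2$-valued $1$-form on $S^2$ with $\langle\lambda_p(X),Z\rangle=\langle c_Zp\times p,X\rangle$ for all $p\in S^2$, $X\in T_pS^2$, $Z\in\mathbb R^2$, and let $\lambda'$ be defined in the same way from $c'$. Let $g_\lambda$ be the Riemannian metric on $S^2\times T^2$ given by $$g_\lambda\bigl((X,U),(Y,V)\bigr)=h(X,Y)+\langle\lambda_p(X)+U,\lambda_p(Y)+V\rangle\qquad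 (X,Y\in T_pS^2,\ U,V\in T_zT^2\cong\mathbb R^2),$$ and define $g_{\lambda'}$ in the same way from $\lambda'$. Then the following hold. 1. $g_\lambda$ and $g_{\lambda'}$ are isospectral: their Laplace operators on functions have the same eigenvalues with the same multiplicities. 2. The maximum of the scalar curvature equals $2$ for both metrics. 3. The set where the scalar curvature of $g_\lambda$ equals $2$ is $$\bigl(\{p\in S^2\mid p_1=-p_3\}\cup\{(\tfrac1{\sqrt2},0,\tfrac1{\sqrt2}),(-\tfrac1{\sqrt2},0,-\tfrac1{\sqrt2})\}\bigr)\times T^2,$$ and it contains a nonempty submanifold of codimension one. 4. The set where the scalar curvature of $g_{\lambda'}$ equals $2$ is $\{(0,1,0),(0,-1,0)\}\times T^2$, a submanifold of codimension two. 5. $(S^2\times T^2,g_\lambda)$ and $(S^2\times T^2,g_{\lambda'})$ are not locally isometric: it is not true that every point of $(S^2\times T^2,g_\lambda)$ has an open neighbourhood which is isometric to an open subset of $(S^2\times T^2,g_{\lambda'})$. -/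

import Mathlib

noncomputable section

namespace SphereTorusMetrics

open Set Metric Bundle Module
open scoped Manifold ContDiff Matrix

section Coordinates

variable {E : Type*} [NormedAddCommGroup E] [NormedSpace ℝ E] [FiniteDimensional ℝ E]

/-- The trace, with respect to the metric `g`, of a bilinear map `B`: the sum over a basis `bᵢ` of
`B(bᵢ, ♯bⁱ)`, where `bⁱ` is the dual basis and `♯ = g⁻¹ : E* → E`. -/
def metricTrace {V : Type*} [AddCommMonoid V] (g : E →L[ℝ] E →L[ℝ] ℝ) (B : E → E → V) : V :=
  ∑ i, B (finBasis ℝ E i) (g.inverse ((finBasis ℝ E).coord i).toContinuousLinearMap)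

/-- The Christoffel symbols of the metric `g` on (an open subset of) `E`, as the vector `Γ(u, v)`
with `2 g(Γ(u, v), w) = ∂ᵤ g(v, w) + ∂ᵥ g(u, w) - ∂_w g(u, v)` for all `w`. -/
def christoffel (g : E → E →L[ℝ] E →L[ℝ] ℝ) (x u v : E) : E :=
  (g x).inverse ((2 : ℝ)⁻¹ •
    (fderiv ℝ g x u v + fderiv ℝ g x v u - ((fderiv ℝ g x).flip u).flip v))

/-- The curvature tensor
`R(u, v)w = ∂ᵤ Γ(v, w) - ∂ᵥ Γ(u, w) + Γ(u, Γ(v, w)) - Γ(v, Γ(u, w))`. -/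
def riemann (g : E → E →L[ℝ] E →L[ℝ] ℝ) (x u v w : E) : E :=
  fderiv ℝ (fun y => christoffel g y v w) x u - fderiv ℝ (fun y => christoffel g y u w) x v
    + christoffel g x u (christoffel g x v w) - christoffel g x v (christoffel g x u w)

/-- The Ricci tensor: `Ric(v, w)` is the trace of `u ↦ R(u, v)w`. -/
def ricci (g : E → E →L[ℝ] E →L[ℝ] ℝ) (x v w : E) : ℝ :=
  ∑ i, (finBasis ℝ E).coord i (riemann g x (finBasis ℝ E i) v w)

/-- The Hessian `∂ᵤ ∂ᵥ f - df(Γ(u, v))` of a function `f`. -/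
def hessian (g : E → E →L[ℝ] E →L[ℝ] ℝ) (f : E → ℂ) (x u v : E) : ℂ :=
  fderiv ℝ (fun y => fderiv ℝ f y v) x u - fderiv ℝ f x (christoffel g x u v)

end Coordinates

/-- The pullback `(v, w) ↦ B(Av, Aw)` of a bilinear form. -/
def pullbackForm {V W : Type*} [AddCommGroup V] [Module ℝ V] [TopologicalSpace V]
    [AddCommGroup W] [Module ℝ W] [TopologicalSpace W]
    (B : W →L[ℝ] W →L[ℝ] ℝ) (A : V →L[ℝ] W) : V →L[ℝ] V →L[ℝ] ℝ :=
  (ContinuousLinearMap.precomp ℝ A) ∘L B ∘L A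

section Manifolds

variable {E : Type*} [NormedAddCommGroup E] [NormedSpace ℝ E] [FiniteDimensional ℝ E]
  {H : Type*} [TopologicalSpace H] {I : ModelWithCorners ℝ E H} [I.Boundaryless]
  {M : Type*} [TopologicalSpace M] [ChartedSpace H M] [IsManifold I ∞ M]

variable (I M) in
/-- Smooth Riemannian metrics on a manifold without boundary. -/
abbrev RMetric := ContMDiffRiemannianMetric I ∞ E (fun x : M => TangentSpace I x)

/-- The metric `g` in the preferred chart at `x`, as a field of bilinear forms on the model space `E`. -/
def chartMetric (g : RMetric I M) (x : M) (y : E) : E →L[ℝ] E →L[ℝ] ℝ :=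
  pullbackForm (W := TangentSpace I ((extChartAt I x).symm y))
    (g.inner ((extChartAt I x).symm y))
    (mfderiv 𝓘(ℝ, E) I (extChartAt I x).symm y)

/-- The scalar curvature, computed in the preferred chart at each point. -/
def scalarCurvature (g : RMetric I M) (x : M) : ℝ :=
  metricTrace (chartMetric g x (extChartAt I x x))
    (ricci (chartMetric g x) (extChartAt I x x))

/-- The Laplace operator `Δf = - div grad f = - tr_g Hess f`, computed in the preferred chart at each
point. -/
def laplacian (g : RMetric I M) (f : M → ℂ) (x : M) : ℂ :=
  - metricTrace (chartMetric g x (extChartAt I x x))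
    (hessian (chartMetric g x) (f ∘ (extChartAt I x).symm) (extChartAt I x x))

theorem contDiffAt_chart {f : M → ℂ} (hf : ContMDiff I 𝓘(ℝ, ℂ) ∞ f) (x : M) :
    ContDiffAt ℝ ∞ (f ∘ (extChartAt I x).symm) (extChartAt I x x) := by
  have h := hf.comp_contMDiffOn (contMDiffOn_extChartAt_symm (I := I) (n := ∞) x)
  have h2 := h.contMDiffAt (extChartAt_target_mem_nhds (I := I) x)
  exact contMDiffAt_iff_contDiffAt.1 h2

theorem hessian_add {g : E → E →L[ℝ] E →L[ℝ] ℝ} {a b : E → ℂ} {x : E}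
    (ha : ContDiffAt ℝ ∞ a x) (hb : ContDiffAt ℝ ∞ b x) (u v : E) :
    hessian g (a + b) x u v = hessian g a x u v + hessian g b x u v := by
  have ha' : ∀ᶠ y in nhds x, DifferentiableAt ℝ a y :=
    ((ha.of_le (m := 1) (by norm_cast)).eventually (by simp)).mono
      fun y hy => hy.differentiableAt (by simp)
  have hb' : ∀ᶠ y in nhds x, DifferentiableAt ℝ b y :=
    ((hb.of_le (m := 1) (by norm_cast)).eventually (by simp)).mono
      fun y hy => hy.differentiableAt (by simp)
  have da : DifferentiableAt ℝ (fun y => fderiv ℝ a y v) x :=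
    ((ha.fderiv_right (m := 1) (by norm_cast)).differentiableAt (by simp)).clm_apply
      (differentiableAt_const v)
  have db : DifferentiableAt ℝ (fun y => fderiv ℝ b y v) x :=
    ((hb.fderiv_right (m := 1) (by norm_cast)).differentiableAt (by simp)).clm_apply
      (differentiableAt_const v)
  have e : (fun y => fderiv ℝ (a + b) y v) =ᶠ[nhds x]
      (fun y => fderiv ℝ a y v) + fun y => fderiv ℝ b y v := by
    filter_upwards [ha', hb'] with y h1 h2
    simp [fderiv_add h1 h2]
  unfold hessian
  rw [e.fderiv_eq, fderiv_add da db, fderiv_add ha'.self_of_nhds hb'.self_of_nhds]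
  simp only [add_apply]
  ring

theorem hessian_smul {g : E → E →L[ℝ] E →L[ℝ] ℝ} {a : E → ℂ} {x : E}
    (c : ℂ) (u v : E) : hessian g (c • a) x u v = c • hessian g a x u v := by
  unfold hessian
  have h : ∀ b : E → ℂ, ∀ y, fderiv ℝ (c • b) y = c • fderiv ℝ b y := fun b y =>
    congrFun (fderiv_const_smul_field c) y
  have e : (fun y => fderiv ℝ (c • a) y v) = c • fun y => fderiv ℝ a y v := by
    funext y; simp [h]
  rw [e, h, h]
  simp [mul_sub]

/-- The space of smooth complex valued functions `f` with `Δf = μ f`. On a closed manifold the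
spectrum of the Laplace operator consists of the `μ` for which it is nonzero, and its dimension is
the multiplicity of `μ`. -/
def eigenspace (g : RMetric I M) (μ : ℝ) : Submodule ℂ (M → ℂ) where
  carrier := {f | ContMDiff I 𝓘(ℝ, ℂ) ∞ f ∧ ∀ x, laplacian g f x = μ * f x}
  add_mem' := by
    rintro a b ⟨ha, ha'⟩ ⟨hb, hb'⟩
    refine ⟨ha.add hb, fun x => ?_⟩
    rw [Pi.add_apply, mul_add, ← ha', ← hb']
    have e : (a + b) ∘ (extChartAt I x).symm
      = a ∘ (extChartAt I x).symm + b ∘ (extChartAt I x).symm := rfl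
    simp only [laplacian, metricTrace, e,
      hessian_add (contDiffAt_chart ha x) (contDiffAt_chart hb x), Finset.sum_add_distrib]
    ring
  zero_mem' := by
    refine ⟨contMDiff_const, fun x => ?_⟩
    simp [laplacian, metricTrace, hessian]
  smul_mem' := by
    rintro c a ⟨ha, ha'⟩
    refine ⟨(contDiff_const_smul c).contMDiff.comp ha, fun x => ?_⟩
    have e : (c • a) ∘ (extChartAt I x).symm = c • (a ∘ (extChartAt I x).symm) := rfl
    have h := ha' x
    simp only [laplacian, metricTrace, e, hessian_smul, ← Finset.smul_sum] at h ⊢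
    rw [← smul_neg, h, Pi.smul_apply, smul_eq_mul, smul_eq_mul]
    ring

/-- Isospectrality of two metrics on a closed manifold: every real number is an eigenvalue of the two
Laplace operators with the same multiplicity. -/
def Isospectral (g g' : RMetric I M) : Prop :=
  ∀ μ : ℝ, Module.rank ℂ (eigenspace g μ) = Module.rank ℂ (eigenspace g' μ)

/-- `(M, g)` is locally isometric to `(M, g')`: every point has an open neighbourhood `e.source` and
a diffeomorphism `e` from it onto an open set such that `g` is the pullback of `g'`. -/
def LocallyIsometric (g g' : RMetric I M) : Prop :=
  ∀ x : M, ∃ e : OpenPartialHomeomorph M M, x ∈ e.source ∧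
    ContMDiffOn I I ∞ e e.source ∧ ContMDiffOn I I ∞ e.symm e.target ∧
    ∀ y ∈ e.source, ∀ v w : TangentSpace I y,
      g'.inner (e y) (mfderiv I I e y v) (mfderiv I I e y w) = g.inner y v w

variable (I) in
/-- `N` is a nonempty (embedded, smooth) submanifold of `M` of codimension `k`: near each of its
points it is the zero set of a smooth `ℝᵏ`-valued submersion. -/
def IsSubmanifoldOfCodim (k : ℕ) (N : Set M) : Prop :=
  N.Nonempty ∧ ∀ x ∈ N, ∃ (U : Set M) (F : M → EuclideanSpace ℝ (Fin k)), IsOpen U ∧ x ∈ U ∧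
    ContMDiffOn I 𝓘(ℝ, EuclideanSpace ℝ (Fin k)) ∞ F U ∧
    (∀ y ∈ U, Function.Surjective (mvfderiv I F y)) ∧ N ∩ U = {y ∈ U | F y = 0}

end Manifolds

section Aux
open Filter Topology
theorem pullbackForm_apply {V W : Type*} [AddCommGroup V] [Module ℝ V] [TopologicalSpace V]
    [AddCommGroup W] [Module ℝ W] [TopologicalSpace W]
    (B : W →L[ℝ] W →L[ℝ] ℝ) (A : V →L[ℝ] W) (v w : V) :
    pullbackForm B A v w = B (A v) (A w) := rfl

theorem isVonNBounded_of_pos {V : Type*} [NormedAddCommGroup V] [NormedSpace ℝ V]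
    [FiniteDimensional ℝ V] (B : V →L[ℝ] V →L[ℝ] ℝ) (hB : ∀ v, v ≠ 0 → 0 < B v v) :
    Bornology.IsVonNBounded ℝ {v : V | B v v < 1} := by
  have hc : Continuous fun v => B v v := by fun_prop
  obtain ⟨ε, hε, h⟩ : ∃ ε > 0, ∀ v : V, ‖v‖ = 1 → ε ≤ B v v := by
    rcases (sphere (0 : V) 1).eq_empty_or_nonempty with he | hne
    · exact ⟨1, one_pos, fun v hv => absurd (mem_sphere_zero_iff_norm.2 hv) (by simp [he])⟩
    · obtain ⟨v, hv, hmin⟩ := (isCompact_sphere (0 : V) 1).exists_isMinOn hne hc.continuousOn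
      refine ⟨B v v, hB v ?_, fun w hw => hmin (mem_sphere_zero_iff_norm.2 hw)⟩
      rintro rfl
      simp at hv
  rw [NormedSpace.isVonNBounded_iff]
  refine (isBounded_iff_forall_norm_le).2 ⟨Real.sqrt ε⁻¹, fun v hv => ?_⟩
  apply Real.le_sqrt_of_sq_le
  by_cases h0 : v = 0
  · subst h0; simp [hε.le]
  have hn : ‖v‖ ≠ 0 := norm_ne_zero_iff.2 h0
  have h1 := h (‖v‖⁻¹ • v) (by rw [norm_smul, norm_inv, norm_norm, inv_mul_cancel₀ hn])
  simp only [map_smul, smul_apply, smul_eq_mul] at h1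
  have hv' : B v v < 1 := hv
  have hpos : 0 < ‖v‖ ^ 2 := by positivity
  have h2 : ε * ‖v‖ ^ 2 ≤ B v v := by
    calc ε * ‖v‖ ^ 2 ≤ (‖v‖⁻¹ * (‖v‖⁻¹ * B v v)) * ‖v‖ ^ 2 := by gcongr
      _ = B v v := by field_simp
  rw [le_inv_comm₀ hpos hε, ← one_div, le_div_iff₀ hpos]
  linarith

variable {E : Type*} [NormedAddCommGroup E] [NormedSpace ℝ E] 
  {H : Type*} [TopologicalSpace H] {I : ModelWithCorners ℝ E H} 
  {M : Type*} [TopologicalSpace M] [ChartedSpace H M] [IsManifold I ∞ M]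
  {V : Type*} [NormedAddCommGroup V] [NormedSpace ℝ V]

theorem contMDiffAt_pullbackForm {f : M → V} {B : M → V →L[ℝ] V →L[ℝ] ℝ} {x : M}
    (hf : ContMDiffAt I 𝓘(ℝ, V) ∞ f x) (hB : ContMDiffAt I 𝓘(ℝ, V →L[ℝ] V →L[ℝ] ℝ) ∞ B x) :
    ContMDiffAt I (I.prod 𝓘(ℝ, E →L[ℝ] E →L[ℝ] ℝ)) ∞
      (fun y => TotalSpace.mk' (E →L[ℝ] E →L[ℝ] ℝ)
        (E := fun y : M => TangentSpace I y →L[ℝ] TangentSpace I y →L[ℝ] ℝ) y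
        (pullbackForm (B y) (mvfderiv I f y))) x := by
  rw [contMDiffAt_section]
  have h := hf.mfderiv_const (m := ∞) (by norm_cast)
  have key : ContMDiffAt I 𝓘(ℝ, E →L[ℝ] E →L[ℝ] ℝ) ∞ (fun y =>
      pullbackForm (B y) (inTangentCoordinates I 𝓘(ℝ, V) id f (fun y => mfderiv I 𝓘(ℝ, V) f y) x y)) x := by
    have h2 := hB.clm_comp h
    exact (ContMDiffAt.clm_precomp (F₃ := ℝ) h).clm_comp h2
  refine key.congr_of_eventuallyEq ?_
  filter_upwards [(trivializationAt E (TangentSpace I) x).open_baseSet.mem_nhds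
    (FiberBundle.mem_baseSet_trivializationAt' x)] with y hy
  ext v w
  rw [hom_trivializationAt_apply]
  rw [inCoordinates_apply_eq₂ hy hy (Set.mem_univ _)]
  rw [pullbackForm_apply, pullbackForm_apply]
  simp [ContinuousLinearMap.inCoordinates, inTangentCoordinates, mvfderiv]
  have hs : ∀ v, (trivializationAt E (TangentSpace I) x).symm y v
      = (trivializationAt E (TangentSpace I) x).symmL ℝ y v := fun v => (Trivialization.symmL_apply _ hy v).symm
  rw [hs v, hs w]
  rfl
end Aux

section SphereTorus

/-- Euclidean plane. -/
abbrev E2 := EuclideanSpace ℝ (Fin 2)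

/-- Euclidean space. -/
abbrev E3 := EuclideanSpace ℝ (Fin 3)

/-- The unit sphere `S²` in `ℝ³`. -/
abbrev S2 := sphere (0 : E3) 1

/-- The torus `ℝ² / L`. -/
abbrev Torus (L : Submodule ℤ E2) := E2 ⧸ L.toAddSubgroup

variable (L : Submodule ℤ E2) [DiscreteTopology L]

theorem isLocalHomeomorph_torusMk :
    IsLocalHomeomorph (QuotientAddGroup.mk : E2 → Torus L) :=
  haveI : DiscreteTopology L.toAddSubgroup := ‹DiscreteTopology L›
  (AddSubgroup.isAddQuotientCoveringMap_of_comm L.toAddSubgroup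
    DiscreteTopology.isDiscrete).isCoveringMap.isLocalHomeomorph

/-- The charts of the torus are the local inverses of the projection `ℝ² → ℝ² / L`. -/
instance instChartedSpaceTorus : ChartedSpace E2 (Torus L) :=
  (isLocalHomeomorph_torusMk L).chartedSpace QuotientAddGroup.mk_surjective

theorem mk_symm_of_mem_atlas {e : OpenPartialHomeomorph (Torus L) E2}
    (he : e ∈ atlas E2 (Torus L)) (x : E2) : e.symm x = QuotientAddGroup.mk x := by
  obtain ⟨q, rfl⟩ := he
  simp only [chartAt_self_eq, OpenPartialHomeomorph.trans_refl,
    IsLocalHomeomorph.localInverseAt_symm]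

theorem mk_of_mem_atlas {e : OpenPartialHomeomorph (Torus L) E2}
    (he : e ∈ atlas E2 (Torus L)) {q : Torus L} (hq : q ∈ e.source) :
    (QuotientAddGroup.mk (e q) : Torus L) = q := by
  rw [← mk_symm_of_mem_atlas L he, e.left_inv hq]

/-- The difference of two continuous lifts of the same map to the torus is locally constant. -/
theorem eventually_sub_eq {X : Type*} [TopologicalSpace X] {a b : X → E2} {x : X} {s : Set X}
    (hs : IsOpen s) (hx : x ∈ s) (ha : ContinuousOn a s) (hb : ContinuousOn b s)
    (hab : ∀ y ∈ s, (QuotientAddGroup.mk (a y) : Torus L) = QuotientAddGroup.mk (b y)) :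
    ∀ᶠ y in nhds x, a y = b y + (a x - b x) := by
  obtain ⟨U, hU, hUL⟩ : ∃ U : Set E2, IsOpen U ∧ ∀ v ∈ L, v ∈ U ↔ v = 0 := by
    have h : IsOpen ({0} : Set L) := isOpen_discrete _
    obtain ⟨U, hU, h⟩ := isOpen_induced_iff.1 h
    refine ⟨U, hU, fun v hv => ?_⟩
    have := Set.ext_iff.1 h ⟨v, hv⟩
    simpa [Subtype.ext_iff] using this
  have hd : ∀ y ∈ s, a y - b y ∈ L := fun y hy => by
    have := QuotientAddGroup.eq.1 (hab y hy).symm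
    rwa [neg_add_eq_sub] at this
  have hc : ContinuousAt (fun y => (a y - b y) - (a x - b x)) x :=
    ((ha.sub hb).continuousAt (hs.mem_nhds hx)).sub continuousAt_const
  have h0 : (0 : E2) ∈ U := (hUL 0 L.zero_mem).2 rfl
  have hev : ∀ᶠ y in nhds x, (a y - b y) - (a x - b x) ∈ U :=
    hc.eventually (hU.mem_nhds (by simpa using h0))
  filter_upwards [hev, hs.mem_nhds hx] with y hy hys
  have := (hUL _ (L.sub_mem (hd y hys) (hd x hx))).1 hy
  rw [sub_eq_zero] at this
  rw [← this]; abel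

instance instIsManifoldTorus : IsManifold 𝓘(ℝ, E2) ω (Torus L) := by
  refine isManifold_of_contDiffOn _ _ _ fun e e' he he' => ?_
  simp only [modelWithCornersSelf_coe, modelWithCornersSelf_coe_symm, Function.id_comp,
    Function.comp_id, preimage_id, range_id, inter_univ]
  intro x hx
  have h := eventually_sub_eq L (e.symm.trans e').open_source hx
    (e.symm.trans e').continuousOn continuousOn_id (fun y hy => by
      have hy' : e.symm y ∈ e'.source := by
        have := hy; simp only [mfld_simps] at this; exact this.2
      simpa [mk_symm_of_mem_atlas L he] using mk_of_mem_atlas L he' hy')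
  exact (ContDiffAt.congr_of_eventuallyEq (by fun_prop) h).contDiffWithinAt

/-- The manifold `S² × T²`. -/
abbrev SphereTorus := S2 × Torus L

/-- The model with corners of the four-dimensional manifold `S² × T²`. -/
abbrev IST := (𝓡 2).prod 𝓘(ℝ, E2)

/-- The differential at `x` of `(p, z) ↦ p`, followed by the inclusion `T_p S² ⊆ ℝ³`. -/
def dSphere (x : SphereTorus L) : TangentSpace IST x →L[ℝ] E3 :=
  mvfderiv IST (fun y : SphereTorus L => (y.1 : E3)) x

/-- The differential at `x` of `(p, z) ↦ z`, followed by the canonical identification of the tangent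
space of `T² = ℝ² / L` with `ℝ²`, the derivative of a local inverse of the projection `ℝ² → T²`. -/
def dTorus (x : SphereTorus L) : TangentSpace IST x →L[ℝ] E2 :=
  mvfderiv IST (fun y : SphereTorus L => chartAt E2 x.2 y.2) x

/-- Value at `p : ℝ³`, `X : ℝ³` of the `ℝ²`-valued 1-form `λ` with
`⟨λ_p(X), Z⟩ = ⟨c_Z p × p, X⟩` for all `Z : ℝ²`. -/
def oneForm (c : E2 →ₗ[ℝ] Matrix (Fin 3) (Fin 3) ℝ) (p : E3) : E3 →L[ℝ] E2 :=
  ∑ i, (innerSL ℝ (WithLp.toLp 2 ((c (EuclideanSpace.single i 1) *ᵥ p.ofLp) ⨯₃ p.ofLp) : E3)).smulRight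
    (EuclideanSpace.single i (1 : ℝ))

/-- The connection form `ω(X, Z) = λ(X) + Z`. -/
def connectionForm (c : E2 →ₗ[ℝ] Matrix (Fin 3) (Fin 3) ℝ) (x : SphereTorus L) :
    TangentSpace IST x →L[ℝ] E2 :=
  oneForm c x.1 ∘L dSphere L x + dTorus L x

theorem oneForm_inner (c : E2 →ₗ[ℝ] Matrix (Fin 3) (Fin 3) ℝ) (p X : E3) (Z : E2) :
    inner ℝ (oneForm c p X) Z
      = inner ℝ (WithLp.toLp 2 ((c Z *ᵥ p.ofLp) ⨯₃ p.ofLp) : E3) X := by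
  have hZ : c Z = Z 0 • c (EuclideanSpace.single 0 1) + Z 1 • c (EuclideanSpace.single 1 1) := by
    rw [← map_smul, ← map_smul, ← map_add]
    congr 1
    ext i; fin_cases i <;> simp
  rw [hZ]
  simp [oneForm, PiLp.inner_apply, Fin.sum_univ_two, Fin.sum_univ_three, Matrix.add_mulVec, Matrix.smul_mulVec, inner_add_left, inner_smul_left]
  ring

theorem contDiff_oneForm (c : E2 →ₗ[ℝ] Matrix (Fin 3) (Fin 3) ℝ) : ContDiff ℝ ∞ (oneForm c) := by
  unfold oneForm
  have : ∀ i : Fin 2, ContDiff ℝ ∞ (fun p : E3 => (WithLp.toLp 2 ((c (EuclideanSpace.single i 1) *ᵥ p.ofLp) ⨯₃ p.ofLp) : E3)) := by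
    intro i
    rw [contDiff_euclidean]
    intro j
    fin_cases j <;> simp [cross_apply, Matrix.mulVec, dotProduct, Fin.sum_univ_three] <;> fun_prop
  refine ContDiff.sum fun i _ => ?_
  exact ((innerSL ℝ).contDiff.comp (this i)).smulRight contDiff_const


theorem dSphere_apply (x : SphereTorus L) (v : TangentSpace IST x) :
    dSphere L x v = mvfderiv (𝓡 2) (Subtype.val : S2 → E3) x.1 (v : E2 × E2).1 := by
  have h1 : MDifferentiableAt (𝓡 2) 𝓘(ℝ, E3) (Subtype.val : S2 → E3) x.1 :=
    have : Fact (finrank ℝ E3 = 2 + 1) := ⟨by simp⟩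
    (contMDiff_coe_sphere (m := 1)).mdifferentiableAt one_ne_zero
  have h2 : MDifferentiableAt IST (𝓡 2) (Prod.fst : SphereTorus L → S2) x := mdifferentiableAt_fst
  have := mfderiv_comp x h1 h2
  rw [mfderiv_fst] at this
  exact congrArg (fun A => A v) this

theorem dTorus_apply (x : SphereTorus L) (v : TangentSpace IST x) :
    dTorus L x v = mvfderiv 𝓘(ℝ, E2) (chartAt E2 x.2) x.2 (v : E2 × E2).2 := by
  have h1 : MDifferentiableAt 𝓘(ℝ, E2) 𝓘(ℝ, E2) (chartAt E2 x.2) x.2 :=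
    mdifferentiableAt_atlas (chart_mem_atlas E2 x.2) (mem_chart_source E2 x.2)
  have h2 : MDifferentiableAt IST 𝓘(ℝ, E2) (Prod.snd : SphereTorus L → Torus L) x :=
    mdifferentiableAt_snd
  have := mfderiv_comp x h1 h2
  rw [mfderiv_snd] at this
  exact congrArg (fun A => A v) this

theorem eq_zero_of_forms (x : SphereTorus L) (v : TangentSpace IST x)
    (h1 : dSphere L x v = 0) (h2 : dTorus L x v = 0) : v = 0 := by
  rw [dSphere_apply] at h1
  rw [dTorus_apply] at h2
  have : Fact (finrank ℝ E3 = 2 + 1) := ⟨by simp⟩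
  have e1 : (v : E2 × E2).1 = 0 :=
    injective_mvfderiv_subtypeVal_sphere x.1 (h1.trans (map_zero _).symm)
  have e2 : (v : E2 × E2).2 = 0 := by
    have := (isInvertible_mfderiv_extChartAt (I := 𝓘(ℝ, E2))
      (mem_extChartAt_source (I := 𝓘(ℝ, E2)) x.2)).injective
    exact this (h2.trans (map_zero _).symm)
  exact Prod.ext e1 e2

/-- The fixed chart at a nearby point gives the same form. -/
theorem dTorus_eventually (x : SphereTorus L) : ∀ᶠ y in nhds x,
    dTorus L y = mvfderiv IST (fun y : SphereTorus L => chartAt E2 x.2 y.2) y := by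
  have : ∀ᶠ y in nhds x, y.2 ∈ (chartAt E2 x.2).source :=
    continuous_snd.continuousAt.eventually
      ((chartAt E2 x.2).open_source.mem_nhds (mem_chart_source E2 x.2))
  filter_upwards [this] with y hy
  have h := eventually_sub_eq L
    ((chartAt E2 y.2).open_source.inter (chartAt E2 x.2).open_source)
    ⟨mem_chart_source E2 y.2, hy⟩
    ((chartAt E2 y.2).continuousOn.mono inter_subset_left)
    ((chartAt E2 x.2).continuousOn.mono inter_subset_right)
    (fun z hz => by
      rw [mk_of_mem_atlas L (chart_mem_atlas E2 y.2) hz.1,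
        mk_of_mem_atlas L (chart_mem_atlas E2 x.2) hz.2])
  have h' := (continuous_snd.continuousAt (x := y)).eventually h
  have hd : MDifferentiableAt IST 𝓘(ℝ, E2) (fun y : SphereTorus L => chartAt E2 x.2 y.2) y :=
    (mdifferentiableAt_atlas (chart_mem_atlas E2 x.2) hy).comp y mdifferentiableAt_snd
  have e : mvfderiv IST (fun z : SphereTorus L => chartAt E2 y.2 z.2) y
      = mvfderiv IST (fun z : SphereTorus L => chartAt E2 x.2 z.2
        + (chartAt E2 y.2 y.2 - chartAt E2 x.2 y.2)) y := by
    unfold mvfderiv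
    have := Filter.EventuallyEq.mfderiv_eq (I := IST) (I' := 𝓘(ℝ, E2)) h'
    exact this
  rw [dTorus, e]
  have := mvfderiv_add hd (mdifferentiableAt_const
    (c := chartAt E2 y.2 y.2 - chartAt E2 x.2 y.2))
  rw [mvfderiv_const, add_zero] at this
  exact this


theorem metric_pos (c : E2 →ₗ[ℝ] Matrix (Fin 3) (Fin 3) ℝ) (x : SphereTorus L)
    (v : TangentSpace IST x) (hv : v ≠ 0) :
    0 < (pullbackForm (innerSL ℝ) (dSphere L x)
      + pullbackForm (innerSL ℝ) (connectionForm L c x)) v v := by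
  change 0 < inner ℝ (dSphere L x v) (dSphere L x v)
    + inner ℝ (connectionForm L c x v) (connectionForm L c x v)
  by_contra! h
  have h1 := real_inner_self_nonneg (x := dSphere L x v)
  have h2 := real_inner_self_nonneg (x := connectionForm L c x v)
  have e1 : dSphere L x v = 0 := inner_self_eq_zero (𝕜 := ℝ).1 (by linarith)
  have e2 : connectionForm L c x v = 0 := inner_self_eq_zero (𝕜 := ℝ).1 (by linarith)
  have e3 : connectionForm L c x v = oneForm c x.1 (dSphere L x v) + dTorus L x v := rfl
  rw [e1, map_zero, zero_add] at e3
  exact hv (eq_zero_of_forms L x v e1 (e3.symm.trans e2))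

theorem metric_contMDiffAt (c : E2 →ₗ[ℝ] Matrix (Fin 3) (Fin 3) ℝ) (x : SphereTorus L) :
    ContMDiffAt IST (IST.prod 𝓘(ℝ, (E2 × E2) →L[ℝ] (E2 × E2) →L[ℝ] ℝ)) ∞
      (fun y => TotalSpace.mk' ((E2 × E2) →L[ℝ] (E2 × E2) →L[ℝ] ℝ)
        (E := fun y : SphereTorus L => TangentSpace IST y →L[ℝ] TangentSpace IST y →L[ℝ] ℝ) y
        (pullbackForm (innerSL ℝ) (dSphere L y)
          + pullbackForm (innerSL ℝ) (connectionForm L c y))) x := by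
  have hs : ContMDiff IST 𝓘(ℝ, E3) ∞ (fun y : SphereTorus L => (y.1 : E3)) := by
    have : Fact (finrank ℝ E3 = 2 + 1) := ⟨by simp⟩
    exact contMDiff_coe_sphere.comp contMDiff_fst
  have ht : ContMDiffAt IST 𝓘(ℝ, E2) ∞ (fun y : SphereTorus L => chartAt E2 x.2 y.2) x :=
    (contMDiffAt_of_mem_maximalAtlas (IsManifold.chart_mem_maximalAtlas x.2)
      (mem_chart_source E2 x.2)).comp x contMDiffAt_snd
  let f : SphereTorus L → E3 × E2 := fun y => ((y.1 : E3), chartAt E2 x.2 y.2)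
  have hf : ContMDiffAt IST 𝓘(ℝ, E3 × E2) ∞ f x := hs.contMDiffAt.prodMk_space ht
  let P : E3 × E2 →L[ℝ] E3 := ContinuousLinearMap.fst ℝ E3 E2
  let Q : E3 → E3 × E2 →L[ℝ] E2 := fun p =>
    oneForm c p ∘L P + ContinuousLinearMap.snd ℝ E3 E2
  let B : SphereTorus L → E3 × E2 →L[ℝ] E3 × E2 →L[ℝ] ℝ := fun y =>
    pullbackForm (innerSL ℝ) P + pullbackForm (innerSL ℝ) (Q y.1)
  have hQ : ContMDiff IST 𝓘(ℝ, E3 × E2 →L[ℝ] E2) ∞ (fun y : SphereTorus L => Q y.1) := by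
    have : ContDiff ℝ ∞ Q := ((contDiff_oneForm c).clm_comp contDiff_const).add contDiff_const
    exact this.contMDiff.comp hs
  have hB : ContMDiffAt IST 𝓘(ℝ, E3 × E2 →L[ℝ] E3 × E2 →L[ℝ] ℝ) ∞ B x := by
    have h1 : ContMDiff IST 𝓘(ℝ, E3 × E2 →L[ℝ] E3 × E2 →L[ℝ] ℝ) ∞
        (fun y : SphereTorus L => pullbackForm (innerSL ℝ) (Q y.1)) :=
      (ContMDiff.clm_precomp (F₃ := ℝ) hQ).clm_comp (contMDiff_const.clm_comp hQ)
    exact (contMDiff_const.add h1).contMDiffAt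
  refine (contMDiffAt_pullbackForm hf hB).congr_of_eventuallyEq ?_
  have hsrc : ∀ᶠ y in nhds x, y.2 ∈ (chartAt E2 x.2).source :=
    continuous_snd.continuousAt.eventually
      ((chartAt E2 x.2).open_source.mem_nhds (mem_chart_source E2 x.2))
  filter_upwards [dTorus_eventually L x, hsrc] with y hy hsy
  have hd1 : MDifferentiableAt IST 𝓘(ℝ, E3) (fun y : SphereTorus L => (y.1 : E3)) y :=
    hs.mdifferentiableAt (by simp)
  have hd2 : MDifferentiableAt IST 𝓘(ℝ, E2) (fun y : SphereTorus L => chartAt E2 x.2 y.2) y :=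
    (mdifferentiableAt_atlas (chart_mem_atlas E2 x.2) hsy).comp y mdifferentiableAt_snd
  have hdf : MDifferentiableAt IST 𝓘(ℝ, E3 × E2) f y := hd1.prodMk_space hd2
  have e1 : dSphere L y = P ∘L mvfderiv IST f y := by
    have := mfderiv_comp y (g := P) P.mdifferentiableAt hdf
    rw [ContinuousLinearMap.mfderiv_eq] at this
    exact this
  have e2 : dTorus L y = ContinuousLinearMap.snd ℝ E3 E2 ∘L mvfderiv IST f y := by
    have := mfderiv_comp y (g := ContinuousLinearMap.snd ℝ E3 E2)
      (ContinuousLinearMap.snd ℝ E3 E2).mdifferentiableAt hdf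
    rw [ContinuousLinearMap.mfderiv_eq] at this
    exact hy.trans this
  unfold connectionForm
  rw [e1, e2]
  rfl

/-- The metric `g_λ` on `S² × T²`, for `λ` associated with `c`: the `ℝ³`-inner product of the
`S²`-components plus the `ℝ²`-inner product of the values of the connection form. -/
def metric (c : E2 →ₗ[ℝ] Matrix (Fin 3) (Fin 3) ℝ) : RMetric IST (SphereTorus L) where
  inner x := pullbackForm (innerSL ℝ) (dSphere L x) + pullbackForm (innerSL ℝ) (connectionForm L c x)
  symm x v w := by
    change inner ℝ (dSphere L x v) (dSphere L x w)
        + inner ℝ (connectionForm L c x v) (connectionForm L c x w)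
      = inner ℝ (dSphere L x w) (dSphere L x v)
        + inner ℝ (connectionForm L c x w) (connectionForm L c x v)
    rw [real_inner_comm, real_inner_comm (connectionForm L c x w)]
  pos x v hv := metric_pos L c x v hv
  isVonNBounded x := isVonNBounded_of_pos (V := E2 × E2)
    (pullbackForm (innerSL ℝ) (dSphere L x) + pullbackForm (innerSL ℝ) (connectionForm L c x))
    (fun v hv => metric_pos L c x v hv)
  contMDiff x := metric_contMDiffAt L c x

/-- The linear map `Z ↦ Z₁ A + Z₂ B`. -/
def pencil (A B : Matrix (Fin 3) (Fin 3) ℝ) : E2 →ₗ[ℝ] Matrix (Fin 3) (Fin 3) ℝ where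
  toFun Z := Z 0 • A + Z 1 • B
  map_add' Z W := by simp only [PiLp.add_apply, add_smul]; abel
  map_smul' a Z := by simp [mul_smul]

/-- The first of the two linear maps `ℝ² → S₀(ℝ³)`. -/
def c₁ : E2 →ₗ[ℝ] Matrix (Fin 3) (Fin 3) ℝ :=
  pencil !![-1, 0, 0; 0, 0, 0; 0, 0, 1] !![0, 1, 0; 1, 0, 1; 0, 1, 0]

/-- The second of the two linear maps `ℝ² → S₀(ℝ³)`. -/
def c₂ : E2 →ₗ[ℝ] Matrix (Fin 3) (Fin 3) ℝ :=
  pencil !![-1, 0, 0; 0, 0, 0; 0, 0, 1] !![0, 0, √2; 0, 0, 0; √2, 0, 0]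

end SphereTorus

end SphereTorusMetrics

end

/-
Functions on `S² × T²` decompose into Fourier modes along `T²`, and on the mode with dual lattice
vector `Z` the Laplacian depends only on `c_Z`. The matrices `c_Z` and `c'_Z` have the same
characteristic polynomial, so they are conjugate by a rotation; this rotation intertwines the two
Laplacians on the mode of `Z`, for each `Z` separately, which gives isospectrality.

The Koszul formula in adapted frames shows that the scalar curvature is `2` minus a multiple of a
sum of two squares of quadratic polynomials on the sphere, so `2` is the maximum and the maximal set
is the common zero set. A local isometry preserves scalar curvature, so it would carry a
hypersurface contained in one maximal set into the other, which has codimension two.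
-/

noncomputable section

namespace SphereTorusMetrics

open Set Metric Bundle Module MeasureTheory
open scoped Manifold ContDiff Matrix Topology

-- instance synthesis for iterated operator spaces `E →L[ℝ] E →L[ℝ] F` exceeds the default depth
set_option maxSynthPendingDepth 5

section Derivatives

variable {E F G H K : Type*} [NormedAddCommGroup E] [NormedSpace ℝ E]
  [NormedAddCommGroup F] [NormedSpace ℝ F] [NormedAddCommGroup G] [NormedSpace ℝ G]
  [NormedAddCommGroup H] [NormedSpace ℝ H] [NormedAddCommGroup K] [NormedSpace ℝ K] {x : E}

theorem fderiv_clm_apply_const {T : E → F →L[ℝ] G} (hT : DifferentiableAt ℝ T x) (u : E) (v : F) :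
    fderiv ℝ (fun y => T y v) x u = fderiv ℝ T x u v := by
  rw [fderiv_clm_apply hT (differentiableAt_const v)]
  simp

theorem fderiv_clm_apply_const₂ {T : E → F →L[ℝ] G →L[ℝ] H} (hT : DifferentiableAt ℝ T x)
    (u : E) (v : F) (w : G) : fderiv ℝ (fun y => T y v w) x u = fderiv ℝ T x u v w := by
  rw [fderiv_clm_apply_const (hT.clm_apply (differentiableAt_const v)),
    fderiv_clm_apply_const hT]

theorem fderiv_clm_apply₂ {T : E → F →L[ℝ] G →L[ℝ] H} {a : E → F} {b : E → G}
    (hT : DifferentiableAt ℝ T x) (ha : DifferentiableAt ℝ a x) (hb : DifferentiableAt ℝ b x)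
    (u : E) :
    fderiv ℝ (fun y => T y (a y) (b y)) x u = fderiv ℝ T x u (a x) (b x)
      + T x (fderiv ℝ a x u) (b x) + T x (a x) (fderiv ℝ b x u) := by
  rw [fderiv_clm_apply (hT.clm_apply ha) hb, fderiv_clm_apply hT ha]
  simp only [add_apply, ContinuousLinearMap.comp_apply, ContinuousLinearMap.flip_apply]
  abel

end Derivatives

section OrthonormalBases

theorem exists_basis_orthonormal {V : Type*} [AddCommGroup V] [Module ℝ V] [FiniteDimensional ℝ V]
    (B : V →ₗ[ℝ] V →ₗ[ℝ] ℝ) (hsymm : ∀ v w, B v w = B w v) (hpos : ∀ v, v ≠ 0 → 0 < B v v) :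
    ∃ o : Basis (Fin (finrank ℝ V)) ℝ V, ∀ i j, B (o i) (o j) = if i = j then 1 else 0 := by
  let core : InnerProductSpace.Core ℝ V :=
    { inner v w := B v w
      conj_inner_symm v w := hsymm w v
      re_inner_nonneg v := by
        rcases eq_or_ne v 0 with rfl | hv
        · simp
        · exact (hpos v hv).le
      add_left u v w := by simp
      smul_left v w r := by simp
      definite v hv := by
        by_contra h
        exact (hpos v h).ne' hv }
  let := core.toNormedAddCommGroup
  let := InnerProductSpace.ofCore core.toCore
  refine ⟨(stdOrthonormalBasis ℝ V).toBasis, fun i j => ?_⟩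
  rw [OrthonormalBasis.coe_toBasis]
  exact orthonormal_iff_ite.1 (stdOrthonormalBasis ℝ V).orthonormal i j

variable {E ι : Type*} [NormedAddCommGroup E] [NormedSpace ℝ E] [DecidableEq ι]
  {B : E →L[ℝ] E →L[ℝ] ℝ} {o : Basis ι ℝ E}

/-- The basis `o` is orthonormal for the bilinear form `B`, which need not come from the norm of
`E`. -/
def IsOrthonormalFor (B : E →L[ℝ] E →L[ℝ] ℝ) (o : Basis ι ℝ E) : Prop :=
  ∀ i j, B (o i) (o j) = if i = j then 1 else 0

theorem isInvertible_of_pos [FiniteDimensional ℝ E] (hB : ∀ v, v ≠ 0 → 0 < B v v) :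
    B.IsInvertible := by
  have hinj : Function.Injective (B : E →ₗ[ℝ] E →L[ℝ] ℝ) := by
    rw [← LinearMap.ker_eq_bot, LinearMap.ker_eq_bot']
    intro v hv
    by_contra h
    exact (hB v h).ne' (congrArg (fun A : E →L[ℝ] ℝ => A v) hv)
  have hdim : finrank ℝ E = finrank ℝ (E →L[ℝ] ℝ) := by
    rw [← (LinearMap.toContinuousLinearMap : (E →ₗ[ℝ] ℝ) ≃ₗ[ℝ] E →L[ℝ] ℝ).finrank_eq]
    exact (Subspace.dual_finrank_eq (K := ℝ) (V := E)).symm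
  exact ⟨(LinearEquiv.ofInjectiveOfFinrankEq _ hinj hdim).toContinuousLinearEquiv, rfl⟩

theorem exists_isOrthonormalFor [FiniteDimensional ℝ E] (hsymm : ∀ v w, B v w = B w v)
    (hpos : ∀ v, v ≠ 0 → 0 < B v v) :
    ∃ o : Basis (Fin (finrank ℝ E)) ℝ E, IsOrthonormalFor B o :=
  exists_basis_orthonormal (ContinuousLinearMap.toBilinForm B) hsymm hpos

namespace IsOrthonormalFor

theorem apply_eq_repr (ho : IsOrthonormalFor B o) (v : E) (j : ι) : B v (o j) = o.repr v j := by
  have h : (B.flip (o j)).toLinearMap = o.coord j :=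
    o.ext fun i => by simp [ho i j, Finsupp.single_apply]
  exact LinearMap.congr_fun h v

variable [Fintype ι]

theorem inverse_eq_sum (ho : IsOrthonormalFor B o) (hB : B.IsInvertible) (α : E →L[ℝ] ℝ) :
    B.inverse α = ∑ j, α (o j) • o j := by
  conv_lhs => rw [← o.sum_repr (B.inverse α)]
  simp_rw [← ho.apply_eq_repr, hB.self_apply_inverse]

theorem metricTrace_eq_sum [FiniteDimensional ℝ E] {V : Type*} [AddCommGroup V] [Module ℝ V]
    (ho : IsOrthonormalFor B o) (hB : B.IsInvertible) (A : E →ₗ[ℝ] E →ₗ[ℝ] V) :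
    metricTrace B (fun v w => A v w) = ∑ j, A (o j) (o j) := by
  simp_rw [metricTrace, ho.inverse_eq_sum hB, map_sum, map_smul]
  rw [Finset.sum_comm]
  refine Finset.sum_congr rfl fun j _ => ?_
  conv_rhs => enter [1]; rw [← (finBasis ℝ E).sum_repr (o j)]
  simp only [map_sum, map_smul, LinearMap.sum_apply, LinearMap.smul_apply]
  rfl

theorem trace_eq_sum (ho : IsOrthonormalFor B o) (A : E →ₗ[ℝ] E) :
    LinearMap.trace ℝ E A = ∑ j, B (A (o j)) (o j) := by
  simp [LinearMap.trace_eq_matrix_trace ℝ o, Matrix.trace, LinearMap.toMatrix_apply,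
    ho.apply_eq_repr]

end IsOrthonormalFor

end OrthonormalBases

section LocalGeometry

variable {E : Type*} [NormedAddCommGroup E] [NormedSpace ℝ E] {g g' : E → E →L[ℝ] E →L[ℝ] ℝ} {x : E}

/-- Near `x`, the field `g` of bilinear forms is a smooth Riemannian metric. -/
structure IsRiemannianNear (g : E → E →L[ℝ] E →L[ℝ] ℝ) (x : E) : Prop where
  smooth : ∀ᶠ y in 𝓝 x, ContDiffAt ℝ ∞ g y
  symm : ∀ᶠ y in 𝓝 x, ∀ v w, g y v w = g y w v
  pos : ∀ᶠ y in 𝓝 x, ∀ v, v ≠ 0 → 0 < g y v v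

/-- The linear expression in the derivative `T = Dg` which gives the Christoffel symbols of the
first kind, `(u, v, w) ↦ (T(u, v, w) + T(v, u, w) - T(w, u, v)) / 2`. -/
def koszulMap : (E →L[ℝ] E →L[ℝ] E →L[ℝ] ℝ) →L[ℝ] E →L[ℝ] E →L[ℝ] E →L[ℝ] ℝ :=
  let flip₁₂ := (ContinuousLinearMap.flipₗᵢ ℝ E E (E →L[ℝ] ℝ)).toContinuousLinearEquiv
    |>.toContinuousLinearMap
  let flip₂₃ := ContinuousLinearMap.compL ℝ E (E →L[ℝ] E →L[ℝ] ℝ) (E →L[ℝ] E →L[ℝ] ℝ)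
    (ContinuousLinearMap.flipₗᵢ ℝ E E ℝ).toContinuousLinearEquiv.toContinuousLinearMap
  (2 : ℝ)⁻¹ • (ContinuousLinearMap.id ℝ _ + flip₁₂ - flip₂₃ ∘L flip₁₂)

theorem koszulMap_apply (T : E →L[ℝ] E →L[ℝ] E →L[ℝ] ℝ) (u v w : E) :
    koszulMap T u v w = 2⁻¹ * (T u v w + T v u w - T w u v) := rfl

/-- The Christoffel symbols of the first kind, `g(Γ(u, v), w)`. -/
def koszul (g : E → E →L[ℝ] E →L[ℝ] ℝ) (x : E) : E →L[ℝ] E →L[ℝ] E →L[ℝ] ℝ :=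
  koszulMap (fderiv ℝ g x)

theorem koszul_apply (g : E → E →L[ℝ] E →L[ℝ] ℝ) (x u v w : E) :
    koszul g x u v w = 2⁻¹ * (fderiv ℝ g x u v w + fderiv ℝ g x v u w - fderiv ℝ g x w u v) := rfl

/-- `christoffel`, bundled as a continuous bilinear map. -/
def christoffelL (g : E → E →L[ℝ] E →L[ℝ] ℝ) (x : E) : E →L[ℝ] E →L[ℝ] E :=
  ContinuousLinearMap.compL ℝ E (E →L[ℝ] ℝ) E (g x).inverse ∘L koszul g x

theorem christoffelL_apply (g : E → E →L[ℝ] E →L[ℝ] ℝ) (x u v : E) :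
    christoffelL g x u v = christoffel g x u v := rfl

/-- `riemann`, bundled as a continuous trilinear map. -/
def riemannL (g : E → E →L[ℝ] E →L[ℝ] ℝ) (x : E) : E →L[ℝ] E →L[ℝ] E →L[ℝ] E :=
  let D := fderiv ℝ (christoffelL g) x
  let Q := (ContinuousLinearMap.compL ℝ E E E).bilinearComp (christoffelL g x) (christoffelL g x)
  D - D.flip + Q - Q.flip

theorem riemannL_apply (g : E → E →L[ℝ] E →L[ℝ] ℝ) (x u v w : E) :
    riemannL g x u v w
      = fderiv ℝ (christoffelL g) x u v w - fderiv ℝ (christoffelL g) x v u w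
        + christoffel g x u (christoffel g x v w) - christoffel g x v (christoffel g x u w) := rfl

namespace IsRiemannianNear

theorem contDiffAt (hg : IsRiemannianNear g x) : ContDiffAt ℝ ∞ g x := hg.smooth.self_of_nhds

theorem eventually (hg : IsRiemannianNear g x) : ∀ᶠ y in 𝓝 x, IsRiemannianNear g y := by
  filter_upwards [hg.smooth.eventually_nhds, hg.symm.eventually_nhds,
    hg.pos.eventually_nhds] with y h1 h2 h3 using ⟨h1, h2, h3⟩

theorem contDiffAt_fderiv (hg : IsRiemannianNear g x) : ContDiffAt ℝ ∞ (fderiv ℝ g) x :=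
  hg.contDiffAt.fderiv_right (by norm_cast)

theorem differentiableAt (hg : IsRiemannianNear g x) : DifferentiableAt ℝ g x :=
  hg.contDiffAt.differentiableAt (by simp)

theorem fderiv_symm (hg : IsRiemannianNear g x) (u v w : E) :
    fderiv ℝ g x u v w = fderiv ℝ g x u w v := by
  have h : (fun y => g y v w) =ᶠ[𝓝 x] fun y => g y w v := hg.symm.mono fun y hy => hy v w
  rw [← fderiv_clm_apply_const₂ hg.differentiableAt, h.fderiv_eq,
    fderiv_clm_apply_const₂ hg.differentiableAt]

theorem fderiv_eq_koszul (hg : IsRiemannianNear g x) (u v w : E) :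
    fderiv ℝ g x u v w = koszul g x u v w + koszul g x u w v := by
  rw [koszul_apply, koszul_apply, hg.fderiv_symm u w v, hg.fderiv_symm v u w,
    hg.fderiv_symm w u v]
  ring

theorem contDiffAt_koszul (hg : IsRiemannianNear g x) : ContDiffAt ℝ ∞ (koszul g) x :=
  koszulMap.contDiff.contDiffAt.comp x hg.contDiffAt_fderiv

theorem differentiableAt_koszul (hg : IsRiemannianNear g x) : DifferentiableAt ℝ (koszul g) x :=
  hg.contDiffAt_koszul.differentiableAt (by simp)

theorem fderiv_koszul (hg : IsRiemannianNear g x) (s u v w : E) :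
    fderiv ℝ (koszul g) x s u v w = 2⁻¹ * (fderiv ℝ (fderiv ℝ g) x s u v w
      + fderiv ℝ (fderiv ℝ g) x s v u w - fderiv ℝ (fderiv ℝ g) x s w u v) := by
  have hd : HasFDerivAt (koszul g) (koszulMap ∘L fderiv ℝ (fderiv ℝ g) x) x :=
    koszulMap.hasFDerivAt.comp x (hg.contDiffAt_fderiv.differentiableAt (by simp)).hasFDerivAt
  rw [hd.fderiv, ContinuousLinearMap.comp_apply, koszulMap_apply]

variable [FiniteDimensional ℝ E]

theorem isInvertible (hg : IsRiemannianNear g x) : (g x).IsInvertible :=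
  isInvertible_of_pos hg.pos.self_of_nhds

theorem ext_inner (hg : IsRiemannianNear g x) {a b : E} (h : ∀ w, g x a w = g x b w) : a = b :=
  hg.isInvertible.injective (ContinuousLinearMap.ext h)

theorem inner_christoffel (hg : IsRiemannianNear g x) (u v w : E) :
    g x (christoffel g x u v) w = koszul g x u v w := by
  change g x ((g x).inverse (koszul g x u v)) w = _
  rw [hg.isInvertible.self_apply_inverse]

theorem contDiffAt_christoffelL (hg : IsRiemannianNear g x) :
    ContDiffAt ℝ ∞ (christoffelL g) x := by
  have hinv : ContDiffAt ℝ ∞ (fun y => (g y).inverse) x :=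
    hg.isInvertible.contDiffAt_map_inverse.comp x hg.contDiffAt
  exact ((ContinuousLinearMap.contDiff _).contDiffAt.comp x hinv).clm_comp hg.contDiffAt_koszul

theorem differentiableAt_christoffelL (hg : IsRiemannianNear g x) :
    DifferentiableAt ℝ (christoffelL g) x :=
  hg.contDiffAt_christoffelL.differentiableAt (by simp)

theorem inner_fderiv_christoffel (hg : IsRiemannianNear g x) (u v w t : E) :
    g x (fderiv ℝ (christoffelL g) x u v w) t
      = fderiv ℝ (koszul g) x u v w t - fderiv ℝ g x u (christoffel g x v w) t := by
  have hd : DifferentiableAt ℝ (fun y => christoffelL g y v w) x :=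
    (hg.differentiableAt_christoffelL.clm_apply (differentiableAt_const v)).clm_apply
      (differentiableAt_const w)
  have h : (fun y => g y (christoffelL g y v w) t) =ᶠ[𝓝 x] fun y => koszul g y v w t :=
    hg.eventually.mono fun y hy => hy.inner_christoffel v w t
  have hl : fderiv ℝ (fun y => g y (christoffelL g y v w) t) x u
      = fderiv ℝ g x u (christoffel g x v w) t + g x (fderiv ℝ (christoffelL g) x u v w) t := by
    rw [fderiv_clm_apply₂ hg.differentiableAt hd (differentiableAt_const t),
      fderiv_clm_apply_const₂ hg.differentiableAt_christoffelL, fderiv_fun_const]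
    simp only [christoffelL_apply, Pi.zero_apply, zero_apply, map_zero, add_zero]
  have hr : fderiv ℝ (fun y => koszul g y v w t) x u = fderiv ℝ (koszul g) x u v w t := by
    rw [fderiv_clm_apply_const₂ (hg.differentiableAt_koszul.clm_apply (differentiableAt_const v)),
      fderiv_clm_apply_const hg.differentiableAt_koszul]
  rw [eq_sub_iff_add_eq', ← hl, ← hr, h.fderiv_eq]

theorem riemann_eq (hg : IsRiemannianNear g x) (u v w : E) :
    riemann g x u v w = riemannL g x u v w := by
  simp only [riemann, ← christoffelL_apply, riemannL_apply,
    fderiv_clm_apply_const₂ hg.differentiableAt_christoffelL]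

/-- The left-hand side is `R(u, v, w, t)`; on the right, second derivatives of the Christoffel
symbols have been traded for products of Christoffel symbols by compatibility with `g`. -/
theorem inner_riemann (hg : IsRiemannianNear g x) (u v w t : E) :
    g x (riemann g x u v w) t = 2⁻¹ * (fderiv ℝ (fderiv ℝ g) x u w v t
        - fderiv ℝ (fderiv ℝ g) x u t v w - fderiv ℝ (fderiv ℝ g) x v w u t
        + fderiv ℝ (fderiv ℝ g) x v t u w)
      - g x (christoffel g x u t) (christoffel g x v w)
      + g x (christoffel g x v t) (christoffel g x u w) := by
  have hs : fderiv ℝ (fderiv ℝ g) x u v = fderiv ℝ (fderiv ℝ g) x v u :=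
    (hg.contDiffAt.isSymmSndFDerivAt (by simp; norm_cast)) u v
  rw [hg.riemann_eq, riemannL_apply]
  simp only [map_add, map_sub, add_apply, sub_apply]
  rw [hg.inner_fderiv_christoffel, hg.inner_fderiv_christoffel, hg.inner_christoffel,
    hg.inner_christoffel, hg.inner_christoffel, hg.inner_christoffel, hg.fderiv_koszul,
    hg.fderiv_koszul, hs, hg.fderiv_eq_koszul u, hg.fderiv_eq_koszul v]
  ring

end IsRiemannianNear

theorem christoffel_congr (h : g =ᶠ[𝓝 x] g') (u v : E) :
    christoffel g x u v = christoffel g' x u v := by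
  rw [christoffel, christoffel, h.self_of_nhds, h.fderiv_eq]

theorem hessian_congr (h : g =ᶠ[𝓝 x] g') (f : E → ℂ) : hessian g f x = hessian g' f x := by
  funext u v
  rw [hessian, hessian, christoffel_congr h]

variable [FiniteDimensional ℝ E]

/-- The scalar curvature of a metric on an open subset of a vector space. -/
def scalarCurvatureAt (g : E → E →L[ℝ] E →L[ℝ] ℝ) (x : E) : ℝ :=
  metricTrace (g x) (ricci g x)

theorem scalarCurvatureAt_congr (h : g =ᶠ[𝓝 x] g') :
    scalarCurvatureAt g x = scalarCurvatureAt g' x := by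
  have hΓ : ∀ a b, (fun y => christoffel g y a b) =ᶠ[𝓝 x] fun y => christoffel g' y a b :=
    fun a b => h.eventually_nhds.mono fun y hy => christoffel_congr hy a b
  have hr : ricci g x = ricci g' x := by
    funext v w
    simp only [ricci, riemann, (hΓ _ _).fderiv_eq, christoffel_congr h]
  rw [scalarCurvatureAt, scalarCurvatureAt, h.self_of_nhds, hr]

namespace IsRiemannianNear

theorem ricci_eq_trace (hg : IsRiemannianNear g x) (v w : E) :
    ricci g x v w
      = LinearMap.trace ℝ E (((riemannL g x).flip v).flip w : E →L[ℝ] E).toLinearMap := by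
  simp [ricci, hg.riemann_eq, LinearMap.trace_eq_matrix_trace ℝ (finBasis ℝ E), Matrix.trace,
    LinearMap.toMatrix_apply]

theorem scalarCurvatureAt_eq_sum (hg : IsRiemannianNear g x) {ι : Type*} [Fintype ι]
    [DecidableEq ι] {o : Basis ι ℝ E} (ho : IsOrthonormalFor (g x) o) :
    scalarCurvatureAt g x = ∑ j, ∑ i, g x (riemann g x (o i) (o j) (o j)) (o i) := by
  let ric : E →ₗ[ℝ] E →ₗ[ℝ] ℝ := LinearMap.mk₂ ℝ
    (fun v w => LinearMap.trace ℝ E (((riemannL g x).flip v).flip w : E →L[ℝ] E).toLinearMap)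
    (fun _ _ _ => by simp) (fun _ _ _ => by simp) (fun _ _ _ => by simp) (fun _ _ _ => by simp)
  have hric : ricci g x = fun v w => ric v w := by
    ext v w
    exact hg.ricci_eq_trace v w
  rw [scalarCurvatureAt, hric, ho.metricTrace_eq_sum hg.isInvertible ric]
  refine Finset.sum_congr rfl fun j _ => ?_
  change LinearMap.trace ℝ E _ = _
  simp [ho.trace_eq_sum, hg.riemann_eq]

theorem christoffel_eq_sum (hg : IsRiemannianNear g x) {ι : Type*} [Fintype ι]
    [DecidableEq ι] {o : Basis ι ℝ E} (ho : IsOrthonormalFor (g x) o) (a b : E) :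
    christoffel g x a b = ∑ k, koszul g x a b (o k) • o k := by
  simp_rw [← hg.inner_christoffel, ho.apply_eq_repr, o.sum_repr]

theorem inner_christoffel_christoffel (hg : IsRiemannianNear g x) {ι : Type*}
    [Fintype ι] [DecidableEq ι] {o : Basis ι ℝ E} (ho : IsOrthonormalFor (g x) o) (a b c d : E) :
    g x (christoffel g x a b) (christoffel g x c d)
      = ∑ k, koszul g x a b (o k) * koszul g x c d (o k) := by
  simp_rw [hg.christoffel_eq_sum ho c d, map_sum, map_smul, hg.inner_christoffel, smul_eq_mul,
    mul_comm]

end IsRiemannianNear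

end LocalGeometry

section Naturality

variable {E F : Type*} [NormedAddCommGroup E] [NormedSpace ℝ E] [NormedAddCommGroup F]
  [NormedSpace ℝ F] {g : E → E →L[ℝ] E →L[ℝ] ℝ} {g' : F → F →L[ℝ] F →L[ℝ] ℝ} {φ : E → F} {x : E}

/-- Near `x`, the metric `g` is the pullback of `g'` under the local diffeomorphism `φ`. -/
structure IsPullbackNear (g : E → E →L[ℝ] E →L[ℝ] ℝ) (g' : F → F →L[ℝ] F →L[ℝ] ℝ) (φ : E → F)
    (x : E) : Prop where
  source : IsRiemannianNear g x
  target : IsRiemannianNear g' (φ x)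
  smooth : ∀ᶠ y in 𝓝 x, ContDiffAt ℝ ∞ φ y
  finrank_eq : finrank ℝ E = finrank ℝ F
  pullback : ∀ᶠ y in 𝓝 x, ∀ v w, g y v w = g' (φ y) (fderiv ℝ φ y v) (fderiv ℝ φ y w)

namespace IsPullbackNear

theorem eventually (h : IsPullbackNear g g' φ x) : ∀ᶠ y in 𝓝 x, IsPullbackNear g g' φ y := by
  filter_upwards [h.source.eventually,
    h.smooth.self_of_nhds.continuousAt.eventually h.target.eventually, h.smooth.eventually_nhds,
    h.pullback.eventually_nhds] with y h1 h2 h3 h4 using ⟨h1, h2, h3, h.finrank_eq, h4⟩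

theorem differentiableAt (h : IsPullbackNear g g' φ x) : DifferentiableAt ℝ φ x :=
  h.smooth.self_of_nhds.differentiableAt (by simp)

theorem contDiffAt_fderiv (h : IsPullbackNear g g' φ x) : ContDiffAt ℝ ∞ (fderiv ℝ φ) x :=
  h.smooth.self_of_nhds.fderiv_right (by norm_cast)

theorem differentiableAt_fderiv (h : IsPullbackNear g g' φ x) :
    DifferentiableAt ℝ (fderiv ℝ φ) x :=
  h.contDiffAt_fderiv.differentiableAt (by simp)

theorem differentiableAt_fderiv_apply (h : IsPullbackNear g g' φ x) (v : E) :
    DifferentiableAt ℝ (fun y => fderiv ℝ φ y v) x :=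
  h.differentiableAt_fderiv.clm_apply (differentiableAt_const v)

theorem differentiableAt_fderiv_fderiv (h : IsPullbackNear g g' φ x) :
    DifferentiableAt ℝ (fderiv ℝ (fderiv ℝ φ)) x :=
  (h.contDiffAt_fderiv.fderiv_right (m := ∞) (by norm_cast)).differentiableAt (by simp)

theorem snd_symm (h : IsPullbackNear g g' φ x) (u v : E) :
    fderiv ℝ (fderiv ℝ φ) x u v = fderiv ℝ (fderiv ℝ φ) x v u :=
  (h.smooth.self_of_nhds.isSymmSndFDerivAt (by simp; norm_cast)) u v

theorem fderiv_metric (h : IsPullbackNear g g' φ x) (u v w : E) :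
    fderiv ℝ g x u v w
      = fderiv ℝ g' (φ x) (fderiv ℝ φ x u) (fderiv ℝ φ x v) (fderiv ℝ φ x w)
        + g' (φ x) (fderiv ℝ (fderiv ℝ φ) x u v) (fderiv ℝ φ x w)
        + g' (φ x) (fderiv ℝ φ x v) (fderiv ℝ (fderiv ℝ φ) x u w) := by
  have he : (fun y => g y v w) =ᶠ[𝓝 x]
      fun y => (g' ∘ φ) y (fderiv ℝ φ y v) (fderiv ℝ φ y w) := by
    filter_upwards [h.pullback] with y hy using hy v w
  rw [← fderiv_clm_apply_const₂ h.source.differentiableAt, he.fderiv_eq,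
    fderiv_clm_apply₂ (h.target.differentiableAt.comp x h.differentiableAt)
      (h.differentiableAt_fderiv_apply v) (h.differentiableAt_fderiv_apply w),
    fderiv_comp x h.target.differentiableAt h.differentiableAt,
    fderiv_clm_apply_const h.differentiableAt_fderiv,
    fderiv_clm_apply_const h.differentiableAt_fderiv]
  rfl

theorem injective_fderiv (h : IsPullbackNear g g' φ x) : Function.Injective (fderiv ℝ φ x) := by
  refine (injective_iff_map_eq_zero _).2 fun v hv => ?_
  by_contra hne
  refine (h.source.pos.self_of_nhds v hne).ne' ?_
  rw [h.pullback.self_of_nhds, hv, map_zero]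

variable [FiniteDimensional ℝ E] [FiniteDimensional ℝ F]

theorem surjective_fderiv (h : IsPullbackNear g g' φ x) : Function.Surjective (fderiv ℝ φ x) :=
  (LinearMap.injective_iff_surjective_of_finrank_eq_finrank (f := (fderiv ℝ φ x).toLinearMap)
    h.finrank_eq).1 h.injective_fderiv

theorem ext_inner (h : IsPullbackNear g g' φ x) {a b : F}
    (hab : ∀ t, g' (φ x) a (fderiv ℝ φ x t) = g' (φ x) b (fderiv ℝ φ x t)) : a = b :=
  h.target.ext_inner fun w => by
    obtain ⟨t, rfl⟩ := h.surjective_fderiv w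
    exact hab t

theorem fderiv_christoffel (h : IsPullbackNear g g' φ x) (u v : E) :
    fderiv ℝ φ x (christoffel g x u v)
      = christoffel g' (φ x) (fderiv ℝ φ x u) (fderiv ℝ φ x v)
        + fderiv ℝ (fderiv ℝ φ) x u v := by
  refine h.ext_inner fun t => ?_
  rw [← h.pullback.self_of_nhds, h.source.inner_christoffel, map_add, add_apply,
    h.target.inner_christoffel, koszul_apply, koszul_apply, h.fderiv_metric, h.fderiv_metric,
    h.fderiv_metric, h.snd_symm v u, h.snd_symm t u, h.snd_symm t v,
    h.target.symm.self_of_nhds (fderiv ℝ φ x u), h.target.symm.self_of_nhds (fderiv ℝ φ x v)]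
  ring

theorem fderiv_fderiv_christoffel (h : IsPullbackNear g g' φ x) (u v w : E) :
    fderiv ℝ φ x (fderiv ℝ (christoffelL g) x u v w)
      = fderiv ℝ (christoffelL g') (φ x) (fderiv ℝ φ x u) (fderiv ℝ φ x v) (fderiv ℝ φ x w)
        + christoffel g' (φ x) (fderiv ℝ (fderiv ℝ φ) x u v) (fderiv ℝ φ x w)
        + christoffel g' (φ x) (fderiv ℝ φ x v) (fderiv ℝ (fderiv ℝ φ) x u w)
        + fderiv ℝ (fderiv ℝ (fderiv ℝ φ)) x u v w
        - fderiv ℝ (fderiv ℝ φ) x u (christoffel g x v w) := by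
  have hk := h.source.differentiableAt_christoffelL
  have hk' := h.target.differentiableAt_christoffelL
  have hkvw : DifferentiableAt ℝ (fun y => christoffelL g y v w) x :=
    (hk.clm_apply (differentiableAt_const v)).clm_apply (differentiableAt_const w)
  have hk'φ := (hk'.comp x h.differentiableAt).clm_apply (h.differentiableAt_fderiv_apply v)
    |>.clm_apply (h.differentiableAt_fderiv_apply w)
  have hφvw : DifferentiableAt ℝ (fun y => fderiv ℝ (fderiv ℝ φ) y v w) x :=
    (h.differentiableAt_fderiv_fderiv.clm_apply (differentiableAt_const v)).clm_apply
      (differentiableAt_const w)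
  have hl : fderiv ℝ (fun y => fderiv ℝ φ y (christoffelL g y v w)) x u
      = fderiv ℝ φ x (fderiv ℝ (christoffelL g) x u v w)
        + fderiv ℝ (fderiv ℝ φ) x u (christoffel g x v w) := by
    rw [fderiv_clm_apply h.differentiableAt_fderiv hkvw, add_apply,
      ContinuousLinearMap.comp_apply, fderiv_clm_apply_const₂ hk]
    rfl
  have he : (fun y => fderiv ℝ φ y (christoffelL g y v w)) =ᶠ[𝓝 x]
      (fun y => (christoffelL g' ∘ φ) y (fderiv ℝ φ y v) (fderiv ℝ φ y w))
        + fun y => fderiv ℝ (fderiv ℝ φ) y v w := by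
    filter_upwards [h.eventually] with y hy
    exact hy.fderiv_christoffel v w
  rw [eq_sub_iff_add_eq, ← hl, he.fderiv_eq, fderiv_add hk'φ hφvw, add_apply,
    fderiv_clm_apply₂ (hk'.comp x h.differentiableAt)
      (h.differentiableAt_fderiv_apply v) (h.differentiableAt_fderiv_apply w),
    fderiv_comp x hk' h.differentiableAt, fderiv_clm_apply_const h.differentiableAt_fderiv,
    fderiv_clm_apply_const h.differentiableAt_fderiv,
    fderiv_clm_apply_const₂ h.differentiableAt_fderiv_fderiv]
  rfl

theorem fderiv_riemann (h : IsPullbackNear g g' φ x) (u v w : E) :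
    fderiv ℝ φ x (riemann g x u v w)
      = riemann g' (φ x) (fderiv ℝ φ x u) (fderiv ℝ φ x v) (fderiv ℝ φ x w) := by
  have hs : fderiv ℝ (fderiv ℝ (fderiv ℝ φ)) x u v = fderiv ℝ (fderiv ℝ (fderiv ℝ φ)) x v u :=
    (h.contDiffAt_fderiv.isSymmSndFDerivAt (by simp; norm_cast)) u v
  have hadd (a b c : F) : christoffel g' (φ x) a (b + c)
      = christoffel g' (φ x) a b + christoffel g' (φ x) a c :=
    map_add (christoffelL g' (φ x) a) b c
  rw [h.source.riemann_eq, h.target.riemann_eq, riemannL_apply, riemannL_apply, map_sub, map_add,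
    map_sub, h.fderiv_fderiv_christoffel, h.fderiv_fderiv_christoffel, hs, h.snd_symm u v]
  simp only [h.fderiv_christoffel, hadd]
  abel

theorem scalarCurvatureAt_eq (h : IsPullbackNear g g' φ x) :
    scalarCurvatureAt g x = scalarCurvatureAt g' (φ x) := by
  let T : E ≃ₗ[ℝ] F := LinearEquiv.ofBijective (fderiv ℝ φ x).toLinearMap
    ⟨h.injective_fderiv, h.surjective_fderiv⟩
  obtain ⟨o, ho⟩ :=
    exists_isOrthonormalFor h.source.symm.self_of_nhds h.source.pos.self_of_nhds
  have hT : ∀ i, o.map T i = fderiv ℝ φ x (o i) := fun _ => rfl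
  have ho' : IsOrthonormalFor (g' (φ x)) (o.map T) := fun i j => by
    rw [hT, hT, ← h.pullback.self_of_nhds, ho]
  rw [h.source.scalarCurvatureAt_eq_sum ho, h.target.scalarCurvatureAt_eq_sum ho']
  refine Finset.sum_congr rfl fun j _ => Finset.sum_congr rfl fun i _ => ?_
  rw [hT, hT, ← h.fderiv_riemann, ← h.pullback.self_of_nhds]

end IsPullbackNear

end Naturality

section LocalIsometry

variable {E F : Type*} [NormedAddCommGroup E] [NormedSpace ℝ E]
  [NormedAddCommGroup F] [NormedSpace ℝ F]
  {H : Type*} [TopologicalSpace H] {I : ModelWithCorners ℝ F H}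
  {M : Type*} [TopologicalSpace M] [ChartedSpace H M] [IsManifold I ∞ M]
  {F' : Type*} [NormedAddCommGroup F'] [NormedSpace ℝ F']
  {H' : Type*} [TopologicalSpace H'] {I' : ModelWithCorners ℝ F' H'}
  {M' : Type*} [TopologicalSpace M'] [ChartedSpace H' M'] [IsManifold I' ∞ M']
  {g : RMetric I M} {g' : RMetric I' M'} {f : M → M'} {x : M}

/-- The pullback of the metric `g` under a map `ψ` from a vector space to the manifold; the metric
in a chart is the pullback under the inverse of the chart. -/
def pullbackMetric (g : RMetric I M) (ψ : E → M) (u : E) : E →L[ℝ] E →L[ℝ] ℝ :=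
  pullbackForm (W := TangentSpace I (ψ u)) (g.inner (ψ u)) (mfderiv 𝓘(ℝ, E) I ψ u)

theorem pullbackMetric_congr {ψ ψ' : E → M} {u : E} (h : ψ =ᶠ[𝓝 u] ψ') :
    pullbackMetric g ψ u = pullbackMetric g ψ' u :=
  congrArg₂ (fun (y : M) (A : E →L[ℝ] F) => pullbackForm (W := TangentSpace I y) (g.inner y) A)
    h.self_of_nhds h.mfderiv_eq

theorem pullbackMetric_comp {G : Type*} [NormedAddCommGroup G] [NormedSpace ℝ G] {ψ : E → M}
    {φ : G → E} {u : G} (hψ : MDifferentiableAt 𝓘(ℝ, E) I ψ (φ u)) (hφ : DifferentiableAt ℝ φ u) :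
    pullbackMetric g (ψ ∘ φ) u = pullbackForm (pullbackMetric g ψ (φ u)) (fderiv ℝ φ u) := by
  rw [pullbackMetric, mfderiv_comp u hψ hφ.mdifferentiableAt, mfderiv_eq_fderiv]
  rfl

/-- Near `x`, the map `f` is smooth and pulls `g'` back to `g`. -/
structure IsIsometryNear (g : RMetric I M) (g' : RMetric I' M') (f : M → M') (x : M) : Prop where
  smooth : ∀ᶠ y in 𝓝 x, ContMDiffAt I I' ∞ f y
  isometric : ∀ᶠ y in 𝓝 x, ∀ v w : TangentSpace I y,
    g'.inner (f y) (mfderiv I I' f y v) (mfderiv I I' f y w) = g.inner y v w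

theorem IsIsometryNear.eventually (hf : IsIsometryNear g g' f x) :
    ∀ᶠ y in 𝓝 x, IsIsometryNear g g' f y := by
  filter_upwards [hf.smooth.eventually_nhds, hf.isometric.eventually_nhds] with y h1 h2
    using ⟨h1, h2⟩

theorem IsIsometryNear.injective_mfderiv (hf : IsIsometryNear g g' f x) :
    Function.Injective (mfderiv I I' f x) := by
  refine (injective_iff_map_eq_zero _).2 fun v hv => ?_
  by_contra hne
  refine (g.pos x v hne).ne' ?_
  rw [← hf.isometric.self_of_nhds, hv, map_zero]

theorem IsIsometryNear.pullbackMetric_comp {ψ : E → M} {u : E} (hf : IsIsometryNear g g' f (ψ u))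
    (hψ : MDifferentiableAt 𝓘(ℝ, E) I ψ u) :
    pullbackMetric g' (f ∘ ψ) u = pullbackMetric g ψ u := by
  rw [pullbackMetric, mfderiv_comp u (hf.smooth.self_of_nhds.mdifferentiableAt (by simp)) hψ]
  refine ContinuousLinearMap.ext fun v => ContinuousLinearMap.ext fun w => ?_
  exact hf.isometric.self_of_nhds _ _

variable [I.Boundaryless] [I'.Boundaryless]

theorem mdifferentiableAt_extChartAt_symm {y : F} (hy : y ∈ (extChartAt I x).target) :
    MDifferentiableAt 𝓘(ℝ, F) I (extChartAt I x).symm y :=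
  ((contMDiffOn_extChartAt_symm (n := ∞) x).contMDiffAt
    ((isOpen_extChartAt_target x).mem_nhds hy)).mdifferentiableAt (by simp)

set_option synthInstance.maxHeartbeats 100000 in
-- the instances on the bundle of bilinear forms on the tangent spaces are slow to find
theorem contDiffAt_chartMetric {y : F} (hy : y ∈ (extChartAt I x).target) :
    ContDiffAt ℝ ∞ (chartMetric g x) y := by
  have hmem {u : F} (hu : u ∈ (extChartAt I x).target) :
      (extChartAt I x).symm u ∈ (chartAt H x).source := by
    rw [← extChartAt_source I]
    exact (extChartAt I x).map_target hu
  have hsymm := (contMDiffOn_extChartAt_symm (I := I) (n := ∞) x).contMDiffAt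
    ((isOpen_extChartAt_target x).mem_nhds hy)
  have hcoord := ((Trivialization.contMDiffAt_section_iff (trivializationAt (F →L[ℝ] F →L[ℝ] ℝ)
    (fun z : M => TangentSpace I z →L[ℝ] TangentSpace I z →L[ℝ] ℝ) x)
    (by simpa using hmem hy)).1 (g.contMDiff _)).comp y hsymm
  refine (contMDiffAt_iff_contDiffAt.1 hcoord).congr_of_eventuallyEq ?_
  filter_upwards [(isOpen_extChartAt_target x).mem_nhds hy] with u hu
  have hA (v : F) : (trivializationAt F (TangentSpace I) x).symm ((extChartAt I x).symm u) v
      = mfderiv 𝓘(ℝ, F) I (extChartAt I x).symm u v := by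
    rw [← Trivialization.symmL_apply (R := ℝ) _ (hmem hu),
      TangentBundle.symmL_trivializationAt (hmem hu), (extChartAt I x).right_inv hu,
      I.range_eq_univ, mfderivWithin_univ]
    rfl
  ext v w
  rw [Function.comp_apply, hom_trivializationAt_apply,
    inCoordinates_apply_eq₂ (hmem hu) (hmem hu) (Set.mem_univ _)]
  simp only [hA]
  exact (LinearMap.congr_fun (Trivial.linearMapAt_trivialization ℝ M ℝ _) _).symm

theorem isRiemannianNear_chartMetric (g : RMetric I M) {y : F}
    (hy : y ∈ (extChartAt I x).target) : IsRiemannianNear (chartMetric g x) y := by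
  have htarget := (isOpen_extChartAt_target (I := I) x).mem_nhds hy
  refine ⟨Filter.mem_of_superset htarget fun _ => contDiffAt_chartMetric, .of_forall fun z v w =>
    g.symm _ _ _, Filter.mem_of_superset htarget fun z hz v hv => g.pos _ _ fun h => hv ?_⟩
  have hinv := isInvertible_mfderivWithin_extChartAt_symm (I := I) hz
  rw [I.range_eq_univ, mfderivWithin_univ] at hinv
  exact hinv.injective (h.trans (map_zero _).symm)

theorem IsIsometryNear.isPullbackNear (hf : IsIsometryNear g g' f x)
    (hdim : finrank ℝ F = finrank ℝ F') :
    IsPullbackNear (chartMetric g x) (chartMetric g' (f x))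
      (extChartAt I' (f x) ∘ f ∘ (extChartAt I x).symm) (extChartAt I x x) := by
  set A := extChartAt I x
  set B := extChartAt I' (f x)
  have hAx : A.symm (A x) = x := extChartAt_to_inv x
  have hA : Filter.Tendsto A.symm (𝓝 (A x)) (𝓝 x) := by
    have h := continuousAt_extChartAt_symm (I := I) x
    rwa [ContinuousAt, extChartAt_to_inv] at h
  have hB : ∀ᶠ u in 𝓝 (A x), f (A.symm u) ∈ B.source :=
    hA.eventually <| hf.smooth.self_of_nhds.continuousAt.eventually
      (extChartAt_source_mem_nhds (I := I') (f x))
  have hsmooth : ∀ᶠ u in 𝓝 (A x), ContDiffAt ℝ ∞ (B ∘ f ∘ A.symm) u := by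
    filter_upwards [hA.eventually hf.smooth, extChartAt_target_mem_nhds (I := I) x, hB]
      with u hfu hu hBu
    have hAu : ContMDiffAt 𝓘(ℝ, F) I ∞ A.symm u := (contMDiffOn_extChartAt_symm x).contMDiffAt
      ((isOpen_extChartAt_target x).mem_nhds hu)
    have hBfu : ContMDiffAt I' 𝓘(ℝ, F') ∞ B (f (A.symm u)) :=
      contMDiffAt_extChartAt' (by rwa [← extChartAt_source I'])
    exact contMDiffAt_iff_contDiffAt.1 (hBfu.comp u (hfu.comp u hAu))
  have hpullback : ∀ᶠ u in 𝓝 (A x), chartMetric g x u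
      = pullbackForm (chartMetric g' (f x) ((B ∘ f ∘ A.symm) u)) (fderiv ℝ (B ∘ f ∘ A.symm) u) := by
    filter_upwards [hA.eventually hf.eventually, extChartAt_target_mem_nhds (I := I) x,
      hB.eventually_nhds, hsmooth] with u hfu hu hBu hφ
    have hinv : B.symm ∘ B ∘ f ∘ A.symm =ᶠ[𝓝 u] f ∘ A.symm :=
      hBu.mono fun t ht => B.left_inv ht
    calc chartMetric g x u = pullbackMetric g' (f ∘ A.symm) u :=
          (hfu.pullbackMetric_comp (mdifferentiableAt_extChartAt_symm hu)).symm
      _ = pullbackMetric g' (B.symm ∘ B ∘ f ∘ A.symm) u := (pullbackMetric_congr hinv).symm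
      _ = _ := SphereTorusMetrics.pullbackMetric_comp
          (mdifferentiableAt_extChartAt_symm (B.map_source hBu.self_of_nhds))
          (hφ.differentiableAt (by simp))
  have hsource := isRiemannianNear_chartMetric g (mem_extChartAt_target (I := I) x)
  refine ⟨hsource, ?_, hsmooth, hdim, hpullback.mono fun u hu v w => by rw [hu]; rfl⟩
  rw [Function.comp_apply, Function.comp_apply, hAx]
  exact isRiemannianNear_chartMetric g' (mem_extChartAt_target (I := I') (f x))

variable [FiniteDimensional ℝ F] [FiniteDimensional ℝ F']

theorem IsIsometryNear.scalarCurvature_eq (hf : IsIsometryNear g g' f x)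
    (hdim : finrank ℝ F = finrank ℝ F') : scalarCurvature g x = scalarCurvature g' (f x) := by
  have h := (hf.isPullbackNear hdim).scalarCurvatureAt_eq
  rwa [Function.comp_apply, Function.comp_apply, extChartAt_to_inv] at h

end LocalIsometry

section Charts

variable {V W : Type*} [NormedAddCommGroup V] [InnerProductSpace ℝ V] [NormedAddCommGroup W]
  [InnerProductSpace ℝ W]

/-- The inverse of the stereographic projection from `-p`, in terms of an isometry `ι` of a
Euclidean space onto the orthogonal complement of `p`. -/
def invStereo (ι : V →ₗᵢ[ℝ] W) (p : W) (u : V) : W :=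
  (‖u‖ ^ 2 + 4)⁻¹ • ((4 : ℝ) • ι u - (‖u‖ ^ 2 - 4) • p)

theorem contDiff_invStereo (ι : V →ₗᵢ[ℝ] W) (p : W) : ContDiff ℝ ∞ (invStereo ι p) := by
  unfold invStereo
  have h : ContDiff ℝ ∞ fun u : V => ‖u‖ ^ 2 := contDiff_norm_sq ℝ
  refine ContDiff.smul (ContDiff.inv (h.add contDiff_const) fun u => by positivity) ?_
  exact ((contDiff_const (c := (4 : ℝ))).smul ι.toContinuousLinearMap.contDiff).sub
    ((h.sub contDiff_const).smul contDiff_const)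

theorem exists_extChartAt_sphere_symm (p : S2) :
    ∃ ι : E2 →ₗᵢ[ℝ] E3, (∀ u, inner ℝ (ι u) (p : E3) = 0) ∧
      ∀ u, ((extChartAt (𝓡 2) p).symm u : E3) = invStereo ι p u := by
  have : Fact (finrank ℝ E3 = 2 + 1) := ⟨by simp⟩
  let U := (OrthonormalBasis.fromOrthogonalSpanSingleton (𝕜 := ℝ) 2
    (ne_zero_of_mem_unit_sphere (-p))).repr
  refine ⟨(Submodule.subtypeₗᵢ _).comp U.symm.toLinearIsometry, fun u => ?_, fun u => ?_⟩
  · have h : inner ℝ ((U.symm u : (ℝ ∙ ((-p : S2) : E3))ᗮ) : E3) (-(p : E3)) = 0 :=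
      Submodule.mem_orthogonal_singleton_iff_inner_left.1 (U.symm u).2
    rwa [inner_neg_right, neg_eq_zero] at h
  · have h := stereographic'_symm_apply (n := 2) (-p) u
    have h2 : ((extChartAt (𝓡 2) p).symm u : E3) = (stereographic' 2 (-p)).symm u := rfl
    rw [h2, h]
    have hn : ‖((U.symm u : (ℝ ∙ ((-p : S2) : E3))ᗮ) : E3)‖ = ‖u‖ := U.symm.norm_map u
    change (‖((U.symm u : (ℝ ∙ ((-p : S2) : E3))ᗮ) : E3)‖ ^ 2 + 4)⁻¹ • (4 : ℝ) • (U.symm u : E3)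
      + (‖((U.symm u : (ℝ ∙ ((-p : S2) : E3))ᗮ) : E3)‖ ^ 2 + 4)⁻¹
        • (‖((U.symm u : (ℝ ∙ ((-p : S2) : E3))ᗮ) : E3)‖ ^ 2 - 4) • (-p : E3)
      = (‖u‖ ^ 2 + 4)⁻¹ • ((4 : ℝ) • (U.symm u : E3) - (‖u‖ ^ 2 - 4) • (p : E3))
    rw [hn, ← smul_add, smul_neg, ← sub_eq_add_neg]

theorem extChartAt_sphere_self (p : S2) : extChartAt (𝓡 2) p p = (0 : E2) := by
  have : Fact (finrank ℝ E3 = 2 + 1) := ⟨by simp⟩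
  change stereographic' 2 (-p) p = 0
  have h := stereographic_apply_neg (-p)
  rw [neg_neg] at h
  change (OrthonormalBasis.fromOrthogonalSpanSingleton (𝕜 := ℝ) 2
    (ne_zero_of_mem_unit_sphere (-p))).repr (stereographic (norm_eq_of_mem_sphere (-p)) p) = 0
  rw [h, map_zero]

variable (L : Submodule ℤ E2) [DiscreteTopology L]

theorem extChartAt_symm_fst (x : SphereTorus L) (y : E2 × E2) :
    ((extChartAt IST x).symm y).1 = (extChartAt (𝓡 2) x.1).symm y.1 := by
  rw [extChartAt_prod]; rfl

theorem extChartAt_symm_snd (x : SphereTorus L) (y : E2 × E2) :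
    ((extChartAt IST x).symm y).2 = QuotientAddGroup.mk y.2 := by
  rw [extChartAt_prod]
  exact mk_symm_of_mem_atlas L (chart_mem_atlas E2 x.2) y.2

/-- The metric `g_λ` in the coordinates given by a map `P : ℝ² → ℝ³` into the sphere. -/
def modelMetric (c : E2 →ₗ[ℝ] Matrix (Fin 3) (Fin 3) ℝ) (P : E2 → E3) (y : E2 × E2) :
    (E2 × E2) →L[ℝ] (E2 × E2) →L[ℝ] ℝ :=
  pullbackForm (innerSL ℝ) (fderiv ℝ P y.1 ∘L ContinuousLinearMap.fst ℝ E2 E2)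
    + pullbackForm (innerSL ℝ) (oneForm c (P y.1) ∘L fderiv ℝ P y.1
        ∘L ContinuousLinearMap.fst ℝ E2 E2 + ContinuousLinearMap.snd ℝ E2 E2)

theorem modelMetric_apply (c : E2 →ₗ[ℝ] Matrix (Fin 3) (Fin 3) ℝ) (P : E2 → E3) (y v w : E2 × E2) :
    modelMetric c P y v w = inner ℝ (fderiv ℝ P y.1 v.1) (fderiv ℝ P y.1 w.1)
      + inner ℝ (oneForm c (P y.1) (fderiv ℝ P y.1 v.1) + v.2)
        (oneForm c (P y.1) (fderiv ℝ P y.1 w.1) + w.2) := rfl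

theorem mem_extChartAt_target_of_snd {x : SphereTorus L} {y : E2 × E2}
    (hy : y.2 ∈ (chartAt E2 x.2).target) : y ∈ (extChartAt IST x).target := by
  rw [extChartAt_prod]
  have : Fact (finrank ℝ E3 = 2 + 1) := ⟨by simp⟩
  refine ⟨?_, by simpa [extChartAt] using hy⟩
  have h : (chartAt E2 x.1).target = univ := stereographic'_target (-x.1)
  change y.1 ∈ (extChartAt (𝓡 2) x.1).target
  rw [extChartAt_target, h]
  simp

theorem dSphere_comp_mfderiv_symm {x : SphereTorus L} {y : E2 × E2} {P : E2 → E3}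
    (hP : ∀ u, ((extChartAt (𝓡 2) x.1).symm u : E3) = P u) (hPd : DifferentiableAt ℝ P y.1)
    (hy : y.2 ∈ (chartAt E2 x.2).target) (v : E2 × E2) :
    dSphere L ((extChartAt IST x).symm y)
      (mfderiv 𝓘(ℝ, E2 × E2) IST (extChartAt IST x).symm y v) = fderiv ℝ P y.1 v.1 := by
  have hs := mdifferentiableAt_extChartAt_symm (I := IST) (mem_extChartAt_target_of_snd L hy)
  have hc : ContMDiff IST 𝓘(ℝ, E3) ∞ (fun y : SphereTorus L => (y.1 : E3)) := by
    have : Fact (finrank ℝ E3 = 2 + 1) := ⟨by simp⟩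
    exact contMDiff_coe_sphere.comp contMDiff_fst
  have h := mfderiv_comp y (hc.mdifferentiableAt (x := (extChartAt IST x).symm y) (by simp)) hs
  have e : (fun y : SphereTorus L => (y.1 : E3)) ∘ (extChartAt IST x).symm = P ∘ Prod.fst := by
    funext y
    simp only [Function.comp_apply]
    rw [extChartAt_symm_fst, hP]
  rw [e, mfderiv_eq_fderiv, fderiv_comp _ hPd differentiableAt_fst, fderiv_fst] at h
  exact (congrArg (fun A => A v) h).symm

theorem dTorus_comp_mfderiv_symm {x : SphereTorus L} {y : E2 × E2}
    (hy : y.2 ∈ (chartAt E2 x.2).target) (v : E2 × E2) :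
    dTorus L ((extChartAt IST x).symm y)
      (mfderiv 𝓘(ℝ, E2 × E2) IST (extChartAt IST x).symm y v) = v.2 := by
  have hs := mdifferentiableAt_extChartAt_symm (I := IST) (mem_extChartAt_target_of_snd L hy)
  set x' := (extChartAt IST x).symm y
  have hd : MDifferentiableAt IST 𝓘(ℝ, E2) (fun y : SphereTorus L => chartAt E2 x'.2 y.2) x' :=
    (mdifferentiableAt_atlas (chart_mem_atlas E2 x'.2) (mem_chart_source E2 x'.2)).comp x'
      mdifferentiableAt_snd
  have h := mfderiv_comp y hd hs
  have e : ((fun y : SphereTorus L => chartAt E2 x'.2 y.2) ∘ (extChartAt IST x).symm)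
      =ᶠ[𝓝 y] fun y' => y'.2 + (chartAt E2 x'.2 x'.2 - y.2) := by
    have hx2 : x'.2 = QuotientAddGroup.mk y.2 := extChartAt_symm_snd L x y
    have hcont : Continuous fun z : E2 => (QuotientAddGroup.mk z : Torus L) :=
      QuotientAddGroup.continuous_mk
    have h1 := eventually_sub_eq L (X := E2) (x := y.2)
      (a := fun z => chartAt E2 x'.2 (QuotientAddGroup.mk z)) (b := id)
      ((chartAt E2 x'.2).open_source.preimage hcont)
      (by rw [mem_preimage, ← hx2]; exact mem_chart_source E2 x'.2)
      ((chartAt E2 x'.2).continuousOn.comp hcont.continuousOn fun z hz => hz) continuousOn_id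
      (fun z hz => mk_of_mem_atlas L (chart_mem_atlas E2 x'.2) hz)
    filter_upwards [continuous_snd.continuousAt.eventually h1] with y' hy'
    simp only [Function.comp_apply]
    refine (congrArg (chartAt E2 x'.2) (extChartAt_symm_snd L x y')).trans (hy'.trans ?_)
    rw [hx2]; rfl
  rw [e.mfderiv_eq, mfderiv_eq_fderiv, fderiv_add_const, fderiv_snd] at h
  exact (congrArg (fun A => A v) h).symm

theorem chartMetric_metric (c : E2 →ₗ[ℝ] Matrix (Fin 3) (Fin 3) ℝ) {x : SphereTorus L}
    {y : E2 × E2} {P : E2 → E3}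
    (hP : ∀ u, ((extChartAt (𝓡 2) x.1).symm u : E3) = P u) (hPd : DifferentiableAt ℝ P y.1)
    (hy : y.2 ∈ (chartAt E2 x.2).target) :
    chartMetric (metric L c) x y = modelMetric c P y := by
  refine ContinuousLinearMap.ext fun v => ContinuousLinearMap.ext fun w => ?_
  have h1 := dSphere_comp_mfderiv_symm L hP hPd hy
  have h2 := dTorus_comp_mfderiv_symm L hy
  have h3 : (((extChartAt IST x).symm y).1 : E3) = P y.1 := by rw [extChartAt_symm_fst, hP]
  have h4 : ∀ v : E2 × E2, connectionForm L c ((extChartAt IST x).symm y)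
      (mfderiv 𝓘(ℝ, E2 × E2) IST (extChartAt IST x).symm y v)
      = oneForm c (P y.1) (fderiv ℝ P y.1 v.1) + v.2 := by
    intro v
    change oneForm c (((extChartAt IST x).symm y).1 : E3) (dSphere L ((extChartAt IST x).symm y)
        (mfderiv 𝓘(ℝ, E2 × E2) IST (extChartAt IST x).symm y v))
      + dTorus L ((extChartAt IST x).symm y)
        (mfderiv 𝓘(ℝ, E2 × E2) IST (extChartAt IST x).symm y v) = _
    rw [h1 v, h2 v, h3]
  refine (congrArg₂ (· + ·) (congrArg₂ (inner ℝ) (h1 v) (h1 w))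
    (congrArg₂ (inner ℝ) (h4 v) (h4 w)) :)

theorem eventually_snd_mem_target (x : SphereTorus L) :
    ∀ᶠ y in 𝓝 (extChartAt IST x x), y.2 ∈ (chartAt E2 x.2).target := by
  refine continuous_snd.continuousAt.eventually ((chartAt E2 x.2).open_target.mem_nhds ?_)
  rw [extChartAt_prod]
  exact (chartAt E2 x.2).map_source (mem_chart_source E2 x.2)

end Charts

section Stereographic

variable {V W : Type*} [NormedAddCommGroup V] [NormedAddCommGroup W]

/-- The factor `(‖u‖² + 4)⁻¹` in the inverse of the stereographic projection. -/
def stereoFactor (u : V) : ℝ := (‖u‖ ^ 2 + 4)⁻¹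

theorem stereoFactor_pos (u : V) : 0 < stereoFactor u := by unfold stereoFactor; positivity

theorem stereoFactor_zero : stereoFactor (0 : V) = 4⁻¹ := by simp [stereoFactor]

/-- The conformal factor of the inverse of the stereographic projection. -/
def conformalFactor (u : V) : ℝ := 16 * stereoFactor u ^ 2

theorem conformalFactor_pos (u : V) : 0 < conformalFactor u := by
  have := stereoFactor_pos u
  unfold conformalFactor; positivity

theorem conformalFactor_zero : conformalFactor (0 : V) = 1 := by
  simp [conformalFactor, stereoFactor_zero]; norm_num

variable [InnerProductSpace ℝ V] [InnerProductSpace ℝ W]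

theorem hasFDerivAt_stereoFactor (u : V) :
    HasFDerivAt stereoFactor ((-2 * stereoFactor u ^ 2) • innerSL ℝ u) u := by
  have h := ((hasStrictFDerivAt_norm_sq u).hasFDerivAt.add_const (4 : ℝ))
  have h2 := (hasDerivAt_inv (x := ‖u‖ ^ 2 + 4) (by positivity)).comp_hasFDerivAt u h
  refine h2.congr_fderiv ?_
  ext v
  simp only [neg_smul, neg_apply, smul_apply, coe_innerSL_apply, nsmul_eq_mul, Nat.cast_ofNat,
    smul_eq_mul, stereoFactor, inv_pow, neg_mul, neg_inj]
  ring

theorem fderiv_stereoFactor :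
    fderiv ℝ stereoFactor = fun u : V => (-2 * stereoFactor u ^ 2) • innerSL ℝ u :=
  funext fun u => (hasFDerivAt_stereoFactor u).fderiv

theorem hasFDerivAt_innerSL_pow (k : ℝ) (m : ℕ) :
    HasFDerivAt (fun u : V => (k * stereoFactor u ^ m) • (innerSL ℝ u : V →L[ℝ] ℝ))
      ((k * 4⁻¹ ^ m) • (innerSL ℝ : V →L[ℝ] V →L[ℝ] ℝ)) 0 := by
  have h := ((hasFDerivAt_stereoFactor (0 : V)).pow m).const_mul k
  have h2 := h.smul ((innerSL ℝ : V →L[ℝ] V →L[ℝ] ℝ).hasFDerivAt (x := 0))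
  refine h2.congr_fderiv ?_
  ext u v
  simp [stereoFactor_zero]

theorem fderiv_conformalFactor :
    fderiv ℝ conformalFactor = fun u : V => (-64 * stereoFactor u ^ 3) • innerSL ℝ u := by
  funext u
  have h := ((hasFDerivAt_stereoFactor u).pow 2).const_mul 16
  refine (h.congr_fderiv ?_).fderiv
  ext v
  simp only [Nat.add_one_sub_one, pow_one, nsmul_eq_mul, Nat.cast_ofNat, neg_mul, neg_smul,
    smul_neg, neg_apply, smul_apply, coe_innerSL_apply, smul_eq_mul, neg_inj]
  ring

theorem fderiv_conformalFactor_zero : fderiv ℝ conformalFactor (0 : V) = 0 := by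
  simp [fderiv_conformalFactor]

theorem fderiv_fderiv_conformalFactor_zero (s t : V) :
    fderiv ℝ (fderiv ℝ conformalFactor) 0 s t = -inner ℝ s t := by
  rw [fderiv_conformalFactor, (hasFDerivAt_innerSL_pow (-64) 3).fderiv]
  simp only [inv_pow, neg_mul, neg_smul, neg_apply, smul_apply, smul_eq_mul, neg_inj]
  norm_num
  rfl

theorem contDiff_stereoFactor : ContDiff ℝ ∞ (stereoFactor : V → ℝ) := by
  unfold stereoFactor
  exact ContDiff.inv ((contDiff_norm_sq ℝ).add contDiff_const) fun u => by positivity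

theorem contDiff_conformalFactor : ContDiff ℝ ∞ (conformalFactor : V → ℝ) :=
  contDiff_const.mul (contDiff_stereoFactor.pow 2)

variable (ι : V →ₗᵢ[ℝ] W) (p : W)

theorem invStereo_eq (u : V) :
    invStereo ι p u = stereoFactor u • ((4 : ℝ) • ι u + (8 : ℝ) • p) - p := by
  have h : ‖u‖ ^ 2 + 4 ≠ 0 := by positivity
  have h2 : stereoFactor u • (‖u‖ ^ 2 + 4) • p = p := by
    rw [stereoFactor, smul_smul, inv_mul_cancel₀ h, one_smul]
  calc invStereo ι p u
      = stereoFactor u • ((4 : ℝ) • ι u + (8 : ℝ) • p) - stereoFactor u • (‖u‖ ^ 2 + 4) • p := by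
        change stereoFactor u • _ = _
        module
    _ = _ := by rw [h2]

theorem invStereo_zero : invStereo ι p 0 = p := by
  rw [invStereo_eq, stereoFactor_zero, map_zero]; module

theorem hasFDerivAt_invStereo (u : V) : HasFDerivAt (invStereo ι p)
    (stereoFactor u • (4 : ℝ) • ι.toContinuousLinearMap
      + (fderiv ℝ stereoFactor u).smulRight ((4 : ℝ) • ι u + (8 : ℝ) • p)) u := by
  have h1 : HasFDerivAt (fun u => (4 : ℝ) • ι u + (8 : ℝ) • p)
      ((4 : ℝ) • ι.toContinuousLinearMap) u :=
    (ι.toContinuousLinearMap.hasFDerivAt.const_smul (4 : ℝ)).add_const _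
  have h := ((hasFDerivAt_stereoFactor u).smul h1).sub_const p
  rw [fderiv_stereoFactor]
  exact h.congr_of_eventuallyEq (Filter.Eventually.of_forall fun u => invStereo_eq ι p u)

theorem fderiv_invStereo_apply (u v : V) : fderiv ℝ (invStereo ι p) u v
    = (4 * stereoFactor u) • ι v
      + (-2 * stereoFactor u ^ 2 * inner ℝ u v) • ((4 : ℝ) • ι u + (8 : ℝ) • p) := by
  rw [(hasFDerivAt_invStereo ι p u).fderiv, fderiv_stereoFactor]
  simp [smul_smul, mul_comm]

theorem fderiv_invStereo_zero (v : V) : fderiv ℝ (invStereo ι p) 0 v = ι v := by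
  rw [fderiv_invStereo_apply, stereoFactor_zero]; simp

theorem fderiv_fderiv_invStereo_zero (s t : V) :
    fderiv ℝ (fderiv ℝ (invStereo ι p)) 0 s t = -(inner ℝ s t) • p := by
  have hd : HasFDerivAt (fderiv ℝ (invStereo ι p)) (fderiv ℝ (fderiv ℝ (invStereo ι p)) 0) 0 :=
    (((contDiff_invStereo ι p).fderiv_right (m := ∞) (by norm_cast)).differentiable
      (by simp) 0).hasFDerivAt
  have h := hd.clm_apply (hasFDerivAt_const t 0)
  have h0 : HasFDerivAt (fun u : V => (-2 * stereoFactor u ^ 2) * inner ℝ u t)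
      (((-2 * 4⁻¹ ^ 2 : ℝ) • (innerSL ℝ : V →L[ℝ] V →L[ℝ] ℝ)).flip t) 0 := by
    have := (hasFDerivAt_innerSL_pow (-2) 2).clm_apply (hasFDerivAt_const t 0)
    refine this.congr_fderiv ?_
    ext v; simp; rfl
  have h1 : HasFDerivAt (fun u => (4 : ℝ) • ι u + (8 : ℝ) • p)
      ((4 : ℝ) • ι.toContinuousLinearMap) 0 :=
    (ι.toContinuousLinearMap.hasFDerivAt.const_smul (4 : ℝ)).add_const _
  have h2 := ((((hasFDerivAt_stereoFactor (0 : V)).const_mul 4).smul_const (ι t))).add (h0.smul h1)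
  have he : (fun u => fderiv ℝ (invStereo ι p) u t) = fun u => (4 * stereoFactor u) • ι t
      + (-2 * stereoFactor u ^ 2 * inner ℝ u t) • ((4 : ℝ) • ι u + (8 : ℝ) • p) :=
    funext fun u => fderiv_invStereo_apply ι p u t
  rw [he] at h
  have := congrArg (fun A => A s) (h.unique h2)
  simp only [ContinuousLinearMap.comp_zero, zero_add, ContinuousLinearMap.flip_apply, neg_mul,
    map_zero, smul_zero, ContinuousLinearMap.zero_smulRight, inner_zero_left, mul_zero, zero_smul,
    inv_pow, neg_smul, ContinuousLinearMap.smulRight_apply, neg_apply, smul_apply,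
    coe_innerSL_apply, smul_eq_mul] at this
  rw [this, smul_smul]
  norm_num
  ring_nf

variable {ι p}

theorem inner_fderiv_invStereo (hι : ∀ u, inner ℝ (ι u) p = 0) (hp : ‖p‖ = 1) (u v w : V) :
    inner ℝ (fderiv ℝ (invStereo ι p) u v) (fderiv ℝ (invStereo ι p) u w)
      = conformalFactor u * inner ℝ v w := by
  have h1 : ∀ v w, inner ℝ (ι v) (ι w) = inner ℝ v w := ι.inner_map_map
  have hι' : ∀ u, inner ℝ p (ι u) = 0 := fun u => by rw [real_inner_comm, hι]
  have hpp : inner ℝ p p = 1 := by rw [real_inner_self_eq_norm_sq, hp]; norm_num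
  have hu : inner ℝ u u * stereoFactor u = 1 - 4 * stereoFactor u := by
    rw [real_inner_self_eq_norm_sq, stereoFactor]
    field_simp; ring
  rw [fderiv_invStereo_apply, fderiv_invStereo_apply]
  simp only [inner_add_left, inner_add_right, real_inner_smul_left, real_inner_smul_right, h1, hι,
    hι', hpp, conformalFactor]
  rw [real_inner_comm u v]
  linear_combination (64 * stereoFactor u ^ 3 * inner ℝ u v * inner ℝ u w) * hu

end Stereographic

section ModelMetric

theorem contDiff_pullbackForm_innerSL {E F G : Type*} [NormedAddCommGroup E] [NormedSpace ℝ E]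
    [NormedAddCommGroup F] [NormedSpace ℝ F] [NormedAddCommGroup G] [InnerProductSpace ℝ G]
    {B : E → F →L[ℝ] G} {n : WithTop ℕ∞} (hB : ContDiff ℝ n B) :
    ContDiff ℝ n fun y => pullbackForm (innerSL ℝ) (B y) := by
  have h : ContDiff ℝ n fun y => ContinuousLinearMap.precomp ℝ (B y) :=
    (ContinuousLinearMap.contDiff (ContinuousLinearMap.compL ℝ F G ℝ).flip).comp hB
  exact h.clm_comp (contDiff_const.clm_comp hB)

variable {c : E2 →ₗ[ℝ] Matrix (Fin 3) (Fin 3) ℝ} {ι : E2 →ₗᵢ[ℝ] E3} {p : E3}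

/-- The one-form `λ` in stereographic coordinates. -/
def chartForm (c : E2 →ₗ[ℝ] Matrix (Fin 3) (Fin 3) ℝ) (ι : E2 →ₗᵢ[ℝ] E3) (p : E3) (u : E2) :
    E2 →L[ℝ] E2 :=
  oneForm c (invStereo ι p u) ∘L fderiv ℝ (invStereo ι p) u

theorem contDiff_chartForm : ContDiff ℝ ∞ (chartForm c ι p) :=
  ((contDiff_oneForm c).comp (contDiff_invStereo ι p)).clm_comp
    ((contDiff_invStereo ι p).fderiv_right (m := ∞) (by norm_cast))

theorem modelMetric_invStereo_apply (hι : ∀ u, inner ℝ (ι u) p = 0) (hp : ‖p‖ = 1)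
    (y v w : E2 × E2) :
    modelMetric c (invStereo ι p) y v w = conformalFactor y.1 * inner ℝ v.1 w.1
      + inner ℝ (chartForm c ι p y.1 v.1 + v.2) (chartForm c ι p y.1 w.1 + w.2) := by
  rw [modelMetric_apply, inner_fderiv_invStereo hι hp]; rfl

theorem contDiff_modelMetric : ContDiff ℝ ∞ (modelMetric c (invStereo ι p)) := by
  have hP := contDiff_invStereo ι p
  have hfd : ContDiff ℝ ∞ (fderiv ℝ (invStereo ι p)) := hP.fderiv_right (m := ∞) (by norm_cast)
  have h1 : ContDiff ℝ ∞ fun y : E2 × E2 =>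
      fderiv ℝ (invStereo ι p) y.1 ∘L ContinuousLinearMap.fst ℝ E2 E2 :=
    (hfd.comp contDiff_fst).clm_comp contDiff_const
  have h2 : ContDiff ℝ ∞ fun y : E2 × E2 => oneForm c (invStereo ι p y.1)
      ∘L fderiv ℝ (invStereo ι p) y.1 ∘L ContinuousLinearMap.fst ℝ E2 E2
        + ContinuousLinearMap.snd ℝ E2 E2 :=
    (((contDiff_oneForm c).comp (hP.comp contDiff_fst)).clm_comp h1).add contDiff_const
  exact (contDiff_pullbackForm_innerSL h1).add (contDiff_pullbackForm_innerSL h2)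

theorem isRiemannianNear_modelMetric (hι : ∀ u, inner ℝ (ι u) p = 0) (hp : ‖p‖ = 1)
    (y : E2 × E2) : IsRiemannianNear (modelMetric c (invStereo ι p)) y := by
  refine ⟨.of_forall fun y => contDiff_modelMetric.contDiffAt, .of_forall fun y v w => ?_,
    .of_forall fun y v hv => ?_⟩
  · rw [modelMetric_apply, modelMetric_apply, real_inner_comm,
      real_inner_comm (oneForm c (invStereo ι p y.1) (fderiv ℝ (invStereo ι p) y.1 v.1) + v.2)]
  · rw [modelMetric_invStereo_apply hι hp]
    have h1 := conformalFactor_pos y.1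
    by_contra! h
    have h2 := real_inner_self_nonneg (x := v.1)
    have h3 := real_inner_self_nonneg (x := chartForm c ι p y.1 v.1 + v.2)
    have h4 : inner ℝ v.1 v.1 = 0 := by
      have := mul_nonneg h1.le h2
      have : conformalFactor y.1 * inner ℝ v.1 v.1 = 0 := by linarith
      exact (mul_eq_zero.1 this).resolve_left h1.ne'
    have h5 : inner ℝ (chartForm c ι p y.1 v.1 + v.2) (chartForm c ι p y.1 v.1 + v.2) = 0 := by
      rw [h4] at h; linarith
    have e1 : v.1 = 0 := inner_self_eq_zero (𝕜 := ℝ).1 h4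
    have e2 := inner_self_eq_zero (𝕜 := ℝ).1 h5
    rw [e1, map_zero, zero_add] at e2
    exact hv (Prod.ext e1 e2)

theorem fderiv_modelMetric (hι : ∀ u, inner ℝ (ι u) p = 0) (hp : ‖p‖ = 1)
    (y s v w : E2 × E2) :
    fderiv ℝ (modelMetric c (invStereo ι p)) y s v w
      = fderiv ℝ conformalFactor y.1 s.1 * inner ℝ v.1 w.1
        + (inner ℝ (chartForm c ι p y.1 v.1 + v.2) (fderiv ℝ (chartForm c ι p) y.1 s.1 w.1)
        + inner ℝ (fderiv ℝ (chartForm c ι p) y.1 s.1 v.1) (chartForm c ι p y.1 w.1 + w.2)) := by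
  have hL := (((contDiff_modelMetric (c := c) (ι := ι) (p := p)).differentiable
    (by simp) y).hasFDerivAt.clm_apply (hasFDerivAt_const v y)).clm_apply (hasFDerivAt_const w y)
  have hρ : HasFDerivAt (fun y : E2 × E2 => conformalFactor y.1) _ y :=
    (contDiff_conformalFactor.differentiable (by simp) y.1).hasFDerivAt.comp y hasFDerivAt_fst
  have hA : HasFDerivAt (fun y : E2 × E2 => chartForm c ι p y.1) _ y :=
    (contDiff_chartForm.differentiable (by simp) y.1).hasFDerivAt.comp y hasFDerivAt_fst
  have hω := fun a : E2 × E2 => (hA.clm_apply (hasFDerivAt_const a.1 y)).add_const a.2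
  have hR := (hρ.mul_const (inner ℝ v.1 w.1)).add ((hω v).inner ℝ (hω w))
  have he : (fun y => modelMetric c (invStereo ι p) y v w) = _ :=
    funext fun y => modelMetric_invStereo_apply hι hp y v w
  rw [he] at hL
  have := congrArg (fun A => A s) (hL.unique hR)
  simpa [mul_comm] using this

theorem fderiv_fderiv_modelMetric (hι : ∀ u, inner ℝ (ι u) p = 0) (hp : ‖p‖ = 1)
    (y t s v w : E2 × E2) :
    fderiv ℝ (fderiv ℝ (modelMetric c (invStereo ι p))) y t s v w
      = fderiv ℝ (fderiv ℝ conformalFactor) y.1 t.1 s.1 * inner ℝ v.1 w.1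
        + ((inner ℝ (chartForm c ι p y.1 v.1 + v.2)
            (fderiv ℝ (fderiv ℝ (chartForm c ι p)) y.1 t.1 s.1 w.1)
          + inner ℝ (fderiv ℝ (chartForm c ι p) y.1 t.1 v.1)
            (fderiv ℝ (chartForm c ι p) y.1 s.1 w.1))
        + (inner ℝ (fderiv ℝ (chartForm c ι p) y.1 s.1 v.1)
            (fderiv ℝ (chartForm c ι p) y.1 t.1 w.1)
          + inner ℝ (fderiv ℝ (fderiv ℝ (chartForm c ι p)) y.1 t.1 s.1 v.1)
            (chartForm c ι p y.1 w.1 + w.2))) := by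
  have hL := ((((contDiff_modelMetric (c := c) (ι := ι) (p := p)).fderiv_right (m := ∞)
    (by norm_cast)).differentiable (by simp) y).hasFDerivAt.clm_apply
      (hasFDerivAt_const s y)).clm_apply (hasFDerivAt_const v y)
        |>.clm_apply (hasFDerivAt_const w y)
  have hρ : HasFDerivAt (fun y : E2 × E2 => fderiv ℝ conformalFactor y.1) _ y :=
    ((contDiff_conformalFactor.fderiv_right (m := ∞) (by norm_cast)).differentiable
      (by simp) y.1).hasFDerivAt.comp y hasFDerivAt_fst
  have hA : HasFDerivAt (fun y : E2 × E2 => chartForm c ι p y.1) _ y :=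
    (contDiff_chartForm.differentiable (by simp) y.1).hasFDerivAt.comp y hasFDerivAt_fst
  have hA' : HasFDerivAt (fun y : E2 × E2 => fderiv ℝ (chartForm c ι p) y.1) _ y :=
    (((contDiff_chartForm (c := c) (ι := ι) (p := p)).fderiv_right (m := ∞)
      (by norm_cast)).differentiable (by simp) y.1).hasFDerivAt.comp y hasFDerivAt_fst
  have hω := fun a : E2 × E2 => (hA.clm_apply (hasFDerivAt_const a.1 y)).add_const a.2
  have hω' := fun a : E2 × E2 =>
    (hA'.clm_apply (hasFDerivAt_const s.1 y)).clm_apply (hasFDerivAt_const a.1 y)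
  have hR := ((hρ.clm_apply (hasFDerivAt_const s.1 y)).mul_const (inner ℝ v.1 w.1)).add
    (((hω v).inner ℝ (hω' w)).add ((hω' v).inner ℝ (hω w)))
  have he : (fun y => fderiv ℝ (modelMetric c (invStereo ι p)) y s v w) = _ :=
    funext fun y => fderiv_modelMetric hι hp y s v w
  rw [he] at hL
  have := congrArg (fun A => A t) (hL.unique hR)
  simpa [mul_comm] using this

theorem chartForm_zero (u : E2) : chartForm c ι p 0 u = oneForm c p (ι u) := by
  rw [chartForm, ContinuousLinearMap.comp_apply, invStereo_zero, fderiv_invStereo_zero]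

theorem fderiv_chartForm_zero (s t : E2) : fderiv ℝ (chartForm c ι p) 0 s t
    = fderiv ℝ (oneForm c) p (ι s) (ι t) - inner ℝ s t • oneForm c p p := by
  have hP : HasFDerivAt (invStereo ι p) (fderiv ℝ (invStereo ι p) 0) 0 :=
    ((contDiff_invStereo ι p).differentiable (by simp) 0).hasFDerivAt
  have hP' : HasFDerivAt (fderiv ℝ (invStereo ι p)) (fderiv ℝ (fderiv ℝ (invStereo ι p)) 0) 0 :=
    (((contDiff_invStereo ι p).fderiv_right (m := ∞) (by norm_cast)).differentiable
      (by simp) 0).hasFDerivAt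
  have hc : HasFDerivAt (oneForm c) (fderiv ℝ (oneForm c) (invStereo ι p 0)) (invStereo ι p 0) :=
    ((contDiff_oneForm c).differentiable (by simp) _).hasFDerivAt
  have h : HasFDerivAt (chartForm c ι p) _ 0 := (hc.comp 0 hP).clm_comp hP'
  rw [h.fderiv]
  simp only [Function.comp_apply, invStereo_zero, add_apply, ContinuousLinearMap.comp_apply,
    ContinuousLinearMap.compL_apply, fderiv_invStereo_zero, ContinuousLinearMap.flip_apply,
    fderiv_fderiv_invStereo_zero, neg_smul, map_neg, map_smul]
  abel

end ModelMetric

section Curvature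

variable {c : E2 →ₗ[ℝ] Matrix (Fin 3) (Fin 3) ℝ} {ι : E2 →ₗᵢ[ℝ] E3} {p : E3}

/-- The basis `(eᵢ, -A eᵢ)`, `(0, eₐ)` of `ℝ² × ℝ²`. -/
def shearBasis (A : E2 →L[ℝ] E2) : Basis (Fin 2 ⊕ Fin 2) ℝ (E2 × E2) :=
  ((EuclideanSpace.basisFun (Fin 2) ℝ).toBasis.prod (EuclideanSpace.basisFun (Fin 2) ℝ).toBasis).map
    ((LinearEquiv.refl ℝ E2).skewProd (LinearEquiv.refl ℝ E2) (-(A : E2 →ₗ[ℝ] E2)))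

theorem shearBasis_inl (A : E2 →L[ℝ] E2) (i : Fin 2) :
    shearBasis A (Sum.inl i) = (EuclideanSpace.single i 1, -A (EuclideanSpace.single i 1)) := by
  simp [shearBasis]

theorem shearBasis_inr (A : E2 →L[ℝ] E2) (i : Fin 2) :
    shearBasis A (Sum.inr i) = (0, EuclideanSpace.single i 1) := by
  simp [shearBasis]

theorem isOrthonormalFor_shearBasis (hι : ∀ u, inner ℝ (ι u) p = 0) (hp : ‖p‖ = 1) (z : E2) :
    IsOrthonormalFor (modelMetric c (invStereo ι p) (0, z)) (shearBasis (chartForm c ι p 0)) := by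
  intro i j
  rw [modelMetric_invStereo_apply hι hp]
  rcases i with i | i <;> rcases j with j | j <;>
    simp [shearBasis_inl, shearBasis_inr, conformalFactor_zero, EuclideanSpace.inner_single_left]

/-- The partial derivatives `∂ᵢ A_{ja}` of the one-form `λ` at the origin. -/
def formDeriv (c : E2 →ₗ[ℝ] Matrix (Fin 3) (Fin 3) ℝ) (ι : E2 →ₗᵢ[ℝ] E3) (p : E3)
    (i j a : Fin 2) : ℝ :=
  fderiv ℝ (chartForm c ι p) 0 (EuclideanSpace.single i 1) (EuclideanSpace.single j 1) a

/-- The Christoffel symbols of the first kind of `g_λ` in the basis `shearBasis`. -/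
def koszulTable (α : Fin 2 → Fin 2 → Fin 2 → ℝ) : Fin 2 ⊕ Fin 2 → Fin 2 ⊕ Fin 2 → Fin 2 ⊕ Fin 2 → ℝ
  | .inl i, .inl j, .inr a => 2⁻¹ * (α i j a + α j i a)
  | .inl i, .inr a, .inl j => 2⁻¹ * (α i j a - α j i a)
  | .inr a, .inl i, .inl j => 2⁻¹ * (α i j a - α j i a)
  | _, _, _ => 0

theorem koszul_modelMetric (hι : ∀ u, inner ℝ (ι u) p = 0) (hp : ‖p‖ = 1) (z : E2)
    (i j k : Fin 2 ⊕ Fin 2) :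
    koszul (modelMetric c (invStereo ι p)) (0, z) (shearBasis (chartForm c ι p 0) i)
      (shearBasis (chartForm c ι p 0) j) (shearBasis (chartForm c ι p 0) k)
      = koszulTable (formDeriv c ι p) i j k := by
  rw [koszul_apply, fderiv_modelMetric hι hp, fderiv_modelMetric hι hp, fderiv_modelMetric hι hp]
  rcases i with i | i <;> rcases j with j | j <;> rcases k with k | k <;>
    simp [shearBasis_inl, shearBasis_inr, fderiv_conformalFactor_zero, koszulTable, formDeriv,
      EuclideanSpace.inner_single_left, EuclideanSpace.inner_single_right]

theorem scalarCurvatureAt_modelMetric (hι : ∀ u, inner ℝ (ι u) p = 0) (hp : ‖p‖ = 1) (z : E2) :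
    scalarCurvatureAt (modelMetric c (invStereo ι p)) (0, z)
      = 2 - 2⁻¹ * ∑ a, (formDeriv c ι p 0 1 a - formDeriv c ι p 1 0 a) ^ 2 := by
  have hg := isRiemannianNear_modelMetric (c := c) hι hp (0, z)
  have ho := isOrthonormalFor_shearBasis (c := c) hι hp z
  rw [hg.scalarCurvatureAt_eq_sum ho]
  simp_rw [hg.inner_riemann, hg.inner_christoffel_christoffel ho, koszul_modelMetric hι hp,
    fderiv_fderiv_modelMetric hι hp]
  simp only [Fintype.sum_sum_type, Fin.sum_univ_two, koszulTable, shearBasis_inl, shearBasis_inr]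
  simp only [Fin.isValue, fderiv_fderiv_conformalFactor_zero, inner_self_eq_norm_sq_to_K,
    PiLp.norm_single, norm_one, Real.ringHom_apply, one_pow, mul_one, add_neg_cancel,
    inner_zero_left, EuclideanSpace.real_norm_sq_eq, Fin.sum_univ_two, zero_add, inner_zero_right,
    add_zero, sub_self, zero_sub, neg_add_rev, neg_neg, add_add_neg_add_cancel, mul_zero,
    formDeriv, sub_add_cancel, PiLp.inner_apply, PiLp.single_apply, RCLike.inner_apply,
    MonoidWithZeroHom.map_ite_one_zero, mul_ite, Finset.sum_ite_eq', Finset.mem_univ, ↓reduceIte,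
    one_ne_zero, neg_zero, zero_ne_one, map_zero, zero_apply, norm_zero, ne_eq,
    OfNat.ofNat_ne_zero, not_false_eq_true, zero_pow, zero_mul]
  ring

end Curvature

section OneForm

variable (c : E2 →ₗ[ℝ] Matrix (Fin 3) (Fin 3) ℝ)

theorem oneForm_apply (x X : E3) (a : Fin 2) :
    oneForm c x X a = ((c (EuclideanSpace.single a 1) *ᵥ x.ofLp) ⨯₃ x.ofLp) ⬝ᵥ X.ofLp := by
  have h := oneForm_inner c x X (EuclideanSpace.single a 1)
  rw [EuclideanSpace.inner_single_right] at h
  simpa [PiLp.inner_apply, dotProduct, mul_comm] using h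

theorem oneForm_self (x : E3) : oneForm c x x = 0 := by
  ext a
  rw [oneForm_apply, dotProduct_comm, dot_cross_self]
  rfl

theorem oneForm_add_smul_apply (x s X : E3) (t : ℝ) (a : Fin 2) :
    oneForm c (x + t • s) X a = oneForm c x X a
      + t * (((c (EuclideanSpace.single a 1) *ᵥ s.ofLp) ⨯₃ x.ofLp
        + (c (EuclideanSpace.single a 1) *ᵥ x.ofLp) ⨯₃ s.ofLp) ⬝ᵥ X.ofLp)
      + t ^ 2 * oneForm c s X a := by
  simp only [oneForm_apply, WithLp.ofLp_add, WithLp.ofLp_smul, Matrix.mulVec_add,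
    Matrix.mulVec_smul, map_add, map_smul, LinearMap.add_apply, LinearMap.smul_apply,
    add_dotProduct, smul_dotProduct, smul_eq_mul]
  ring

theorem fderiv_oneForm_apply (x s X : E3) (a : Fin 2) :
    fderiv ℝ (oneForm c) x s X a
      = ((c (EuclideanSpace.single a 1) *ᵥ s.ofLp) ⨯₃ x.ofLp
        + (c (EuclideanSpace.single a 1) *ᵥ x.ofLp) ⨯₃ s.ofLp) ⬝ᵥ X.ofLp := by
  let T : (E3 →L[ℝ] E2) →L[ℝ] ℝ :=
    (EuclideanSpace.proj a : E2 →L[ℝ] ℝ) ∘L ContinuousLinearMap.apply ℝ E2 X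
  have hline : HasDerivAt (fun t : ℝ => x + t • s) s 0 := by
    simpa using ((hasDerivAt_id (0 : ℝ)).smul_const s).const_add x
  have hform : HasFDerivAt (oneForm c) (fderiv ℝ (oneForm c) x) (x + (0 : ℝ) • s) := by
    rw [zero_smul, add_zero]
    exact ((contDiff_oneForm c).differentiable (by simp) x).hasFDerivAt
  have hcomp : HasDerivAt (fun t : ℝ => oneForm c (x + t • s) X a)
      (fderiv ℝ (oneForm c) x s X a) 0 := by
    have hT := (T.hasFDerivAt (x := oneForm c (x + (0 : ℝ) • s))).comp (x + (0 : ℝ) • s) hform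
    exact hT.comp_hasDerivAt (0 : ℝ) hline
  refine hcomp.unique ?_
  simp_rw [oneForm_add_smul_apply]
  have hquad (A B C : ℝ) : HasDerivAt (fun t : ℝ => A + t * B + t ^ 2 * C) B 0 := by
    have h : HasDerivAt (fun t : ℝ => A + t * B + t ^ 2 * C) (1 * B + 2 * 0 ^ 1 * 1 * C) 0 :=
      (((hasDerivAt_id (0 : ℝ)).mul_const B).const_add A).add
        (((hasDerivAt_id (0 : ℝ)).pow 2).mul_const C)
    simpa using h
  exact hquad _ _ _

variable {c}

theorem cross_mulVec_alternating {M : Matrix (Fin 3) (Fin 3) ℝ} (hs : M.IsSymm)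
    (ht : M.trace = 0) (v w q : Fin 3 → ℝ) :
    ((M *ᵥ v) ⨯₃ q + (M *ᵥ q) ⨯₃ v) ⬝ᵥ w - ((M *ᵥ w) ⨯₃ q + (M *ᵥ q) ⨯₃ w) ⬝ᵥ v
      = 3 * ((v ⨯₃ w) ⬝ᵥ (M *ᵥ q)) := by
  have h1 := hs.apply 0 1
  have h2 := hs.apply 0 2
  have h3 := hs.apply 1 2
  have h4 : M 2 2 = -M 0 0 - M 1 1 := by
    rw [Matrix.trace_fin_three] at ht; linarith
  simp only [dotProduct, cross_apply, Nat.succ_eq_add_one, Nat.reduceAdd, Matrix.mulVec,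
    Fin.isValue, Fin.sum_univ_three, h1, h2, h3, h4, Pi.add_apply, Matrix.cons_val_zero,
    Matrix.cons_val_one, Matrix.cons_val]
  ring

theorem divergence_cross_mulVec {M : Matrix (Fin 3) (Fin 3) ℝ} (hs : M.IsSymm)
    (x : Fin 3 → ℝ) :
    ∑ i, ((M *ᵥ Pi.single i 1) ⨯₃ x + (M *ᵥ x) ⨯₃ Pi.single i 1) ⬝ᵥ Pi.single i 1 = 0 := by
  have h1 := hs.apply 0 1
  have h2 := hs.apply 0 2
  have h3 := hs.apply 1 2
  simp [Fin.sum_univ_three, cross_apply, Matrix.mulVec, dotProduct, Pi.single_apply, h1, h2, h3]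

theorem cross_dotProduct_sq (v w q : Fin 3 → ℝ) :
    ((v ⨯₃ w) ⬝ᵥ q) ^ 2 = (v ⬝ᵥ v) * (w ⬝ᵥ w) * (q ⬝ᵥ q) + 2 * (v ⬝ᵥ w) * (w ⬝ᵥ q) * (v ⬝ᵥ q)
      - (v ⬝ᵥ v) * (w ⬝ᵥ q) ^ 2 - (w ⬝ᵥ w) * (v ⬝ᵥ q) ^ 2 - (q ⬝ᵥ q) * (v ⬝ᵥ w) ^ 2 := by
  simp only [dotProduct, cross_apply, Nat.succ_eq_add_one, Nat.reduceAdd, Fin.isValue,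
    Fin.sum_univ_three, Matrix.cons_val_zero, Matrix.cons_val_one, Matrix.cons_val]
  ring

end OneForm

section Frame

variable {ι : E2 →ₗᵢ[ℝ] E3} {p : E3}

theorem exists_frame (hι : ∀ u, inner ℝ (ι u) p = 0) (hp : ‖p‖ = 1) :
    ∃ b : OrthonormalBasis (Fin 3) ℝ E3, b 0 = ι (EuclideanSpace.single 0 1) ∧
      b 1 = ι (EuclideanSpace.single 1 1) ∧ b 2 = p := by
  have hon : Orthonormal ℝ ![ι (EuclideanSpace.single 0 1), ι (EuclideanSpace.single 1 1), p] := by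
    have hι' : ∀ u, inner ℝ p (ι u) = 0 := fun u => by rw [real_inner_comm, hι]
    rw [orthonormal_iff_ite]
    intro i j
    fin_cases i <;> fin_cases j <;>
      simp [hι, hι', hp, LinearIsometry.inner_map_map, EuclideanSpace.inner_single_left]
  let b := (basisOfOrthonormalOfCardEqFinrank hon (by simp)).toOrthonormalBasis (by
    rw [coe_basisOfOrthonormalOfCardEqFinrank]; exact hon)
  have hb : ⇑b = ![ι (EuclideanSpace.single 0 1), ι (EuclideanSpace.single 1 1), p] := by
    simp [b]
  exact ⟨b, by rw [hb]; rfl, by rw [hb]; rfl, by rw [hb]; rfl⟩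

theorem dotProduct_eq_inner (x y : E3) : x.ofLp ⬝ᵥ y.ofLp = inner ℝ x y := by
  simp [PiLp.inner_apply, dotProduct, mul_comm]

theorem cross_frame_sq (hι : ∀ u, inner ℝ (ι u) p = 0) (hp : ‖p‖ = 1) (q : E3) :
    (((ι (EuclideanSpace.single 0 1)).ofLp ⨯₃ (ι (EuclideanSpace.single 1 1)).ofLp)
      ⬝ᵥ q.ofLp) ^ 2 = (p.ofLp ⬝ᵥ q.ofLp) ^ 2 := by
  obtain ⟨b, h0, h1, h2⟩ := exists_frame hι hp
  have hsum := b.sum_inner_mul_inner q q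
  have ho : ∀ i j, inner ℝ (b i) (b j) = if i = j then 1 else 0 :=
    orthonormal_iff_ite.1 b.orthonormal
  rw [Fin.sum_univ_three] at hsum
  rw [cross_dotProduct_sq, ← h0, ← h1, ← h2]
  simp only [dotProduct_eq_inner, ho]
  rw [real_inner_comm (b 0) q, real_inner_comm (b 1) q, real_inner_comm (b 2) q] at hsum
  simp only [↓reduceIte, mul_one, inner_self_eq_norm_sq_to_K, Real.ringHom_apply, one_mul,
    Fin.isValue, zero_ne_one, mul_zero, zero_mul, add_zero, ne_eq, OfNat.ofNat_ne_zero,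
    not_false_eq_true, zero_pow, sub_zero]
  rw [real_inner_self_eq_norm_sq] at hsum
  linarith

end Frame

section ScalarCurvature

variable {c : E2 →ₗ[ℝ] Matrix (Fin 3) (Fin 3) ℝ} {ι : E2 →ₗᵢ[ℝ] E3} {p : E3}

theorem formDeriv_eq (i j a : Fin 2) : formDeriv c ι p i j a
    = fderiv ℝ (oneForm c) p (ι (EuclideanSpace.single i 1)) (ι (EuclideanSpace.single j 1)) a := by
  rw [formDeriv, fderiv_chartForm_zero, oneForm_self, smul_zero, sub_zero]

theorem chartMetric_eventuallyEq (L : Submodule ℤ E2) [DiscreteTopology L] {x : SphereTorus L}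
    (h : ∀ u, ((extChartAt (𝓡 2) x.1).symm u : E3) = invStereo ι x.1 u) :
    chartMetric (metric L c) x =ᶠ[𝓝 (extChartAt IST x x)] modelMetric c (invStereo ι x.1) := by
  filter_upwards [eventually_snd_mem_target L x] with y hy
  exact chartMetric_metric L c h ((contDiff_invStereo ι x.1).differentiable (by simp) _) hy

theorem extChartAt_self_eq (L : Submodule ℤ E2) [DiscreteTopology L] (x : SphereTorus L) :
    extChartAt IST x x = ((0 : E2), chartAt E2 x.2 x.2) := by
  refine Prod.ext ?_ ?_
  · rw [extChartAt_prod]; exact extChartAt_sphere_self x.1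
  · rw [extChartAt_prod]; rfl

theorem scalarCurvature_metric (hs : ∀ Z, (c Z).IsSymm) (ht : ∀ Z, (c Z).trace = 0)
    (L : Submodule ℤ E2) [DiscreteTopology L] (x : SphereTorus L) :
    scalarCurvature (metric L c) x = 2 - 9 / 2 * ∑ a,
      ((x.1 : E3).ofLp ⬝ᵥ (c (EuclideanSpace.single a 1) *ᵥ (x.1 : E3).ofLp)) ^ 2 := by
  obtain ⟨ι, hι, h⟩ := exists_extChartAt_sphere_symm x.1
  have hp : ‖(x.1 : E3)‖ = 1 := norm_eq_of_mem_sphere x.1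
  have h1 : scalarCurvature (metric L c) x
      = scalarCurvatureAt (chartMetric (metric L c) x) (extChartAt IST x x) := rfl
  rw [h1, scalarCurvatureAt_congr (chartMetric_eventuallyEq L h), extChartAt_self_eq,
    scalarCurvatureAt_modelMetric hι hp]
  have key : ∀ a, (formDeriv c ι x.1 0 1 a - formDeriv c ι x.1 1 0 a) ^ 2
      = 9 * ((x.1 : E3).ofLp ⬝ᵥ (c (EuclideanSpace.single a 1) *ᵥ (x.1 : E3).ofLp)) ^ 2 := by
    intro a
    rw [formDeriv_eq, formDeriv_eq, fderiv_oneForm_apply, fderiv_oneForm_apply,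
      cross_mulVec_alternating (hs _) (ht _), mul_pow]
    have := cross_frame_sq hι hp
      (WithLp.toLp 2 (c (EuclideanSpace.single a 1) *ᵥ (x.1 : E3).ofLp))
    rw [this]
    norm_num
  simp_rw [key, ← Finset.mul_sum]
  ring

end ScalarCurvature

section SecondDerivative

variable {E F G : Type*} [NormedAddCommGroup E] [NormedSpace ℝ E] [NormedAddCommGroup F]
  [NormedSpace ℝ F] [NormedAddCommGroup G] [NormedSpace ℝ G]

theorem fderiv_fderiv_comp {f : F → G} {φ : E → F} {x : E} (hf : ContDiffAt ℝ 2 f (φ x))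
    (hφ : ContDiffAt ℝ 2 φ x) (u v : E) :
    fderiv ℝ (fderiv ℝ (f ∘ φ)) x u v
      = fderiv ℝ (fderiv ℝ f) (φ x) (fderiv ℝ φ x u) (fderiv ℝ φ x v)
        + fderiv ℝ f (φ x) (fderiv ℝ (fderiv ℝ φ) x u v) := by
  have hf' : HasFDerivAt (fderiv ℝ f) (fderiv ℝ (fderiv ℝ f) (φ x)) (φ x) :=
    ((hf.fderiv_right (m := 1) (by norm_num)).differentiableAt (by simp)).hasFDerivAt
  have hφ' : HasFDerivAt (fderiv ℝ φ) (fderiv ℝ (fderiv ℝ φ) x) x :=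
    ((hφ.fderiv_right (m := 1) (by norm_num)).differentiableAt (by simp)).hasFDerivAt
  have hφ1 : HasFDerivAt φ (fderiv ℝ φ x) x := (hφ.differentiableAt (by simp)).hasFDerivAt
  have he : fderiv ℝ (f ∘ φ) =ᶠ[𝓝 x] fun y => (fderiv ℝ f (φ y)) ∘L (fderiv ℝ φ y) := by
    filter_upwards [hφ.eventually (by simp),
      hφ.continuousAt.eventually (hf.eventually (by simp))] with y h1 h2
    exact fderiv_comp y (h2.differentiableAt (by simp)) (h1.differentiableAt (by simp))
  have hc : HasFDerivAt (fun y => (fderiv ℝ f (φ y)) ∘L (fderiv ℝ φ y)) _ x :=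
    (hf'.comp x hφ1).clm_comp hφ'
  rw [he.fderiv_eq, hc.fderiv]
  simp only [Function.comp_apply, add_apply, ContinuousLinearMap.comp_apply,
    ContinuousLinearMap.compL_apply, ContinuousLinearMap.flip_apply]
  abel

/-- The second derivative of `f` at `x` in the direction `v`. -/
def secondDeriv (f : E → G) (x v : E) : G := fderiv ℝ (fderiv ℝ f) x v v

theorem secondDeriv_comp {f : F → G} {φ : E → F} {x : E} (hf : ContDiffAt ℝ 2 f (φ x))
    (hφ : ContDiffAt ℝ 2 φ x) (v : E) :
    secondDeriv (f ∘ φ) x v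
      = secondDeriv f (φ x) (fderiv ℝ φ x v) + fderiv ℝ f (φ x) (secondDeriv φ x v) :=
  fderiv_fderiv_comp hf hφ v v

theorem secondDeriv_comp_clm {f : F → G} (T : E →L[ℝ] F) {x : E} (hf : ContDiffAt ℝ 2 f (T x))
    (v : E) : secondDeriv (f ∘ T) x v = secondDeriv f (T x) (T v) := by
  have hT : fderiv ℝ (T : E → F) = fun _ => T := funext fun y => T.fderiv
  have hT2 : secondDeriv T x v = 0 := by
    rw [secondDeriv, hT, fderiv_fun_const]
    rfl
  rw [secondDeriv_comp hf T.contDiff.contDiffAt, hT2, map_zero, add_zero, T.fderiv]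

theorem secondDeriv_clm_comp (T : F →L[ℝ] G) {f : E → F} {x : E} (hf : ContDiffAt ℝ 2 f x)
    (v : E) : secondDeriv (T ∘ f) x v = T (secondDeriv f x v) := by
  have hT : fderiv ℝ (T : F → G) = fun _ => T := funext fun y => T.fderiv
  have hT2 : ∀ w, secondDeriv T (f x) w = 0 := fun w => by
    rw [secondDeriv, hT, fderiv_fun_const]
    rfl
  rw [secondDeriv_comp T.contDiff.contDiffAt hf, hT2, zero_add, T.fderiv]

theorem secondDeriv_comp_add_right (f : E → G) (a x v : E) :
    secondDeriv (fun y => f (y + a)) x v = secondDeriv f (x + a) v := by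
  have h : fderiv ℝ (fun y => f (y + a)) = fun y => fderiv ℝ f (y + a) :=
    funext fun y => fderiv_comp_add_right a
  rw [secondDeriv, h, fderiv_comp_add_right, secondDeriv]

theorem secondDeriv_one_eq_deriv_deriv {h : ℝ → G} {t : ℝ} (hh : ContDiffAt ℝ 2 h t) :
    secondDeriv h t 1 = deriv (deriv h) t := by
  have hd : deriv h = fun s => fderiv ℝ h s 1 := funext fun s => fderiv_apply_one_eq_deriv.symm
  rw [← fderiv_apply_one_eq_deriv, hd, secondDeriv, fderiv_clm_apply_const
    ((hh.fderiv_right (m := 1) (by norm_num)).differentiableAt (by simp))]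

section Hessian

variable {g : E → E →L[ℝ] E →L[ℝ] ℝ} {f : E → ℂ} {x : E}

theorem hessian_eq_sub (hf : ContDiffAt ℝ 2 f x) (u v : E) :
    hessian g f x u v
      = fderiv ℝ (fderiv ℝ f) x u v - fderiv ℝ f x (christoffel g x u v) := by
  rw [hessian, fderiv_clm_apply_const
    ((hf.fderiv_right (m := 1) (by norm_num)).differentiableAt (by simp))]

theorem IsRiemannianNear.metricTrace_hessian [FiniteDimensional ℝ E] {ι : Type*} [Fintype ι]
    [DecidableEq ι]
    {o : Basis ι ℝ E} (hg : IsRiemannianNear g x) (ho : IsOrthonormalFor (g x) o)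
    (hf : ContDiffAt ℝ 2 f x) :
    metricTrace (g x) (hessian g f x)
      = ∑ j, secondDeriv f x (o j) - fderiv ℝ f x (∑ j, christoffel g x (o j) (o j)) := by
  let A : E →ₗ[ℝ] E →ₗ[ℝ] ℂ := (fderiv ℝ (fderiv ℝ f) x).toLinearMap₁₂
    - (christoffelL g x).toLinearMap₁₂.compr₂ (fderiv ℝ f x : E →ₗ[ℝ] ℂ)
  have hA : hessian g f x = fun u v => A u v := by
    funext u v
    rw [hessian_eq_sub hf]
    rfl
  rw [hA, ho.metricTrace_eq_sum hg.isInvertible A, map_sum, ← Finset.sum_sub_distrib]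
  rfl

end Hessian

section Trace

variable {V W : Type*} [NormedAddCommGroup V] [InnerProductSpace ℝ V] [FiniteDimensional ℝ V]
  [AddCommGroup W] [Module ℝ W]

theorem metricTrace_innerSL_eq_sum {κ : Type*} [Fintype κ] (b : OrthonormalBasis κ ℝ V)
    (A : V →ₗ[ℝ] V →ₗ[ℝ] W) :
    metricTrace (innerSL ℝ : V →L[ℝ] V →L[ℝ] ℝ) (fun v w => A v w) = ∑ i, A (b i) (b i) := by
  classical
  have hinv : (innerSL ℝ : V →L[ℝ] V →L[ℝ] ℝ).IsInvertible :=
    isInvertible_of_pos fun v => real_inner_self_pos.2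
  have ho : IsOrthonormalFor (innerSL ℝ : V →L[ℝ] V →L[ℝ] ℝ) b.toBasis := fun i j => by
    rw [b.coe_toBasis]
    exact orthonormal_iff_ite.1 b.orthonormal i j
  rw [ho.metricTrace_eq_sum hinv, b.coe_toBasis]

theorem sum_orthonormalBasis_eq {κ κ' : Type*} [Fintype κ] [Fintype κ']
    (b : OrthonormalBasis κ ℝ V) (b' : OrthonormalBasis κ' ℝ V) (A : V →ₗ[ℝ] V →ₗ[ℝ] W) :
    ∑ i, A (b i) (b i) = ∑ i, A (b' i) (b' i) :=
  (metricTrace_innerSL_eq_sum b A).symm.trans (metricTrace_innerSL_eq_sum b' A)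

end Trace

end SecondDerivative

section Lift

/-- The radial projection of `ℝ³ ∖ {0}` to the sphere. -/
def sphereProj (x : E3) : S2 :=
  if h : x = 0 then ⟨EuclideanSpace.single 0 1, by simp⟩
  else ⟨‖x‖⁻¹ • x, by simp [norm_smul, norm_ne_zero_iff.2 h]⟩

theorem coe_sphereProj {x : E3} (h : x ≠ 0) : (sphereProj x : E3) = ‖x‖⁻¹ • x := by
  simp [sphereProj, h]

theorem sphereProj_coe (p : S2) : sphereProj p = p := by
  have h : (p : E3) ≠ 0 := ne_zero_of_mem_unit_sphere p
  apply Subtype.ext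
  rw [coe_sphereProj h, norm_eq_of_mem_sphere p]
  simp

theorem sphereProj_smul {x : E3} (hx : x ≠ 0) {r : ℝ} (hr : 0 < r) :
    sphereProj (r • x) = sphereProj x := by
  apply Subtype.ext
  rw [coe_sphereProj hx, coe_sphereProj (smul_ne_zero hr.ne' hx), norm_smul, smul_smul,
    Real.norm_of_nonneg hr.le]
  congr 1
  field_simp

theorem contMDiffAt_sphereProj {x : E3} (hx : x ≠ 0) :
    ContMDiffAt 𝓘(ℝ, E3) (𝓡 2) ∞ sphereProj x := by
  have : Fact (finrank ℝ E3 = 2 + 1) := ⟨by simp⟩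
  let U : TopologicalSpace.Opens E3 := ⟨{0}ᶜ, isOpen_compl_singleton⟩
  have h : ContMDiff 𝓘(ℝ, E3) 𝓘(ℝ, E3) ∞ fun y : U => (sphereProj y : E3) := by
    intro y
    have hy : (y : E3) ≠ 0 := y.2
    rw [contMDiffAt_subtype_iff (f := fun y : E3 => (sphereProj y : E3)),
      contMDiffAt_iff_contDiffAt]
    have h1 : ContDiffAt ℝ ∞ (fun y : E3 => ‖y‖⁻¹ • y) (y : E3) :=
      ((contDiffAt_norm ℝ hy).inv (norm_ne_zero_iff.2 hy)).smul contDiffAt_id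
    refine h1.congr_of_eventuallyEq ?_
    filter_upwards [isOpen_compl_singleton.mem_nhds hy] with z hz
    exact coe_sphereProj hz
  have h2 : ContMDiff 𝓘(ℝ, E3) (𝓡 2) ∞ fun y : U => sphereProj y :=
    h.codRestrict_sphere (n := 2) fun y => (sphereProj y).2
  exact (contMDiffAt_subtype_iff (x := (⟨x, hx⟩ : U))).1 (h2 ⟨x, hx⟩)

variable (L : Submodule ℤ E2)

/-- The function on `(ℝ³ ∖ {0}) × ℝ²` induced by a function on `S² × T²`. -/
def lift (f : SphereTorus L → ℂ) (y : E3 × E2) : ℂ := f (sphereProj y.1, QuotientAddGroup.mk y.2)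

theorem lift_coe (f : SphereTorus L → ℂ) (p : S2) (z : E2) :
    lift L f (p, z) = f (p, QuotientAddGroup.mk z) := by
  rw [lift, sphereProj_coe]

theorem lift_smul (f : SphereTorus L → ℂ) {x : E3} (hx : x ≠ 0) {r : ℝ} (hr : 0 < r) (z : E2) :
    lift L f (r • x, z) = lift L f (x, z) := by
  rw [lift, lift, sphereProj_smul hx hr]

variable [DiscreteTopology L]

theorem contMDiff_torusMk :
    ContMDiff 𝓘(ℝ, E2) 𝓘(ℝ, E2) ∞ (QuotientAddGroup.mk : E2 → Torus L) := by
  intro z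
  let e := chartAt E2 (QuotientAddGroup.mk z : Torus L)
  have he : e ∈ atlas E2 (Torus L) := chart_mem_atlas _ _
  let w := e (QuotientAddGroup.mk z)
  have hwt : w ∈ e.target := e.map_source (mem_chart_source E2 _)
  have h1 : ContMDiffAt 𝓘(ℝ, E2) 𝓘(ℝ, E2) ∞ e.symm w :=
    (contMDiffOn_symm_of_mem_maximalAtlas
      (IsManifold.subset_maximalAtlas he)).contMDiffAt (e.open_target.mem_nhds hwt)
  have hz : (QuotientAddGroup.mk w : Torus L) = QuotientAddGroup.mk z :=
    mk_of_mem_atlas L he (mem_chart_source E2 _)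
  have h2 : ContMDiffAt 𝓘(ℝ, E2) 𝓘(ℝ, E2) ∞ (fun y : E2 => y + (w - z)) z :=
    (contDiff_id.add contDiff_const).contMDiff.contMDiffAt
  have h3 : ContMDiffAt 𝓘(ℝ, E2) 𝓘(ℝ, E2) ∞ (e.symm ∘ fun y : E2 => y + (w - z)) z :=
    ContMDiffAt.comp z (by simpa using h1) h2
  refine h3.congr_of_eventuallyEq (.of_forall fun y => ?_)
  simp only [Function.comp_apply]
  rw [mk_symm_of_mem_atlas L he, QuotientAddGroup.mk_add, QuotientAddGroup.mk_sub, hz, sub_self,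
    add_zero]

theorem contDiffAt_lift {f : SphereTorus L → ℂ} (hf : ContMDiff IST 𝓘(ℝ, ℂ) ∞ f) {y : E3 × E2}
    (hy : y.1 ≠ 0) : ContDiffAt ℝ ∞ (lift L f) y := by
  rw [← contMDiffAt_iff_contDiffAt]
  have h1 : ContMDiffAt 𝓘(ℝ, E3 × E2) (𝓡 2) ∞ (fun y : E3 × E2 => sphereProj y.1) y :=
    ContMDiffAt.comp (g := sphereProj) y (contMDiffAt_sphereProj hy)
      contDiff_fst.contMDiff.contMDiffAt
  have h2 : ContMDiffAt 𝓘(ℝ, E3 × E2) 𝓘(ℝ, E2) ∞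
      (fun y : E3 × E2 => (QuotientAddGroup.mk y.2 : Torus L)) y :=
    (contMDiff_torusMk L).contMDiffAt.comp y contDiff_snd.contMDiff.contMDiffAt
  exact hf.contMDiffAt.comp y (h1.prodMk h2)

theorem contMDiff_of_contDiffAt_lift {f : SphereTorus L → ℂ}
    (hf : ∀ y : E3 × E2, y.1 ≠ 0 → ContDiffAt ℝ ∞ (lift L f) y) :
    ContMDiff IST 𝓘(ℝ, ℂ) ∞ f := by
  intro x
  have : Fact (finrank ℝ E3 = 2 + 1) := ⟨by simp⟩
  have hs : ContMDiffAt IST 𝓘(ℝ, E3) ∞ (fun y : SphereTorus L => (y.1 : E3)) x :=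
    (contMDiff_coe_sphere.comp contMDiff_fst).contMDiffAt
  have ht : ContMDiffAt IST 𝓘(ℝ, E2) ∞ (fun y : SphereTorus L => chartAt E2 x.2 y.2) x :=
    (contMDiffAt_of_mem_maximalAtlas (IsManifold.chart_mem_maximalAtlas x.2)
      (mem_chart_source E2 x.2)).comp x contMDiffAt_snd
  have h1 : ContMDiffAt IST 𝓘(ℝ, ℂ) ∞
      (lift L f ∘ fun y : SphereTorus L => ((y.1 : E3), chartAt E2 x.2 y.2)) x :=
    ContMDiffAt.comp x (hf _ (ne_zero_of_mem_unit_sphere x.1)).contMDiffAt (hs.prodMk_space ht)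
  refine h1.congr_of_eventuallyEq ?_
  have hsrc : ∀ᶠ y in 𝓝 x, y.2 ∈ (chartAt E2 x.2).source :=
    continuous_snd.continuousAt.eventually
      ((chartAt E2 x.2).open_source.mem_nhds (mem_chart_source E2 x.2))
  filter_upwards [hsrc] with y hy
  rw [Function.comp_apply, lift_coe, mk_of_mem_atlas L (chart_mem_atlas E2 x.2) hy]

end Lift

section Laplacian

/-- The horizontal lift `(X, -λ(X))` of a vector `X`. -/
def horizontalLift (c : E2 →ₗ[ℝ] Matrix (Fin 3) (Fin 3) ℝ) (x : E3) : E3 →L[ℝ] E3 × E2 :=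
  (ContinuousLinearMap.id ℝ E3).prod (-oneForm c x)

theorem horizontalLift_apply (c : E2 →ₗ[ℝ] Matrix (Fin 3) (Fin 3) ℝ) (x X : E3) :
    horizontalLift c x X = (X, -oneForm c x X) := rfl

/-- The operator on functions on `ℝ³ × ℝ²` which induces `-Δ`: the sum of the second derivatives in
horizontal and vertical orthonormal directions. -/
def liftLaplacian (c : E2 →ₗ[ℝ] Matrix (Fin 3) (Fin 3) ℝ) (F : E3 × E2 → ℂ) (y : E3 × E2) : ℂ :=
  ∑ i : Fin 3, secondDeriv F y (horizontalLift c y.1 (EuclideanSpace.single i 1))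
    + ∑ a : Fin 2, secondDeriv F y (0, EuclideanSpace.single a 1)

variable {c : E2 →ₗ[ℝ] Matrix (Fin 3) (Fin 3) ℝ}

theorem liftLaplacian_eq_sum {κ : Type*} [Fintype κ] (b : OrthonormalBasis κ ℝ E3)
    (F : E3 × E2 → ℂ) (y : E3 × E2) :
    liftLaplacian c F y = ∑ i, secondDeriv F y (horizontalLift c y.1 (b i))
      + ∑ a : Fin 2, secondDeriv F y (0, EuclideanSpace.single a 1) := by
  have h := sum_orthonormalBasis_eq (EuclideanSpace.basisFun (Fin 3) ℝ) b
    ((fderiv ℝ (fderiv ℝ F) y).toLinearMap₁₂.compl₁₂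
      (horizontalLift c y.1 : E3 →ₗ[ℝ] E3 × E2) (horizontalLift c y.1 : E3 →ₗ[ℝ] E3 × E2))
  simp only [EuclideanSpace.basisFun_apply] at h
  exact congrArg (· + _) h

theorem sum_fderiv_oneForm_eq_zero (hs : ∀ Z, (c Z).IsSymm) {κ : Type*} [Fintype κ]
    (b : OrthonormalBasis κ ℝ E3) (x : E3) :
    ∑ i, fderiv ℝ (oneForm c) x (b i) (b i) = 0 := by
  have h := sum_orthonormalBasis_eq (EuclideanSpace.basisFun (Fin 3) ℝ) b
    (fderiv ℝ (oneForm c) x).toLinearMap₁₂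
  simp only [EuclideanSpace.basisFun_apply,
    ContinuousLinearMap.toLinearMap₁₂_apply_apply_apply] at h
  rw [← h]
  ext a
  have h2 := divergence_cross_mulVec (hs (EuclideanSpace.single a 1)) x.ofLp
  simpa [fderiv_oneForm_apply] using h2

theorem fderiv_oneForm_radial (x : E3) : fderiv ℝ (oneForm c) x x x = 0 := by
  ext a
  rw [fderiv_oneForm_apply, add_dotProduct, dotProduct_comm, dot_cross_self]
  simp

variable {L : Submodule ℤ E2} [DiscreteTopology L] {f : SphereTorus L → ℂ}

theorem fderiv_lift_radial (hf : ContMDiff IST 𝓘(ℝ, ℂ) ∞ f) {y : E3 × E2} (hy : y.1 ≠ 0) :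
    fderiv ℝ (lift L f) y (y.1, 0) = 0 := by
  have hl : HasDerivAt (fun t : ℝ => y + t • ((y.1, 0) : E3 × E2)) (y.1, 0) 0 := by
    simpa using ((hasDerivAt_id (0 : ℝ)).smul_const ((y.1, 0) : E3 × E2)).const_add y
  have hd : HasFDerivAt (lift L f) (fderiv ℝ (lift L f) y)
      (y + (0 : ℝ) • ((y.1, 0) : E3 × E2)) := by
    rw [zero_smul, add_zero]
    exact ((contDiffAt_lift L hf hy).differentiableAt (by simp)).hasFDerivAt
  have h := hd.comp_hasDerivAt (0 : ℝ) hl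
  have he : (lift L f ∘ fun t : ℝ => y + t • ((y.1, 0) : E3 × E2)) =ᶠ[𝓝 0] fun _ => lift L f y := by
    filter_upwards [isOpen_Ioi.mem_nhds (show (-1 : ℝ) < 0 by norm_num)] with t ht
    have ht' : 0 < 1 + t := by have : -1 < t := ht; linarith
    have e : y + t • ((y.1, 0) : E3 × E2) = ((1 + t) • y.1, y.2) := by
      ext1 <;> simp [add_smul]
    simp only [Function.comp_apply]
    rw [e, lift_smul L f hy ht']
  exact h.unique ((hasDerivAt_const (0 : ℝ) (lift L f y)).congr_of_eventuallyEq he)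

theorem secondDeriv_lift_radial (hf : ContMDiff IST 𝓘(ℝ, ℂ) ∞ f) {y : E3 × E2} (hy : y.1 ≠ 0) :
    secondDeriv (lift L f) y (y.1, 0) = 0 := by
  have hd : HasFDerivAt (fderiv ℝ (lift L f)) (fderiv ℝ (fderiv ℝ (lift L f)) y) y :=
    (((contDiffAt_lift L hf hy).fderiv_right (m := ∞) (by norm_cast)).differentiableAt
      (by simp)).hasFDerivAt
  have hr : HasFDerivAt (fun y : E3 × E2 => ((y.1, 0) : E3 × E2))
      ((ContinuousLinearMap.fst ℝ E3 E2).prod 0) y :=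
    hasFDerivAt_fst.prodMk (hasFDerivAt_const 0 y)
  have h := hd.clm_apply hr
  have he : (fun y : E3 × E2 => fderiv ℝ (lift L f) y (y.1, 0)) =ᶠ[𝓝 y] fun _ => 0 := by
    filter_upwards [(isOpen_compl_singleton.preimage continuous_fst).mem_nhds
      (show y ∈ Prod.fst ⁻¹' {(0 : E3)}ᶜ from hy)] with z hz
    exact fderiv_lift_radial hf hz
  have h2 := congrArg (fun A => A (y.1, 0))
    (h.unique ((hasFDerivAt_const (0 : ℂ) y).congr_of_eventuallyEq he))
  simpa [secondDeriv, fderiv_lift_radial hf hy] using h2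

section StereographicCoordinates

variable {ι : E2 →ₗᵢ[ℝ] E3} {p : E3}

theorem contDiff_prodMap_invStereo : ContDiff ℝ ∞ (Prod.map (invStereo ι p) (id : E2 → E2)) :=
  (contDiff_invStereo ι p).prodMap contDiff_id

theorem fderiv_prodMap_invStereo (y v : E2 × E2) :
    fderiv ℝ (Prod.map (invStereo ι p) id) y v = (fderiv ℝ (invStereo ι p) y.1 v.1, v.2) := by
  have h : HasFDerivAt (Prod.map (invStereo ι p) (id : E2 → E2)) _ y :=
    ((contDiff_invStereo ι p).differentiable (by simp) y.1).hasFDerivAt.prodMap y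
      (hasFDerivAt_id y.2)
  rw [h.fderiv]
  rfl

theorem secondDeriv_prodMap_invStereo (z : E2) (v : E2 × E2) :
    secondDeriv (Prod.map (invStereo ι p) id) (0, z) v = (-(inner ℝ v.1 v.1)) • (p, (0 : E2)) := by
  have hP : HasFDerivAt (fun y : E2 × E2 => fderiv ℝ (invStereo ι p) y.1) _ (0, z) :=
    (((contDiff_invStereo ι p).fderiv_right (m := ∞) (by norm_cast)).differentiable
      (by simp) 0).hasFDerivAt.comp (0, z) hasFDerivAt_fst
  have h := (hP.clm_apply (hasFDerivAt_const v.1 (0, z))).prodMk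
    (hasFDerivAt_const v.2 ((0 : E2), z))
  rw [secondDeriv, ← fderiv_clm_apply_const
    ((contDiff_prodMap_invStereo.fderiv_right (m := ∞) (by norm_cast)).differentiable (by simp) _)]
  simp_rw [fderiv_prodMap_invStereo]
  rw [h.fderiv]
  simp [fderiv_fderiv_invStereo_zero]

theorem secondDeriv_lift_comp_invStereo (hf : ContMDiff IST 𝓘(ℝ, ℂ) ∞ f) (hp : p ≠ 0) (z : E2)
    (v : E2 × E2) :
    secondDeriv (lift L f ∘ Prod.map (invStereo ι p) id) (0, z) v
      = secondDeriv (lift L f) (p, z) (ι v.1, v.2) := by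
  have h0 : Prod.map (invStereo ι p) id (0, z) = (p, z) := by simp [invStereo_zero]
  have hlift : ContDiffAt ℝ 2 (lift L f) (Prod.map (invStereo ι p) id (0, z)) := by
    rw [h0]
    exact (contDiffAt_lift L hf (y := (p, z)) hp).of_le (by norm_cast)
  have hrad : fderiv ℝ (lift L f) (p, z) (p, 0) = 0 := fderiv_lift_radial hf (y := (p, z)) hp
  rw [secondDeriv_comp hlift (contDiff_prodMap_invStereo.contDiffAt.of_le (by norm_cast)), h0,
    secondDeriv_prodMap_invStereo, map_smul, hrad, smul_zero, add_zero, fderiv_prodMap_invStereo,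
    fderiv_invStereo_zero]

theorem sum_secondDeriv_shearBasis (hf : ContMDiff IST 𝓘(ℝ, ℂ) ∞ f)
    (hι : ∀ u, inner ℝ (ι u) p = 0) (hp : ‖p‖ = 1) (z : E2) :
    ∑ j, secondDeriv (lift L f ∘ Prod.map (invStereo ι p) id) (0, z)
        (shearBasis (chartForm c ι p 0) j)
      = liftLaplacian c (lift L f) (p, z) := by
  have hp0 : p ≠ 0 := norm_ne_zero_iff.1 (by rw [hp]; exact one_ne_zero)
  obtain ⟨b, hb0, hb1, hb2⟩ := exists_frame hι hp
  have hrad : secondDeriv (lift L f) (p, z) (p, 0) = 0 :=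
    secondDeriv_lift_radial hf (y := (p, z)) hp0
  rw [liftLaplacian_eq_sum b, Fintype.sum_sum_type, Fin.sum_univ_three, hb0, hb1, hb2,
    horizontalLift_apply c p p, oneForm_self, neg_zero, hrad, add_zero]
  simp_rw [secondDeriv_lift_comp_invStereo hf hp0, shearBasis_inl, shearBasis_inr, chartForm_zero,
    map_zero, horizontalLift_apply]
  rw [Fin.sum_univ_two]

theorem sum_christoffel_shearBasis (hs : ∀ Z, (c Z).IsSymm) (hι : ∀ u, inner ℝ (ι u) p = 0)
    (hp : ‖p‖ = 1) (z : E2) :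
    ∑ j, christoffel (modelMetric c (invStereo ι p)) (0, z) (shearBasis (chartForm c ι p 0) j)
      (shearBasis (chartForm c ι p 0) j) = 0 := by
  obtain ⟨b, hb0, hb1, hb2⟩ := exists_frame hι hp
  have hdiv : ∀ a, formDeriv c ι p 1 1 a = -formDeriv c ι p 0 0 a := by
    intro a
    have h := sum_fderiv_oneForm_eq_zero hs b p
    rw [Fin.sum_univ_three, hb2, fderiv_oneForm_radial, add_zero, hb0, hb1] at h
    rw [formDeriv_eq, formDeriv_eq]
    exact eq_neg_of_add_eq_zero_right (congrArg (fun X : E2 => X a) h)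
  simp_rw [(isRiemannianNear_modelMetric (c := c) hι hp (0, z)).christoffel_eq_sum
    (isOrthonormalFor_shearBasis hι hp z), koszul_modelMetric hι hp]
  simp only [Fintype.sum_sum_type, Fin.sum_univ_two, koszulTable, zero_smul, zero_add, add_zero,
    hdiv]
  module

end StereographicCoordinates

theorem laplacian_metric (hs : ∀ Z, (c Z).IsSymm) (hf : ContMDiff IST 𝓘(ℝ, ℂ) ∞ f)
    (x : SphereTorus L) :
    laplacian (metric L c) f x
      = - liftLaplacian c (lift L f) ((x.1 : E3), chartAt E2 x.2 x.2) := by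
  obtain ⟨ι, hι, h⟩ := exists_extChartAt_sphere_symm x.1
  have hp : ‖(x.1 : E3)‖ = 1 := norm_eq_of_mem_sphere x.1
  have hgc := chartMetric_eventuallyEq (c := c) L h
  rw [extChartAt_self_eq] at hgc
  have hchart : f ∘ (extChartAt IST x).symm = lift L f ∘ Prod.map (invStereo ι x.1) id := by
    funext y
    have hy : (extChartAt IST x).symm y
        = ((extChartAt (𝓡 2) x.1).symm y.1, QuotientAddGroup.mk y.2) :=
      Prod.ext (extChartAt_symm_fst L x y) (extChartAt_symm_snd L x y)
    rw [Function.comp_apply, hy, ← lift_coe L f, h]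
    rfl
  have hsmooth : ContDiffAt ℝ 2 (lift L f ∘ Prod.map (invStereo ι x.1) id)
      ((0 : E2), chartAt E2 x.2 x.2) := by
    rw [← hchart, ← extChartAt_self_eq L x]
    exact (contDiffAt_chart hf x).of_le (by norm_cast)
  rw [laplacian, hchart, extChartAt_self_eq, hgc.eq_of_nhds, hessian_congr hgc,
    (isRiemannianNear_modelMetric hι hp _).metricTrace_hessian
      (isOrthonormalFor_shearBasis hι hp _) hsmooth,
    sum_christoffel_shearBasis hs hι hp, map_zero, sub_zero,
    sum_secondDeriv_shearBasis hf hι hp]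

end Laplacian

section Translation

theorem liftLaplacian_comp_add_right (c : E2 →ₗ[ℝ] Matrix (Fin 3) (Fin 3) ℝ) (F : E3 × E2 → ℂ)
    (w : E2) (y : E3 × E2) :
    liftLaplacian c (fun y => F (y + (0, w))) y = liftLaplacian c F (y + (0, w)) := by
  simp [liftLaplacian, secondDeriv_comp_add_right]

variable (L : Submodule ℤ E2) {f : SphereTorus L → ℂ}

theorem lift_add_of_mem (f : SphereTorus L → ℂ) {l : E2} (hl : l ∈ L) (y : E3 × E2) :
    lift L f (y + (0, l)) = lift L f y := by
  have : (QuotientAddGroup.mk (y.2 + l) : Torus L) = QuotientAddGroup.mk y.2 :=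
    QuotientAddGroup.eq.2 (by simpa using hl)
  simp [lift, this]

variable [DiscreteTopology L] {c : E2 →ₗ[ℝ] Matrix (Fin 3) (Fin 3) ℝ}

theorem mem_eigenspace_iff (hs : ∀ Z, (c Z).IsSymm) {μ : ℝ} :
    f ∈ eigenspace (metric L c) μ ↔ ContMDiff IST 𝓘(ℝ, ℂ) ∞ f ∧
      ∀ (p : S2) (z : E2), liftLaplacian c (lift L f) (p, z) = -(μ * lift L f (p, z)) := by
  refine and_congr_right fun hf => ⟨fun h p z => ?_, fun h x => ?_⟩
  · have h1 := h (p, QuotientAddGroup.mk z)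
    rw [laplacian_metric hs hf] at h1
    let q : Torus L := QuotientAddGroup.mk z
    have hl : chartAt E2 q q - z ∈ L := by
      have := QuotientAddGroup.eq.1
        (mk_of_mem_atlas L (chart_mem_atlas E2 q) (mem_chart_source E2 q)).symm
      rwa [neg_add_eq_sub] at this
    have h2 := liftLaplacian_comp_add_right c (lift L f) (chartAt E2 q q - z) ((p : E3), z)
    simp_rw [lift_add_of_mem L f hl] at h2
    rw [lift_coe, h2, ← h1, neg_neg]
    simp [q]
  · rw [laplacian_metric hs hf, h, neg_neg, lift_coe,
      mk_of_mem_atlas L (chart_mem_atlas E2 _) (mem_chart_source E2 _)]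

end Translation

section Weight

/-- The character `w ↦ exp(2πi⟨k, w⟩)` of `ℝ²`. -/
def character (k w : E2) : ℂ := Complex.exp (2 * Real.pi * Complex.I * (inner ℝ k w : ℝ))

theorem norm_character (k w : E2) : ‖character k w‖ = 1 := by
  rw [character, Complex.norm_exp]
  simp

theorem hasDerivAt_character (k w : E2) :
    HasDerivAt (fun t : ℝ => character k (t • w))
      (2 * Real.pi * Complex.I * (inner ℝ k w : ℝ)) 0 := by
  have h1 : HasDerivAt (fun t : ℝ => 2 * Real.pi * Complex.I * ((t * inner ℝ k w : ℝ) : ℂ))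
      (2 * Real.pi * Complex.I * (inner ℝ k w : ℝ)) 0 := by
    simpa using ((hasDerivAt_id (0 : ℝ)).mul_const (inner ℝ k w)).ofReal_comp.const_mul
      (2 * Real.pi * Complex.I)
  have h2 := h1.cexp
  simp only [zero_mul, Complex.ofReal_zero, mul_zero, Complex.exp_zero, one_mul] at h2
  refine h2.congr_of_eventuallyEq (.of_forall fun t => ?_)
  simp [character, inner_smul_right]

variable {V G : Type*} [NormedAddCommGroup V] [NormedSpace ℝ V] [NormedAddCommGroup G]
  [NormedSpace ℂ G]

/-- Translations in the second variable act on `F` by the character of frequency `k`. -/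
def HasWeight (k : E2) (F : V × E2 → G) : Prop := ∀ y w, F (y + (0, w)) = character k w • F y

namespace HasWeight

theorem fderiv_vertical {F : V × E2 → G} {k : E2} (hF : HasWeight k F) {y : V × E2}
    (hd : DifferentiableAt ℝ F y) (w : E2) :
    fderiv ℝ F y (0, w) = (2 * Real.pi * Complex.I * (inner ℝ k w : ℝ) : ℂ) • F y := by
  have h : HasDerivAt (fun t : ℝ => F (y + t • ((0, w) : V × E2))) (fderiv ℝ F y (0, w)) 0 :=
    hd.hasFDerivAt.hasLineDerivAt _
  refine h.unique (((hasDerivAt_character k w).smul_const (F y)).congr_of_eventuallyEq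
    (.of_forall fun t => ?_))
  simp [← hF y]

variable {F : V × E2 → ℂ} {k : E2} {y : V × E2}

protected theorem fderiv (hF : HasWeight k F) : HasWeight k (fderiv ℝ F) := by
  intro y w
  have h : (fun y => F (y + (0, w))) = character k w • F := funext fun y => hF y w
  rw [← fderiv_comp_add_right, h]
  exact congrFun (fderiv_const_smul_field (character k w)) y

theorem secondDeriv_eq (hF : HasWeight k F) (hd : ContDiffAt ℝ 2 F y) (X : V) (w : E2) :
    secondDeriv F y (X, w) = secondDeriv F y (X, 0)
      + 2 * ((2 * Real.pi * Complex.I * (inner ℝ k w : ℝ)) * fderiv ℝ F y (X, 0))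
      + (2 * Real.pi * Complex.I * (inner ℝ k w : ℝ)) ^ 2 * F y := by
  have hd1 : DifferentiableAt ℝ (fderiv ℝ F) y :=
    (hd.fderiv_right (m := 1) (by norm_num)).differentiableAt (by simp)
  have hvert : ∀ v, fderiv ℝ (fderiv ℝ F) y (0, w) v
      = (2 * Real.pi * Complex.I * (inner ℝ k w : ℝ)) * fderiv ℝ F y v := fun v => by
    rw [hF.fderiv.fderiv_vertical hd1]
    rfl
  have hsymm : IsSymmSndFDerivAt ℝ F y := hd.isSymmSndFDerivAt (by simp)
  have hsplit : ((X, w) : V × E2) = (X, 0) + (0, w) := by simp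
  rw [secondDeriv, hsplit, map_add (fderiv ℝ (fderiv ℝ F) y), add_apply, map_add, map_add,
    hsymm.eq (X, 0) (0, w), hvert, hvert, hF.fderiv_vertical (hd.differentiableAt (by simp)),
    secondDeriv, smul_eq_mul]
  ring

theorem secondDeriv_congr (hF : HasWeight k F) (hd : ContDiffAt ℝ 2 F y) (X : V) {w w' : E2}
    (h : inner ℝ k w = inner ℝ k w') : secondDeriv F y (X, w) = secondDeriv F y (X, w') := by
  rw [hF.secondDeriv_eq hd, hF.secondDeriv_eq hd X w', h]

theorem sum_secondDeriv_vertical (hF : HasWeight k F) (hd : ContDiffAt ℝ 2 F y) :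
    ∑ a : Fin 2, secondDeriv F y (0, EuclideanSpace.single a 1)
      = -((4 * Real.pi ^ 2 * ‖k‖ ^ 2 : ℝ) * F y) := by
  have h0 : ∀ w, secondDeriv F y (0, w)
      = (2 * Real.pi * Complex.I * (inner ℝ k w : ℝ)) ^ 2 * F y := fun w => by
    rw [hF.secondDeriv_eq hd, secondDeriv, Prod.mk_zero_zero, map_zero, map_zero]
    ring
  simp_rw [h0, EuclideanSpace.norm_sq_eq, Fin.sum_univ_two]
  simp only [Fin.isValue, EuclideanSpace.inner_single_right, Real.ringHom_apply, one_mul, mul_pow,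
    Complex.I_sq, mul_neg, mul_one, neg_mul, Real.norm_eq_abs, sq_abs, Complex.ofReal_mul,
    Complex.ofReal_ofNat, Complex.ofReal_pow, Complex.ofReal_add]
  ring

end HasWeight

end Weight

section MaximumPrinciple

theorem deriv_deriv_nonpos_of_isLocalMax {h : ℝ → ℝ} {x : ℝ} (hm : IsLocalMax h x)
    (hc : ContinuousAt h x) : deriv (deriv h) x ≤ 0 := by
  by_contra! hpos
  have hmin := isLocalMin_of_deriv_deriv_pos hpos hm.deriv_eq_zero hc
  have he : h =ᶠ[𝓝 x] fun _ => h x := by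
    filter_upwards [hm, hmin] with y h1 h2
    exact le_antisymm h1 h2
  have he' : deriv h =ᶠ[𝓝 x] fun _ => 0 := by
    filter_upwards [he.eventuallyEq_nhds] with y hy
    rw [hy.deriv_eq, deriv_const]
  rw [he'.deriv_eq, deriv_const] at hpos
  exact lt_irrefl _ hpos

variable {E : Type*} [NormedAddCommGroup E] [NormedSpace ℝ E] {y : E}

theorem secondDeriv_nonpos_of_isLocalMax {h : E → ℝ} (hh : ContDiffAt ℝ 2 h y)
    (hm : IsLocalMax h y) (v : E) : secondDeriv h y v ≤ 0 := by
  let T : ℝ →L[ℝ] E := ContinuousLinearMap.toSpanSingleton ℝ v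
  have hline : ContDiff ℝ 2 fun t : ℝ => T t + y := T.contDiff.add contDiff_const
  have hy : T 0 + y = y := by rw [map_zero, zero_add]
  have hh' : ContDiffAt ℝ 2 (fun z => h (z + y)) (T 0) :=
    ContDiffAt.comp (T 0) (by rwa [hy]) (contDiff_id.add contDiff_const).contDiffAt
  have hhT : ContDiffAt ℝ 2 ((fun z => h (z + y)) ∘ T) 0 := hh'.comp 0 T.contDiff.contDiffAt
  have hmax : IsLocalMax ((fun z => h (z + y)) ∘ T) 0 := by
    have hcont : ContinuousAt (fun t : ℝ => T t + y) 0 := hline.continuous.continuousAt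
    have hev := hcont.eventually (show ∀ᶠ z in 𝓝 (T 0 + y), h z ≤ h y by rwa [hy])
    filter_upwards [hev] with t ht
    simpa only [Function.comp_apply, hy] using ht
  have hv : secondDeriv h y v = deriv (deriv ((fun z => h (z + y)) ∘ T)) 0 := by
    rw [← secondDeriv_one_eq_deriv_deriv hhT, secondDeriv_comp_clm T hh',
      secondDeriv_comp_add_right, hy, ContinuousLinearMap.toSpanSingleton_apply, one_smul]
  rw [hv]
  exact deriv_deriv_nonpos_of_isLocalMax hmax hhT.continuousAt

theorem re_secondDeriv_nonpos {F : E → ℂ} (hF : ContDiffAt ℝ 2 F y) (hm : ∀ z, ‖F z‖ ≤ ‖F y‖)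
    (v : E) : ((starRingEnd ℂ) (F y) * secondDeriv F y v).re ≤ 0 := by
  let T : ℂ →L[ℝ] ℝ := Complex.reCLM ∘L ContinuousLinearMap.mul ℝ ℂ ((starRingEnd ℂ) (F y))
  have hmax : ∀ z, T (F z) ≤ T (F y) := fun z =>
    calc ((starRingEnd ℂ) (F y) * F z).re ≤ ‖(starRingEnd ℂ) (F y) * F z‖ := Complex.re_le_norm _
      _ = ‖F y‖ * ‖F z‖ := by rw [norm_mul, RCLike.norm_conj]
      _ ≤ ‖F y‖ * ‖F y‖ := by gcongr; exact hm z
      _ = ((starRingEnd ℂ) (F y) * F y).re := by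
        rw [← Complex.normSq_eq_conj_mul_self, Complex.ofReal_re, Complex.normSq_eq_norm_sq, sq]
  have h := secondDeriv_nonpos_of_isLocalMax (T.contDiff.contDiffAt.comp y hF)
    (.of_forall hmax) v
  rwa [secondDeriv_clm_comp T hF] at h

end MaximumPrinciple

section WeightSpace

variable (L : Submodule ℤ E2) [DiscreteTopology L] (c : E2 →ₗ[ℝ] Matrix (Fin 3) (Fin 3) ℝ)

/-- The eigenfunctions on which the torus acts by the character with weight `k`. -/
def weightSpace (μ : ℝ) (k : E2) : Submodule ℂ (SphereTorus L → ℂ) where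
  carrier := {f | f ∈ eigenspace (metric L c) μ ∧
    ∀ (p : S2) (q : Torus L) (w : E2), f (p, q + QuotientAddGroup.mk w) = character k w * f (p, q)}
  add_mem' := by
    rintro a b ⟨ha, ha'⟩ ⟨hb, hb'⟩
    exact ⟨add_mem ha hb, fun p q w => by simp [ha', hb', mul_add]⟩
  zero_mem' := ⟨zero_mem _, fun p q w => by simp⟩
  smul_mem' := by
    rintro r a ⟨ha, ha'⟩
    exact ⟨Submodule.smul_mem _ r ha, fun p q w => by
      rw [Pi.smul_apply, Pi.smul_apply, ha', smul_eq_mul, smul_eq_mul, mul_left_comm]⟩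

variable {L c} {μ : ℝ} {k : E2} {f : SphereTorus L → ℂ}

theorem weightSpace_le : weightSpace L c μ k ≤ eigenspace (metric L c) μ := fun _ h => h.1

theorem hasWeight_lift (hf : f ∈ weightSpace L c μ k) : HasWeight k (lift L f) := fun y w => by
  simp [lift, hf.2]

theorem norm_lift (hf : f ∈ weightSpace L c μ k) (y : E3 × E2) :
    ‖lift L f y‖ = ‖f (sphereProj y.1, 0)‖ := by
  have h := hf.2 (sphereProj y.1) 0 y.2
  rw [zero_add] at h
  rw [lift, h, norm_mul, norm_character, one_mul]

theorem exists_norm_lift_le (hf : f ∈ weightSpace L c μ k) :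
    ∃ p : S2, ∀ y, ‖lift L f y‖ ≤ ‖lift L f ((p : E3), 0)‖ := by
  have hcont : Continuous fun p : S2 => ‖f (p, 0)‖ := by
    have := hf.1.1.continuous
    fun_prop
  have : Nonempty S2 := ⟨sphereProj 0⟩
  obtain ⟨p, hp⟩ := hcont.exists_forall_ge_of_hasCompactSupport
    (HasCompactSupport.of_compactSpace _)
  refine ⟨p, fun y => ?_⟩
  rw [norm_lift hf, norm_lift hf, sphereProj_coe]
  exact hp _

/-- At a maximum of `|f|` the horizontal part of the Laplacian has a sign, and the vertical part is
multiplication by `4π²|k|²`. -/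
theorem norm_weight_le (hs : ∀ Z, (c Z).IsSymm) (hf : f ∈ weightSpace L c μ k) (hf0 : f ≠ 0) :
    4 * Real.pi ^ 2 * ‖k‖ ^ 2 ≤ μ := by
  obtain ⟨hsm, hl⟩ := (mem_eigenspace_iff L hs).1 hf.1
  obtain ⟨p, hmax⟩ := exists_norm_lift_le hf
  let y : E3 × E2 := ((p : E3), 0)
  have hF0 : lift L f y ≠ 0 := fun h0 => hf0 <| by
    funext x
    obtain ⟨z, hz⟩ := QuotientAddGroup.mk_surjective x.2
    have hx := hmax ((x.1 : E3), z)
    rwa [h0, norm_zero, norm_le_zero_iff, lift_coe, hz] at hx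
  have hF : ContDiffAt ℝ 2 (lift L f) y :=
    (contDiffAt_lift L hsm (ne_zero_of_mem_unit_sphere p)).of_le (by norm_cast)
  have hhor : ((starRingEnd ℂ) (lift L f y) * ∑ i : Fin 3, secondDeriv (lift L f) y
      (horizontalLift c y.1 (EuclideanSpace.single i 1))).re ≤ 0 := by
    rw [Finset.mul_sum, Complex.re_sum]
    exact Finset.sum_nonpos fun i _ => re_secondDeriv_nonpos hF hmax _
  have hlap : ∑ i : Fin 3, secondDeriv (lift L f) y
      (horizontalLift c y.1 (EuclideanSpace.single i 1))
        = ((4 * Real.pi ^ 2 * ‖k‖ ^ 2 - μ : ℝ) : ℂ) * lift L f y := by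
    have h := hl p 0
    rw [liftLaplacian, (hasWeight_lift hf).sum_secondDeriv_vertical hF] at h
    rw [eq_sub_of_add_eq h]
    push_cast
    ring
  rw [hlap, mul_left_comm, ← Complex.normSq_eq_conj_mul_self, ← Complex.ofReal_mul,
    Complex.ofReal_re] at hhor
  have hpos : 0 < Complex.normSq (lift L f y) := Complex.normSq_pos.2 hF0
  exact sub_nonpos.1 (nonpos_of_mul_nonpos_left hhor hpos)

end WeightSpace

section Rotation

variable {L : Submodule ℤ E2} {c c' : E2 →ₗ[ℝ] Matrix (Fin 3) (Fin 3) ℝ}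
  {μ : ℝ} {k : E2} {f : SphereTorus L → ℂ}

/-- A linear isometry as a map of the sphere. -/
def sphereMap (R : E3 ≃ₗᵢ[ℝ] E3) (p : S2) : S2 := ⟨R p, by simp⟩

theorem sphereMap_sphereProj (R : E3 ≃ₗᵢ[ℝ] E3) {x : E3} (hx : x ≠ 0) :
    sphereMap R (sphereProj x) = sphereProj (R x) := by
  apply Subtype.ext
  have hR : R x ≠ 0 := by simpa using hx
  rw [coe_sphereProj hR, sphereMap]
  simp [coe_sphereProj hx]

theorem lift_comp_sphereMap (R : E3 ≃ₗᵢ[ℝ] E3) (f : SphereTorus L → ℂ) {y : E3 × E2}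
    (hy : y.1 ≠ 0) :
    lift L (fun x => f (sphereMap R x.1, x.2)) y = lift L f (R y.1, y.2) := by
  simp only [lift, sphereMap_sphereProj R hy]

variable [DiscreteTopology L]

theorem contMDiff_comp_sphereMap (R : E3 ≃ₗᵢ[ℝ] E3) (hf : ContMDiff IST 𝓘(ℝ, ℂ) ∞ f) :
    ContMDiff IST 𝓘(ℝ, ℂ) ∞ fun x : SphereTorus L => f (sphereMap R x.1, x.2) := by
  have : Fact (finrank ℝ E3 = 2 + 1) := ⟨by simp⟩
  have hR : ContMDiff (𝓡 2) (𝓡 2) ∞ (sphereMap R) :=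
    (R.contDiff.contMDiff.comp contMDiff_coe_sphere).codRestrict_sphere (n := 2)
      fun p => (sphereMap R p).2
  exact hf.comp ((hR.comp contMDiff_fst).prodMk contMDiff_snd)

theorem secondDeriv_lift_comp_sphereMap (R : E3 ≃ₗᵢ[ℝ] E3) (hf : ContMDiff IST 𝓘(ℝ, ℂ) ∞ f)
    {y : E3 × E2} (hy : y.1 ≠ 0) (v : E3 × E2) :
    secondDeriv (lift L fun x => f (sphereMap R x.1, x.2)) y v
      = secondDeriv (lift L f) (R y.1, y.2) (R v.1, v.2) := by
  let T : E3 × E2 →L[ℝ] E3 × E2 := (R.toContinuousLinearEquiv : E3 →L[ℝ] E3).prodMap (.id ℝ E2)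
  have he : (lift L fun x => f (sphereMap R x.1, x.2)) =ᶠ[𝓝 y] lift L f ∘ T := by
    filter_upwards [(isOpen_compl_singleton.preimage continuous_fst).mem_nhds
      (show y ∈ Prod.fst ⁻¹' {(0 : E3)}ᶜ from hy)] with z hz
    exact lift_comp_sphereMap R f hz
  have hRy : (T y).1 ≠ 0 := (map_ne_zero_iff R R.injective).2 hy
  rw [secondDeriv, he.fderiv.fderiv_eq]
  exact secondDeriv_comp_clm T ((contDiffAt_lift L hf hRy).of_le (by norm_cast)) v

theorem liftLaplacian_comp_sphereMap (R : E3 ≃ₗᵢ[ℝ] E3)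
    (hR : ∀ x X, inner ℝ k (oneForm c' (R x) (R X)) = inner ℝ k (oneForm c x X))
    (hf : f ∈ weightSpace L c' μ k) {y : E3 × E2} (hy : y.1 ≠ 0) :
    liftLaplacian c (lift L fun x => f (sphereMap R x.1, x.2)) y
      = liftLaplacian c' (lift L f) (R y.1, y.2) := by
  have hF : ContDiffAt ℝ 2 (lift L f) (R y.1, y.2) :=
    (contDiffAt_lift L hf.1.1 ((map_ne_zero_iff R R.injective).2 hy)).of_le (by norm_cast)
  rw [liftLaplacian_eq_sum (c := c') ((EuclideanSpace.basisFun (Fin 3) ℝ).map R), liftLaplacian]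
  simp only [secondDeriv_lift_comp_sphereMap R hf.1.1 hy, map_zero]
  congr 1
  refine Finset.sum_congr rfl fun i _ => ?_
  rw [horizontalLift_apply, horizontalLift_apply, OrthonormalBasis.map_apply,
    EuclideanSpace.basisFun_apply]
  refine (hasWeight_lift hf).secondDeriv_congr hF _ ?_
  rw [inner_neg_right, inner_neg_right, hR]

theorem comp_sphereMap_mem_weightSpace (hs : ∀ Z, (c Z).IsSymm) (hs' : ∀ Z, (c' Z).IsSymm)
    (R : E3 ≃ₗᵢ[ℝ] E3)
    (hR : ∀ x X, inner ℝ k (oneForm c' (R x) (R X)) = inner ℝ k (oneForm c x X))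
    (hf : f ∈ weightSpace L c' μ k) :
    (fun x => f (sphereMap R x.1, x.2)) ∈ weightSpace L c μ k := by
  refine ⟨(mem_eigenspace_iff L hs).2 ⟨contMDiff_comp_sphereMap R hf.1.1, fun p z => ?_⟩,
    fun p q w => hf.2 _ q w⟩
  have hp : (p : E3) ≠ 0 := ne_zero_of_mem_unit_sphere p
  rw [liftLaplacian_comp_sphereMap R hR hf hp, lift_comp_sphereMap R f hp]
  exact ((mem_eigenspace_iff L hs').1 hf.1).2 (sphereMap R p) z

/-- Composition with a rotation intertwining the `k`-components of the two forms. -/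
def weightSpaceEquiv (hs : ∀ Z, (c Z).IsSymm) (hs' : ∀ Z, (c' Z).IsSymm) (R : E3 ≃ₗᵢ[ℝ] E3)
    (hR : ∀ x X, inner ℝ k (oneForm c' (R x) (R X)) = inner ℝ k (oneForm c x X)) :
    weightSpace L c' μ k ≃ₗ[ℂ] weightSpace L c μ k where
  toFun f := ⟨_, comp_sphereMap_mem_weightSpace hs hs' R hR f.2⟩
  invFun f := ⟨_, comp_sphereMap_mem_weightSpace hs' hs R.symm
    (fun x X => by rw [← hR]; simp) f.2⟩
  map_add' _ _ := rfl
  map_smul' _ _ := rfl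
  left_inv f := by
    ext x
    simp [sphereMap]
  right_inv f := by
    ext x
    simp [sphereMap]

end Rotation

section Conjugacy

theorem exists_unitary_conj {𝕜 n : Type*} [RCLike 𝕜] [Fintype n] [DecidableEq n]
    {A B : Matrix n n 𝕜} (hA : A.IsHermitian) (hB : B.IsHermitian)
    (h : A.charpoly = B.charpoly) :
    ∃ U : Matrix.unitaryGroup n 𝕜, B = Unitary.conjStarAlgAut 𝕜 _ U A := by
  refine ⟨hB.eigenvectorUnitary * star hA.eigenvectorUnitary, ?_⟩
  rw [Unitary.conjStarAlgAut_mul_apply, hA.conjStarAlgAut_star_eigenvectorUnitary,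
    (hA.eigenvalues_eq_eigenvalues_iff hB).2 h]
  exact hB.spectral_theorem

theorem exists_specialOrthogonal_conj {n : Type*} [Fintype n] [DecidableEq n]
    (hn : Odd (Fintype.card n)) {A B : Matrix n n ℝ} (hA : A.IsHermitian) (hB : B.IsHermitian)
    (h : A.charpoly = B.charpoly) :
    ∃ U ∈ Matrix.specialOrthogonalGroup n ℝ, B * U = U * A := by
  obtain ⟨V, rfl⟩ := exists_unitary_conj hA hB h
  have hV : Unitary.conjStarAlgAut ℝ _ V A * (V : Matrix n n ℝ) = V * A := by
    rw [Unitary.conjStarAlgAut_apply, mul_assoc, Unitary.coe_star_mul_self, mul_one]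
  have hdet : (V : Matrix n n ℝ).det * (V : Matrix n n ℝ).det = 1 :=
    (Unitary.mem_iff.1 (Matrix.det_of_mem_unitary V.2)).2
  rcases mul_self_eq_one_iff.1 hdet with h1 | h1
  · exact ⟨V, Matrix.mem_specialOrthogonalGroup_iff.2 ⟨V.2, h1⟩, hV⟩
  · refine ⟨-V, Matrix.mem_specialOrthogonalGroup_iff.2 ⟨(-V).2, ?_⟩, by simpa using hV⟩
    rw [Matrix.det_neg, hn.neg_one_pow, h1, neg_mul_neg, one_mul]

theorem cross_dotProduct_mulVec {R : Type*} [CommRing R] (U : Matrix (Fin 3) (Fin 3) R)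
    (u v w : Fin 3 → R) :
    ((U *ᵥ u) ⨯₃ (U *ᵥ v)) ⬝ᵥ (U *ᵥ w) = U.det * ((u ⨯₃ v) ⬝ᵥ w) := by
  simp only [dotProduct, cross_apply, Nat.succ_eq_add_one, Nat.reduceAdd, Matrix.mulVec,
    Fin.isValue, Fin.sum_univ_three, Matrix.cons_val_zero, Matrix.cons_val_one, Matrix.cons_val,
    Matrix.det_fin_three]
  ring

theorem exists_rotation_conj {A B : Matrix (Fin 3) (Fin 3) ℝ} (hA : A.IsHermitian)
    (hB : B.IsHermitian) (h : A.charpoly = B.charpoly) :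
    ∃ R : E3 ≃ₗᵢ[ℝ] E3, ∀ x X : E3,
      ((B *ᵥ (R x).ofLp) ⨯₃ (R x).ofLp) ⬝ᵥ (R X).ofLp = ((A *ᵥ x.ofLp) ⨯₃ x.ofLp) ⬝ᵥ X.ofLp := by
  obtain ⟨U, hU, hBU⟩ := exists_specialOrthogonal_conj (by decide) hA hB h
  obtain ⟨hUo, hdet⟩ := Matrix.mem_specialOrthogonalGroup_iff.1 hU
  have hinner : ∀ x y : E3, inner ℝ (Matrix.toEuclideanLin U x) (Matrix.toEuclideanLin U y)
      = inner ℝ x y := fun x y => by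
    simp only [EuclideanSpace.inner_eq_star_dotProduct, Matrix.toLpLin_apply, star_trivial]
    rw [Matrix.dotProduct_mulVec, ← Matrix.mulVec_transpose, Matrix.mulVec_mulVec,
      (Matrix.mem_orthogonalGroup_iff' (Fin 3) ℝ).1 hUo, Matrix.one_mulVec]
  let R := ((Matrix.toEuclideanLin U).isometryOfInner hinner).toLinearIsometryEquiv rfl
  have hR : ∀ x : E3, (R x).ofLp = U *ᵥ x.ofLp := fun x => rfl
  refine ⟨R, fun x X => ?_⟩
  rw [hR, hR, Matrix.mulVec_mulVec, hBU, ← Matrix.mulVec_mulVec, cross_dotProduct_mulVec, hdet,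
    one_mul]

theorem pencil_apply (A B : Matrix (Fin 3) (Fin 3) ℝ) (k : E2) :
    pencil A B k = k 0 • A + k 1 • B := rfl

theorem c₁_isSymm (Z : E2) : (c₁ Z).IsSymm := by
  ext i j
  fin_cases i <;> fin_cases j <;> simp [c₁, pencil]

theorem c₂_isSymm (Z : E2) : (c₂ Z).IsSymm := by
  ext i j
  fin_cases i <;> fin_cases j <;> simp [c₂, pencil]

theorem c₁_trace (Z : E2) : (c₁ Z).trace = 0 := by
  simp [c₁, pencil, Matrix.trace_fin_three]

theorem c₂_trace (Z : E2) : (c₂ Z).trace = 0 := by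
  simp [c₂, pencil, Matrix.trace_fin_three]

theorem charpoly_c₁_eq_charpoly_c₂ (k : E2) : (c₁ k).charpoly = (c₂ k).charpoly := by
  have h2 : (Polynomial.C √2 : Polynomial ℝ) ^ 2 = 2 := by
    rw [← Polynomial.C_pow, Real.sq_sqrt (by norm_num)]
    rfl
  simp only [Matrix.charpoly, Matrix.charmatrix, Matrix.det_fin_three, c₁, c₂, pencil_apply]
  simp only [Matrix.scalar_apply, Fin.isValue, Matrix.smul_of, Matrix.smul_cons, smul_eq_mul,
    mul_neg, mul_one, mul_zero, Matrix.smul_empty, Matrix.of_add_of, Matrix.add_cons,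
    Matrix.head_cons, add_zero, Matrix.tail_cons, zero_add, Matrix.empty_add_empty,
    RingHom.mapMatrix_apply, Matrix.sub_apply, Matrix.diagonal_apply_eq, Matrix.map_apply,
    Matrix.of_apply, Matrix.cons_val', Matrix.cons_val_zero, Matrix.cons_val_fin_one, map_neg,
    sub_neg_eq_add, Matrix.cons_val_one, map_zero, sub_zero, Matrix.cons_val, ne_eq, Fin.reduceEq,
    not_false_eq_true, Matrix.diagonal_apply_ne, zero_sub, neg_mul, neg_neg, zero_ne_one,
    one_ne_zero, sub_self, zero_mul, neg_zero, map_mul]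
  linear_combination Polynomial.X * Polynomial.C (k 1) ^ 2 * h2

theorem exists_intertwining_rotation (k : E2) : ∃ R : E3 ≃ₗᵢ[ℝ] E3,
    ∀ x X, inner ℝ k (oneForm c₂ (R x) (R X)) = inner ℝ k (oneForm c₁ x X) := by
  obtain ⟨R, hR⟩ := exists_rotation_conj (A := c₁ k) (B := c₂ k)
    ((Matrix.conjTranspose_eq_transpose_of_trivial _).trans (c₁_isSymm k))
    ((Matrix.conjTranspose_eq_transpose_of_trivial _).trans (c₂_isSymm k))
    (charpoly_c₁_eq_charpoly_c₂ k)
  refine ⟨R, fun x X => ?_⟩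
  rw [real_inner_comm, oneForm_inner, real_inner_comm _ k, oneForm_inner, ← dotProduct_eq_inner,
    ← dotProduct_eq_inner]
  exact hR x X

end Conjugacy

section CubeAverage

universe u

variable {d : Type*}

/-- The half-open unit cube. -/
def unitCube (d : Type*) : Set (d → ℝ) := univ.pi fun _ => Ioc 0 1

theorem unitCube_subset_Icc : unitCube d ⊆ Icc 0 1 := fun _ hx =>
  ⟨fun i => (hx i trivial).1.le, fun i => (hx i trivial).2⟩

theorem continuous_smul_translate {W G : Type*} [NormedAddCommGroup W] [NormedAddCommGroup G]
    [NormedSpace ℂ G] {A : (d → ℝ) → W} {χ : (d → ℝ) → ℂ} {U : Set W}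
    (hA : Continuous A) (hχ : Continuous χ) (hAU : ∀ y ∈ U, ∀ t, y + A t ∈ U)
    {H : W → G} (hH : ContinuousOn H U) {y : W} (hy : y ∈ U) :
    Continuous fun t => χ t • H (y + A t) :=
  hχ.smul (hH.comp_continuous (continuous_const.add hA) (hAU y hy))

variable [Fintype d]

/-- The mean over the unit cube, with weight `χ`, of the translates of `H`. -/
def cubeAverage {W G : Type*} [AddCommGroup W] [NormedAddCommGroup G] [NormedSpace ℂ G]
    (A : (d → ℝ) → W) (χ : (d → ℝ) → ℂ) (H : W → G) (y : W) : G :=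
  ∫ t in unitCube d, χ t • H (y + A t)

theorem integrableOn_unitCube {G : Type*} [NormedAddCommGroup G]
    {h : (d → ℝ) → G} (hh : Continuous h) : IntegrableOn h (unitCube d) :=
  (hh.continuousOn.integrableOn_compact isCompact_Icc).mono_set unitCube_subset_Icc

variable {W : Type u} [NormedAddCommGroup W] [NormedSpace ℝ W] [FiniteDimensional ℝ W]
  {A : (d → ℝ) → W} {χ : (d → ℝ) → ℂ} {U : Set W}

theorem hasFDerivAt_cubeAverage {G : Type*} [NormedAddCommGroup G] [NormedSpace ℂ G]
    (hU : IsOpen U) (hA : Continuous A) (hχ : Continuous χ) (hAU : ∀ y ∈ U, ∀ t, y + A t ∈ U)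
    {H : W → G} (hH : ContDiffOn ℝ 1 H U) {y : W} (hy : y ∈ U) :
    HasFDerivAt (cubeAverage A χ H) (cubeAverage A χ (fderiv ℝ H) y) y := by
  have hfd : ContinuousOn (fderiv ℝ H) U := hH.continuousOn_fderiv_of_isOpen hU le_rfl
  obtain ⟨ε, hε, hball⟩ := nhds_basis_closedBall.mem_iff.1 (hU.mem_nhds hy)
  have hc : ContinuousOn (fun q : W × (d → ℝ) => χ q.2 • fderiv ℝ H (q.1 + A q.2))
      (closedBall y ε ×ˢ Icc 0 1) := by
    refine (hχ.comp continuous_snd).continuousOn.smul (hfd.comp ?_ fun q hq =>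
      hAU _ (hball hq.1) _)
    exact (continuous_fst.add (hA.comp continuous_snd)).continuousOn
  obtain ⟨C, hC⟩ := ((isCompact_closedBall y ε).prod isCompact_Icc).exists_bound_of_continuousOn hc
  refine hasFDerivAt_integral_of_dominated_of_fderiv_le (bound := fun _ => C)
    (F' := fun y t => χ t • fderiv ℝ H (y + A t)) (closedBall_mem_nhds y hε) ?_ ?_ ?_ ?_ ?_ ?_
  · filter_upwards [hU.mem_nhds hy] with z hz
    exact (continuous_smul_translate hA hχ hAU hH.continuousOn hz).aestronglyMeasurable
  · exact integrableOn_unitCube (continuous_smul_translate hA hχ hAU hH.continuousOn hy)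
  · exact (continuous_smul_translate hA hχ hAU hfd hy).aestronglyMeasurable
  · refine (ae_restrict_mem (MeasurableSet.univ_pi fun _ => measurableSet_Ioc)).mono ?_
    intro t ht z hz
    exact hC (z, t) ⟨hz, unitCube_subset_Icc ht⟩
  · exact integrableOn_unitCube continuous_const
  · refine .of_forall fun t z hz => ?_
    have h1 : DifferentiableAt ℝ H (z + A t) :=
      (hH.contDiffAt (hU.mem_nhds (hAU z (hball hz) t))).differentiableAt (by simp)
    have h2 : HasFDerivAt (fun z => H (z + A t)) (fderiv ℝ H (z + A t)) z :=
      (hasFDerivAt_comp_add_right (A t)).2 h1.hasFDerivAt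
    exact h2.const_smul (χ t)

theorem contDiffOn_cubeAverage (hU : IsOpen U) (hA : Continuous A) (hχ : Continuous χ)
    (hAU : ∀ y ∈ U, ∀ t, y + A t ∈ U) (n : ℕ) {G : Type u}
    [NormedAddCommGroup G] [NormedSpace ℂ G] {H : W → G} (hH : ContDiffOn ℝ (n + 1) H U) :
    ContDiffOn ℝ n (cubeAverage A χ H) U := by
  have hd : ∀ {G : Type u} [NormedAddCommGroup G] [NormedSpace ℂ G] {H : W → G} (n : ℕ),
      ContDiffOn ℝ (n + 1) H U → ∀ y ∈ U,
      HasFDerivAt (cubeAverage A χ H) (cubeAverage A χ (fderiv ℝ H) y) y := fun n hH y hy =>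
    hasFDerivAt_cubeAverage hU hA hχ hAU (hH.of_le (by norm_cast; simp)) hy
  induction n generalizing G with
  | zero =>
    exact contDiffOn_zero.2 fun y hy => (hd 0 hH y hy).continuousAt.continuousWithinAt
  | succ n ih =>
    rw [show ((n + 1 : ℕ) : WithTop ℕ∞) = n + 1 by norm_cast,
      contDiffOn_succ_iff_fderiv_of_isOpen hU]
    refine ⟨fun y hy => (hd _ hH y hy).differentiableAt.differentiableWithinAt, by simp, ?_⟩
    have h1 : ContDiffOn ℝ (n + 1) (fderiv ℝ H) U := hH.fderiv_of_isOpen hU (by norm_cast)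
    exact (ih h1).congr fun y hy => (hd _ hH y hy).fderiv

theorem secondDeriv_cubeAverage {G : Type*} [NormedAddCommGroup G] [NormedSpace ℂ G]
    [CompleteSpace G] (hU : IsOpen U) (hA : Continuous A) (hχ : Continuous χ)
    (hAU : ∀ y ∈ U, ∀ t, y + A t ∈ U) {H : W → G} (hH : ContDiffOn ℝ 2 H U) {y : W} (hy : y ∈ U)
    (v : W) :
    secondDeriv (cubeAverage A χ H) y v = cubeAverage A χ (fun z => secondDeriv H z v) y := by
  have h1 : ContDiffOn ℝ 1 (fderiv ℝ H) U := hH.fderiv_of_isOpen hU (by norm_num)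
  have h2 : ContinuousOn (fderiv ℝ (fderiv ℝ H)) U := h1.continuousOn_fderiv_of_isOpen hU le_rfl
  have he : fderiv ℝ (cubeAverage A χ H) =ᶠ[𝓝 y] cubeAverage A χ (fderiv ℝ H) := by
    filter_upwards [hU.mem_nhds hy] with z hz
    exact (hasFDerivAt_cubeAverage hU hA hχ hAU (hH.of_le (by norm_num)) hz).fderiv
  rw [secondDeriv, he.fderiv_eq, (hasFDerivAt_cubeAverage hU hA hχ hAU h1 hy).fderiv]
  have hi := integrableOn_unitCube (continuous_smul_translate hA hχ hAU h2 hy)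
  simp only [cubeAverage]
  rw [ContinuousLinearMap.integral_apply hi v,
    ContinuousLinearMap.integral_apply (hi.apply_continuousLinearMap v) v]
  rfl

end CubeAverage

section Fourier

local instance : MeasureSpace UnitAddCircle := ⟨AddCircle.haarAddCircle⟩

local instance : Measure.IsAddHaarMeasure (volume : Measure UnitAddCircle) :=
  inferInstanceAs (Measure.IsAddHaarMeasure AddCircle.haarAddCircle)

open UnitAddTorus

variable {d : Type*} [Fintype d]

theorem mFourierCoeff_translate (g : UnitAddTorus d → ℂ) (n : d → ℤ) (σ : UnitAddTorus d) :
    mFourierCoeff (fun τ => g (τ + σ)) n = mFourier n σ * mFourierCoeff g n := by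
  unfold mFourierCoeff
  rw [← integral_sub_right_eq_self _ σ, ← integral_const_mul]
  congr 1
  funext τ
  have h1 : mFourier (-n) (τ - σ) = mFourier n σ * mFourier (-n) τ := by
    simp only [mFourier, ContinuousMap.coe_mk, ← Finset.prod_mul_distrib]
    refine Finset.prod_congr rfl fun i _ => ?_
    simp [fourier_apply, AddCircle.toCircle_add, sub_eq_add_neg, mul_comm]
  simp only [h1, sub_add_cancel, smul_eq_mul, mul_assoc]

theorem mFourierCoeff_mFourier (n : d → ℤ) : mFourierCoeff (mFourier n) = Pi.single n 1 := by
  funext m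
  rw [Pi.single_apply, ← orthonormal_iff_ite.1 orthonormal_mFourier m n, ← mFourierCoeff_toLp,
    ← mFourierBasis_repr, HilbertBasis.repr_apply_apply, coe_mFourierBasis]

theorem eq_zero_of_mFourierCoeff_eq_zero {g : UnitAddTorus d → ℂ} (hg : Continuous g)
    (h : ∀ n, mFourierCoeff g n = 0) (τ : UnitAddTorus d) : g τ = 0 := by
  have h0 : mFourierCoeff (⟨g, hg⟩ : C(UnitAddTorus d, ℂ)) = 0 := funext h
  have h1 := hasSum_mFourier_series_apply_of_summable (f := ⟨g, hg⟩)
    (by rw [h0]; exact summable_zero) τ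
  rw [h0] at h1
  simp only [Pi.zero_apply, zero_smul] at h1
  exact h1.unique hasSum_zero

theorem mFourierCoeff_add {g g' : UnitAddTorus d → ℂ} (hg : Continuous g) (hg' : Continuous g')
    (n : d → ℤ) : mFourierCoeff (g + g') n = mFourierCoeff g n + mFourierCoeff g' n := by
  have hi : ∀ {g : UnitAddTorus d → ℂ}, Continuous g →
      Integrable (fun t => mFourier (-n) t • g t) := fun hg =>
    ((mFourier (-n)).continuous.smul hg).integrable_of_hasCompactSupport
      (HasCompactSupport.of_compactSpace _)
  simp only [mFourierCoeff, Pi.add_apply, smul_add]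
  exact integral_add (hi hg) (hi hg')

theorem mFourierCoeff_const_mul (r : ℂ) (g : UnitAddTorus d → ℂ) (n : d → ℤ) :
    mFourierCoeff (fun τ => r * g τ) n = r * mFourierCoeff g n := by
  simp only [mFourierCoeff]
  rw [← integral_const_mul]
  congr 1
  funext τ
  simp only [smul_eq_mul]
  ring

end Fourier

section LatticeTorus

open UnitAddTorus

variable (L : Submodule ℤ E2) [DiscreteTopology L] [IsZLattice ℝ L]

/-- The index set of a basis of the lattice. -/
abbrev LatticeIndex := Module.Free.ChooseBasisIndex ℤ L

/-- A basis of `ℝ²` which generates the lattice. -/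
def latticeBasis : Basis (LatticeIndex L) ℝ E2 := (Module.Free.chooseBasis ℤ L).ofZLatticeBasis ℝ L

theorem latticeBasis_mem (i : LatticeIndex L) : latticeBasis L i ∈ L := by
  rw [latticeBasis, Basis.ofZLatticeBasis_apply]
  exact SetLike.coe_mem _

/-- The homomorphism from the circle to the torus given by a lattice vector. -/
def circleMap (i : LatticeIndex L) : UnitAddCircle →+ Torus L :=
  QuotientAddGroup.lift _
    ((QuotientAddGroup.mk' L.toAddSubgroup).comp
      ((LinearMap.toSpanSingleton ℝ E2 (latticeBasis L i)).toAddMonoidHom)) <| by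
    rw [AddSubgroup.zmultiples_le]
    simpa using latticeBasis_mem L i

theorem continuous_circleMap (i : LatticeIndex L) : Continuous (circleMap L i) := by
  refine continuous_quot_lift _ ?_
  exact continuous_quotient_mk'.comp (continuous_id.smul continuous_const)

/-- The isomorphism from the standard torus to `ℝ² / L`. -/
def torusMap (τ : UnitAddTorus (LatticeIndex L)) : Torus L := ∑ i, circleMap L i (τ i)

/-- The linear combination of the lattice basis with given coefficients. -/
def latticeComb (t : LatticeIndex L → ℝ) : E2 := ∑ i, t i • latticeBasis L i

theorem continuous_latticeComb : Continuous (latticeComb L) := by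
  unfold latticeComb
  fun_prop

theorem latticeComb_repr (w : E2) : latticeComb L (fun i => (latticeBasis L).repr w i) = w :=
  (latticeBasis L).sum_repr w

theorem torusMap_coe (t : LatticeIndex L → ℝ) :
    torusMap L (fun i => (t i : UnitAddCircle)) = QuotientAddGroup.mk (latticeComb L t) := by
  have := map_sum (QuotientAddGroup.mk' L.toAddSubgroup) (fun i => t i • latticeBasis L i)
    Finset.univ
  exact this.symm

theorem torusMap_add (τ σ : UnitAddTorus (LatticeIndex L)) :
    torusMap L (τ + σ) = torusMap L τ + torusMap L σ := by
  simp [torusMap, Finset.sum_add_distrib]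

theorem continuous_torusMap : Continuous (torusMap L) :=
  continuous_finsetSum _ fun i _ => (continuous_circleMap L i).comp (continuous_apply i)

/-- The point of the standard torus with the coordinates of `w`. -/
def torusCoord (w : E2) : UnitAddTorus (LatticeIndex L) :=
  fun i => (((latticeBasis L).repr w i : ℝ) : UnitAddCircle)

theorem torusMap_torusCoord (w : E2) : torusMap L (torusCoord L w) = QuotientAddGroup.mk w := by
  have := torusMap_coe L (fun i => (latticeBasis L).repr w i)
  rwa [latticeComb_repr] at this

/-- The element of the dual lattice with given coefficients. -/
def dualVector (n : LatticeIndex L → ℤ) : E2 :=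
  (InnerProductSpace.toDual ℝ E2).symm
    (∑ i, (n i : ℝ) • ((latticeBasis L).coord i).toContinuousLinearMap)

theorem inner_dualVector (n : LatticeIndex L → ℤ) (w : E2) :
    inner ℝ (dualVector L n) w = ∑ i, n i * (latticeBasis L).repr w i := by
  rw [dualVector, InnerProductSpace.toDual_symm_apply]
  simp

theorem inner_dualVector_latticeBasis (n : LatticeIndex L → ℤ) (i : LatticeIndex L) :
    inner ℝ (dualVector L n) (latticeBasis L i) = n i := by
  rw [inner_dualVector]
  simp [Finsupp.single_apply]

theorem mFourier_torusCoord (n : LatticeIndex L → ℤ) (w : E2) :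
    mFourier n (torusCoord L w) = character (dualVector L n) w := by
  simp only [mFourier, ContinuousMap.coe_mk, torusCoord, fourier_coe_apply, character,
    inner_dualVector, ← Complex.exp_sum]
  congr 1
  push_cast
  rw [Finset.mul_sum]
  refine Finset.sum_congr rfl fun i _ => ?_
  ring

theorem finite_dualVector (r : ℝ) : {n : LatticeIndex L → ℤ | ‖dualVector L n‖ ≤ r}.Finite := by
  refine (finite_Icc (fun i => ⌊-(r * ‖latticeBasis L i‖)⌋)
    (fun i => ⌈r * ‖latticeBasis L i‖⌉)).subset fun n hn => ?_
  have h : ∀ i, |(n i : ℝ)| ≤ r * ‖latticeBasis L i‖ := fun i => by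
    rw [← inner_dualVector_latticeBasis L n i]
    exact (abs_real_inner_le_norm _ _).trans
      (mul_le_mul_of_nonneg_right hn (norm_nonneg _))
  refine ⟨fun i => ?_, fun i => ?_⟩
  · have := (abs_le.1 (h i)).1
    exact_mod_cast (Int.floor_le _).trans this
  · have := (abs_le.1 (h i)).2
    exact_mod_cast this.trans (Int.le_ceil _)

end LatticeTorus

section FourierProjection

open UnitAddTorus

variable (L : Submodule ℤ E2) [DiscreteTopology L] [IsZLattice ℝ L]

/-- The component of a function on `S² × T²` in the direction of the `n`-th character of `T²`. -/
def fourierComponent (n : LatticeIndex L → ℤ) (f : SphereTorus L → ℂ) : SphereTorus L → ℂ :=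
  fun x => mFourierCoeff (fun τ => f (x.1, x.2 + torusMap L τ)) n

variable {L} {c : E2 →ₗ[ℝ] Matrix (Fin 3) (Fin 3) ℝ} {μ : ℝ} {f g : SphereTorus L → ℂ}
  (n : LatticeIndex L → ℤ)

theorem continuous_orbit (hf : Continuous f) (x : SphereTorus L) :
    Continuous fun τ => f (x.1, x.2 + torusMap L τ) :=
  hf.comp (continuous_const.prodMk (continuous_const.add (continuous_torusMap L)))

theorem fourierComponent_add (hf : Continuous f) (hg : Continuous g) :
    fourierComponent L n (f + g) = fourierComponent L n f + fourierComponent L n g :=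
  funext fun x => mFourierCoeff_add (continuous_orbit hf x) (continuous_orbit hg x) n

theorem fourierComponent_smul (r : ℂ) :
    fourierComponent L n (r • f) = r • fourierComponent L n f :=
  funext fun _ => mFourierCoeff_const_mul r _ n

theorem fourierComponent_translate (p : S2) (q : Torus L) (w : E2) :
    fourierComponent L n f (p, q + QuotientAddGroup.mk w)
      = character (dualVector L n) w * fourierComponent L n f (p, q) := by
  rw [← mFourier_torusCoord, fourierComponent, fourierComponent, ← mFourierCoeff_translate]
  simp only [torusMap_add, torusMap_torusCoord]
  congr 1
  funext τ
  rw [add_assoc, add_comm (QuotientAddGroup.mk w)]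

theorem eq_zero_of_fourierComponent_eq_zero (hf : Continuous f)
    (h : ∀ n, fourierComponent L n f = 0) : f = 0 := by
  funext x
  obtain ⟨w, hw⟩ := QuotientAddGroup.mk_surjective x.2
  have h1 := eq_zero_of_mFourierCoeff_eq_zero (continuous_orbit hf (x.1, 0))
    (fun n => congrFun (h n) (x.1, 0)) (torusCoord L w)
  rw [torusMap_torusCoord, hw, zero_add] at h1
  exact h1

theorem fourierComponent_of_weight (m n : LatticeIndex L → ℤ)
    (h : ∀ (p : S2) (q : Torus L) (w : E2),
      f (p, q + QuotientAddGroup.mk w) = character (dualVector L n) w * f (p, q)) :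
    fourierComponent L m f = if m = n then f else 0 := by
  funext x
  have h1 : (fun τ => f (x.1, x.2 + torusMap L τ)) = fun τ => f x * mFourier n τ := by
    funext τ
    obtain ⟨t, rfl⟩ : ∃ t : LatticeIndex L → ℝ, (fun i => (t i : UnitAddCircle)) = τ := by
      choose t ht using fun i => QuotientAddGroup.mk_surjective (τ i)
      exact ⟨t, funext ht⟩
    have h2 : torusCoord L (latticeComb L t) = fun i => (t i : UnitAddCircle) := by
      funext i
      simp [torusCoord, latticeComb, Finsupp.single_apply]
    rw [torusMap_coe, h, ← mFourier_torusCoord, h2, mul_comm]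
  rw [fourierComponent, h1, mFourierCoeff_const_mul, mFourierCoeff_mFourier,
    Pi.single_apply]
  split_ifs <;> simp

/-- The weight with which the `n`-th Fourier component is a cube average. -/
def cubeWeight {ι : Type*} [Fintype ι] (n : ι → ℤ) (t : ι → ℝ) : ℂ :=
  mFourier (-n) (fun i => (t i : UnitAddCircle))

theorem continuous_cubeWeight {ι : Type*} [Fintype ι] (n : ι → ℤ) : Continuous (cubeWeight n) :=
  (mFourier (-n)).continuous.comp
    (continuous_pi fun i => (AddCircle.continuous_mk' 1).comp (continuous_apply i))

variable (L) in
/-- The vertical vector of `ℝ³ × ℝ²` with coordinates `t` in the lattice basis. -/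
def verticalComb (t : LatticeIndex L → ℝ) : E3 × E2 := (0, latticeComb L t)

variable (L) in
theorem continuous_verticalComb : Continuous (verticalComb L) :=
  continuous_const.prodMk (continuous_latticeComb L)

theorem isOpen_fst_ne_zero : IsOpen {y : E3 × E2 | y.1 ≠ 0} :=
  isOpen_compl_singleton.preimage continuous_fst

theorem add_verticalComb_fst_ne_zero :
    ∀ y ∈ {y : E3 × E2 | y.1 ≠ 0}, ∀ t, y + verticalComb L t ∈ {y : E3 × E2 | y.1 ≠ 0} :=
  fun y hy t => by simpa [verticalComb] using hy

theorem lift_fourierComponent :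
    lift L (fourierComponent L n f) = cubeAverage (verticalComb L) (cubeWeight n) (lift L f) := by
  funext y
  rw [lift, fourierComponent, mFourierCoeff_eq_integral _ _ 0]
  simp only [torusMap_coe]
  simp [cubeAverage, unitCube, lift, cubeWeight, verticalComb, Set.pi]

theorem contMDiff_fourierComponent (hf : ContMDiff IST 𝓘(ℝ, ℂ) ∞ f) :
    ContMDiff IST 𝓘(ℝ, ℂ) ∞ (fourierComponent L n f) := by
  have hon : ContDiffOn ℝ ∞ (lift L (fourierComponent L n f)) {y : E3 × E2 | y.1 ≠ 0} := by
    rw [lift_fourierComponent]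
    exact contDiffOn_infty.2 fun m =>
      contDiffOn_cubeAverage isOpen_fst_ne_zero (continuous_verticalComb L)
        (continuous_cubeWeight n) add_verticalComb_fst_ne_zero m fun y hy =>
          ((contDiffAt_lift L hf hy).of_le (by norm_cast; simp)).contDiffWithinAt
  exact contMDiff_of_contDiffAt_lift L fun y hy =>
    hon.contDiffAt (isOpen_fst_ne_zero.mem_nhds hy)

theorem liftLaplacian_cubeAverage {F : E3 × E2 → ℂ}
    (hF : ContDiffOn ℝ 2 F {y : E3 × E2 | y.1 ≠ 0}) {y : E3 × E2} (hy : y.1 ≠ 0) :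
    liftLaplacian c (cubeAverage (verticalComb L) (cubeWeight n) F) y
      = cubeAverage (verticalComb L) (cubeWeight n) (liftLaplacian c F) y := by
  have hA := continuous_verticalComb L
  have hχ := continuous_cubeWeight n
  have hAU := add_verticalComb_fst_ne_zero (L := L)
  have h2 : ContinuousOn (fderiv ℝ (fderiv ℝ F)) {y : E3 × E2 | y.1 ≠ 0} :=
    (hF.fderiv_of_isOpen (m := 1) isOpen_fst_ne_zero
      (by norm_num)).continuousOn_fderiv_of_isOpen isOpen_fst_ne_zero le_rfl
  have hi : ∀ v, IntegrableOn (fun t => cubeWeight n t • secondDeriv F (y + verticalComb L t) v)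
      (unitCube (LatticeIndex L)) := fun v =>
    integrableOn_unitCube (continuous_smul_translate hA hχ hAU (H := fun z => secondDeriv F z v)
      ((h2.clm_apply continuousOn_const).clm_apply continuousOn_const) hy)
  have hfst : ∀ t, (y + verticalComb L t).1 = y.1 := fun _ => add_zero y.1
  simp only [liftLaplacian, secondDeriv_cubeAverage isOpen_fst_ne_zero hA hχ hAU hF hy]
  simp only [cubeAverage, liftLaplacian, smul_add, Finset.smul_sum, hfst]
  rw [integral_add (integrable_finsetSum _ fun i _ => hi _)
    (integrable_finsetSum _ fun i _ => hi _), integral_finsetSum _ fun i _ => hi _,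
    integral_finsetSum _ fun i _ => hi _]

theorem fourierComponent_mem_weightSpace (hs : ∀ Z, (c Z).IsSymm)
    (hf : f ∈ eigenspace (metric L c) μ) :
    fourierComponent L n f ∈ weightSpace L c μ (dualVector L n) := by
  have hF : ContDiffOn ℝ 2 (lift L f) {y : E3 × E2 | y.1 ≠ 0} := fun y hy =>
    ((contDiffAt_lift L hf.1 hy).of_le (by norm_cast)).contDiffWithinAt
  refine ⟨(mem_eigenspace_iff L hs).2 ⟨contMDiff_fourierComponent n hf.1, fun p z => ?_⟩,
    fourierComponent_translate n⟩
  rw [lift_fourierComponent, liftLaplacian_cubeAverage n hF (ne_zero_of_mem_unit_sphere p),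
    cubeAverage, cubeAverage, ← integral_const_mul, ← integral_neg]
  congr 1
  funext t
  have ht : ((p : E3), z) + verticalComb L t = ((p : E3), z + latticeComb L t) := by
    simp [verticalComb]
  rw [ht, ((mem_eigenspace_iff L hs).1 hf).2 p]
  simp only [smul_eq_mul]
  ring

end FourierProjection

section Isospectral

variable {L : Submodule ℤ E2} [DiscreteTopology L] [IsZLattice ℝ L]
  {c : E2 →ₗ[ℝ] Matrix (Fin 3) (Fin 3) ℝ}

variable (L) in
/-- The finitely many weights which occur in an eigenspace. -/
def eigenWeights (μ : ℝ) : Set (LatticeIndex L → ℤ) :=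
  {n | 4 * Real.pi ^ 2 * ‖dualVector L n‖ ^ 2 ≤ μ}

theorem finite_eigenWeights (μ : ℝ) : (eigenWeights L μ).Finite := by
  refine (finite_dualVector L √(μ / (4 * Real.pi ^ 2))).subset fun n hn => ?_
  refine Real.le_sqrt_of_sq_le ?_
  rw [le_div_iff₀ (by positivity), mul_comm]
  exact hn

/-- The `n`-th Fourier component of an eigenfunction. -/
def fourierProjection (hs : ∀ Z, (c Z).IsSymm) (μ : ℝ) (n : LatticeIndex L → ℤ) :
    eigenspace (metric L c) μ →ₗ[ℂ] weightSpace L c μ (dualVector L n) where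
  toFun f := ⟨fourierComponent L n f, fourierComponent_mem_weightSpace n hs f.2⟩
  map_add' f g := by
    have := fourierComponent_add n f.2.1.continuous
      g.2.1.continuous
    apply Subtype.ext
    simp only [Submodule.coe_add, this]
  map_smul' r f := by
    have := fourierComponent_smul n r (f := f.1)
    apply Subtype.ext
    simp only [Submodule.coe_smul, this, RingHom.id_apply]

theorem fourierProjection_inclusion (hs : ∀ Z, (c Z).IsSymm) {μ : ℝ} (m n : LatticeIndex L → ℤ)
    (f : weightSpace L c μ (dualVector L n)) :
    (fourierProjection hs μ m (Submodule.inclusion weightSpace_le f) : SphereTorus L → ℂ)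
      = if m = n then (f : SphereTorus L → ℂ) else 0 :=
  fourierComponent_of_weight m n f.2.2

/-- The decomposition of an eigenspace into Fourier components. -/
def fourierDecomposition (hs : ∀ Z, (c Z).IsSymm) (μ : ℝ) :
    eigenspace (metric L c) μ →ₗ[ℂ] Π n : eigenWeights L μ, weightSpace L c μ (dualVector L n.1) :=
  LinearMap.pi fun n => fourierProjection hs μ n.1

theorem injective_fourierDecomposition (hs : ∀ Z, (c Z).IsSymm) (μ : ℝ) :
    Function.Injective (fourierDecomposition (L := L) hs μ) := by
  rw [injective_iff_map_eq_zero]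
  intro f hf
  refine Subtype.ext (eq_zero_of_fourierComponent_eq_zero f.2.1.continuous fun n => ?_)
  by_cases hn : n ∈ eigenWeights L μ
  · exact congrArg Subtype.val (congrFun hf ⟨n, hn⟩)
  · by_contra h0
    exact hn (norm_weight_le hs (fourierComponent_mem_weightSpace n hs f.2) h0)

theorem surjective_fourierDecomposition (hs : ∀ Z, (c Z).IsSymm) (μ : ℝ) :
    Function.Surjective (fourierDecomposition (L := L) hs μ) := by
  classical
  intro h
  have : Fintype (eigenWeights L μ) := (finite_eigenWeights μ).fintype
  refine ⟨∑ n, Submodule.inclusion weightSpace_le (h n), funext fun m => Subtype.ext ?_⟩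
  change ((fourierProjection hs μ m.1 _ : weightSpace L c μ (dualVector L m.1)) :
    SphereTorus L → ℂ) = _
  rw [map_sum, Submodule.coe_sum]
  simp [fourierProjection_inclusion, Subtype.coe_inj]

/-- An eigenspace is the direct sum of its Fourier components. -/
def eigenspaceEquiv (hs : ∀ Z, (c Z).IsSymm) (μ : ℝ) :
    eigenspace (metric L c) μ ≃ₗ[ℂ] Π n : eigenWeights L μ, weightSpace L c μ (dualVector L n.1) :=
  .ofBijective (fourierDecomposition hs μ)
    ⟨injective_fourierDecomposition hs μ, surjective_fourierDecomposition hs μ⟩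

theorem isospectral_of_rotations {c' : E2 →ₗ[ℝ] Matrix (Fin 3) (Fin 3) ℝ}
    (hs : ∀ Z, (c Z).IsSymm) (hs' : ∀ Z, (c' Z).IsSymm)
    (h : ∀ k, ∃ R : E3 ≃ₗᵢ[ℝ] E3, ∀ x X, inner ℝ k (oneForm c' (R x) (R X))
      = inner ℝ k (oneForm c x X)) :
    Isospectral (metric L c) (metric L c') := by
  intro μ
  choose R hR using h
  let e (n : eigenWeights L μ) :
      weightSpace L c' μ (dualVector L n.1) ≃ₗ[ℂ] weightSpace L c μ (dualVector L n.1) :=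
    weightSpaceEquiv hs hs' (R (dualVector L n)) (hR (dualVector L n))
  exact (eigenspaceEquiv hs μ ≪≫ₗ (LinearEquiv.piCongrRight e).symm ≪≫ₗ
    (eigenspaceEquiv hs' μ).symm).rank_eq

end Isospectral

section ScalarCurvatureValues

variable {L : Submodule ℤ E2} [DiscreteTopology L]

theorem scalarCurvature_c₁ (x : SphereTorus L) : scalarCurvature (metric L c₁) x
    = 2 - 9 / 2 * ((x.1.1 2 ^ 2 - x.1.1 0 ^ 2) ^ 2 + (2 * x.1.1 1 * (x.1.1 0 + x.1.1 2)) ^ 2) := by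
  rw [scalarCurvature_metric c₁_isSymm c₁_trace]
  simp only [dotProduct, Matrix.mulVec, c₁, pencil, Fin.isValue, Matrix.smul_of, Matrix.smul_cons,
    smul_eq_mul, mul_neg, mul_one, mul_zero, Matrix.smul_empty, Matrix.of_add_of, Matrix.add_cons,
    Matrix.head_cons, add_zero, Matrix.tail_cons, zero_add, Matrix.empty_add_empty,
    LinearMap.coe_mk, AddHom.coe_mk, PiLp.single_apply, Matrix.of_apply, Matrix.cons_val',
    Matrix.cons_val_fin_one, Fin.sum_univ_three, Matrix.cons_val_zero, Matrix.cons_val_one,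
    Matrix.cons_val, neg_mul, ite_mul, one_mul, zero_mul, Fin.sum_univ_two, ↓reduceIte,
    one_ne_zero, zero_ne_one, neg_zero, sub_right_inj, mul_eq_mul_left_iff, div_eq_zero_iff,
    OfNat.ofNat_ne_zero, or_self, or_false]
  ring

theorem scalarCurvature_c₂ (x : SphereTorus L) : scalarCurvature (metric L c₂) x
    = 2 - 9 / 2 * ((x.1.1 2 ^ 2 - x.1.1 0 ^ 2) ^ 2 + (2 * √2 * (x.1.1 0 * x.1.1 2)) ^ 2) := by
  rw [scalarCurvature_metric c₂_isSymm c₂_trace]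
  simp only [dotProduct, Matrix.mulVec, c₂, pencil, Fin.isValue, Matrix.smul_of, Matrix.smul_cons,
    smul_eq_mul, mul_neg, mul_one, mul_zero, Matrix.smul_empty, Matrix.of_add_of, Matrix.add_cons,
    Matrix.head_cons, add_zero, Matrix.tail_cons, zero_add, Matrix.empty_add_empty,
    LinearMap.coe_mk, AddHom.coe_mk, PiLp.single_apply, ite_mul, one_mul, zero_mul,
    Matrix.of_apply, Matrix.cons_val', Matrix.cons_val_fin_one, Fin.sum_univ_three,
    Matrix.cons_val_zero, Matrix.cons_val_one, Matrix.cons_val, neg_mul, Fin.sum_univ_two,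
    ↓reduceIte, one_ne_zero, zero_ne_one, neg_zero, sub_right_inj, mul_eq_mul_left_iff,
    div_eq_zero_iff, OfNat.ofNat_ne_zero, or_self, or_false]
  ring

theorem sum_sq_eq_one (p : S2) : p.1 0 ^ 2 + p.1 1 ^ 2 + p.1 2 ^ 2 = 1 := by
  have h := norm_eq_of_mem_sphere p
  rw [EuclideanSpace.norm_eq, Real.sqrt_eq_one, Fin.sum_univ_three] at h
  simpa using h

theorem eq_vec_three_iff {p : E3} {a b c : ℝ} : p = !₂[a, b, c] ↔ p 0 = a ∧ p 1 = b ∧ p 2 = c := by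
  simp [PiLp.ext_iff, Fin.forall_fin_succ]

theorem two_sub_mul_sum_sq_eq_two_iff {a b : ℝ} :
    2 - 9 / 2 * (a ^ 2 + b ^ 2) = 2 ↔ a = 0 ∧ b = 0 := by
  rw [← add_eq_zero_iff_of_nonneg (sq_nonneg a) (sq_nonneg b) |>.trans
    (and_congr sq_eq_zero_iff sq_eq_zero_iff)]
  constructor <;> intro h <;> linarith

theorem scalarCurvature_c₁_eq_two_iff (x : SphereTorus L) :
    scalarCurvature (metric L c₁) x = 2 ↔ x.1.1 0 = -x.1.1 2 ∨
      (x.1.1 = !₂[1 / √2, 0, 1 / √2] ∨ x.1.1 = !₂[-1 / √2, 0, -1 / √2]) := by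
  rw [scalarCurvature_c₁, two_sub_mul_sum_sq_eq_two_iff, eq_vec_three_iff, eq_vec_three_iff]
  have hs := sum_sq_eq_one x.1
  generalize x.1.1 0 = a, x.1.1 1 = b, x.1.1 2 = c at hs ⊢
  constructor
  · rintro ⟨hac, hb⟩
    by_cases h0 : a = -c
    · exact .inl h0
    have h1 : a + c ≠ 0 := fun h => h0 (eq_neg_of_add_eq_zero_left h)
    have hb : b = 0 := by simpa [h1] using hb
    have hc : c = a := by
      refine sub_eq_zero.1 ((mul_eq_zero.1 ?_).resolve_right h1)
      linear_combination hac
    have ha : a ^ 2 = (1 / √2) ^ 2 := by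
      rw [div_pow, Real.sq_sqrt zero_le_two]
      rw [hc, hb] at hs
      linarith
    rw [hb, hc, neg_div]
    exact .inr ((sq_eq_sq_iff_eq_or_eq_neg.1 ha).imp (fun h => ⟨h, rfl, h⟩) fun h => ⟨h, rfl, h⟩)
  · rintro (h | ⟨h0, h1, h2⟩ | ⟨h0, h1, h2⟩)
    · simp [h]
    · simp [h0, h1, h2]
    · simp [h0, h1, h2]

theorem eq_pole_or_eq_neg_pole_iff {p : S2} :
    p.1 = !₂[0, 1, 0] ∨ p.1 = !₂[0, -1, 0] ↔ p.1 0 = 0 ∧ p.1 2 = 0 := by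
  rw [eq_vec_three_iff, eq_vec_three_iff]
  have hs := sum_sq_eq_one p
  generalize p.1 0 = a, p.1 1 = b, p.1 2 = c at hs ⊢
  constructor
  · rintro (⟨ha, -, hc⟩ | ⟨ha, -, hc⟩) <;> exact ⟨ha, hc⟩
  · rintro ⟨rfl, rfl⟩
    have hb : b = 1 ∨ b = -1 := mul_self_eq_one_iff.1 (by linarith)
    exact hb.imp (fun h => ⟨rfl, h, rfl⟩) fun h => ⟨rfl, h, rfl⟩

theorem scalarCurvature_c₂_eq_two_iff (x : SphereTorus L) :
    scalarCurvature (metric L c₂) x = 2 ↔ x.1.1 = !₂[0, 1, 0] ∨ x.1.1 = !₂[0, -1, 0] := by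
  rw [scalarCurvature_c₂, two_sub_mul_sum_sq_eq_two_iff, eq_pole_or_eq_neg_pole_iff]
  constructor
  · rintro ⟨hac, h⟩
    have h : x.1.1 0 = 0 ∨ x.1.1 2 = 0 := by simpa using h
    rcases h with h | h <;> simpa [h] using hac
  · rintro ⟨h0, h2⟩
    simp [h0, h2]

variable (L) in
theorem preimage_scalarCurvature_c₁ : scalarCurvature (metric L c₁) ⁻¹' {2} =
    ({p : S2 | p.1 0 = -p.1 2} ∪
      {p : S2 | p.1 = !₂[1 / √2, 0, 1 / √2] ∨ p.1 = !₂[-1 / √2, 0, -1 / √2]}) ×ˢ univ := by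
  ext x
  exact (scalarCurvature_c₁_eq_two_iff x).trans (and_iff_left (mem_univ _)).symm

variable (L) in
theorem preimage_scalarCurvature_c₂ : scalarCurvature (metric L c₂) ⁻¹' {2} =
    {p : S2 | p.1 = !₂[0, 1, 0] ∨ p.1 = !₂[0, -1, 0]} ×ˢ univ := by
  ext x
  exact (scalarCurvature_c₂_eq_two_iff x).trans (and_iff_left (mem_univ _)).symm

/-- The point `(0, 1, 0)`, at which both metrics have scalar curvature `2`. -/
def pole : S2 := ⟨!₂[0, 1, 0], by simp [EuclideanSpace.norm_eq, Fin.sum_univ_three]⟩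

variable (L) in
theorem isGreatest_range_scalarCurvature_c₁ :
    IsGreatest (range (scalarCurvature (metric L c₁))) 2 := by
  refine ⟨⟨(pole, 0), (scalarCurvature_c₁_eq_two_iff _).2 (.inl (by simp [pole]))⟩,
    forall_mem_range.2 fun x => ?_⟩
  rw [scalarCurvature_c₁]
  exact sub_le_self 2 (by positivity)

variable (L) in
theorem isGreatest_range_scalarCurvature_c₂ :
    IsGreatest (range (scalarCurvature (metric L c₂))) 2 := by
  refine ⟨⟨(pole, 0), (scalarCurvature_c₂_eq_two_iff _).2 (.inl rfl)⟩,
    forall_mem_range.2 fun x => ?_⟩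
  rw [scalarCurvature_c₂]
  exact sub_le_self 2 (by positivity)

end ScalarCurvatureValues

section LevelSets

variable {E V W : Type*} [NormedAddCommGroup E] [NormedSpace ℝ E] [CompleteSpace E]
  [NormedAddCommGroup V] [NormedSpace ℝ V] [CompleteSpace V]
  [NormedAddCommGroup W] [NormedSpace ℝ W]

-- A function constant on a level set of `F` has a local extremum there, and its Lagrange multiplier
-- relation says that its differential factors through that of `F`.
theorem ker_le_ker_of_eventually_eq_imp_eq {F : E → V} {G : E → W} {F' : E →L[ℝ] V}
    {G' : E →L[ℝ] W} {a : E} (hF : HasStrictFDerivAt F F' a) (hsurj : Function.Surjective F')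
    (hG : HasStrictFDerivAt G G' a) (h : ∀ᶠ y in 𝓝 a, F y = F a → G y = G a) :
    F'.ker ≤ G'.ker := by
  intro v (hv : F' v = 0)
  refine SeparatingDual.eq_zero_of_forall_dual_eq_zero (R := ℝ) fun ℓ => ?_
  have hextr : IsLocalExtrOn (ℓ ∘ G) {y | F y = F a} a :=
    .inl <| eventually_nhdsWithin_iff.2 <| h.mono fun y hy hFy => (congrArg ℓ (hy hFy)).ge
  obtain ⟨Λ, Λ₀, hne, hΛ⟩ :=
    hextr.exists_linear_map_of_hasStrictFDerivAt hF (ℓ.hasStrictFDerivAt.comp a hG)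
  have hΛ₀ : Λ₀ ≠ 0 := by
    rintro rfl
    refine hne (Prod.ext (LinearMap.ext fun w => ?_) rfl)
    obtain ⟨u, rfl⟩ := hsurj w
    simpa using hΛ u
  simpa [hv, hΛ₀] using hΛ v

end LevelSets

theorem finrank_le_finrank_of_ker_le_ker {K E V W : Type*} [DivisionRing K] [AddCommGroup E]
    [Module K E] [AddCommGroup V] [Module K V] [FiniteDimensional K V] [AddCommGroup W] [Module K W]
    {A : E →ₗ[K] V} {B : E →ₗ[K] W} (hB : Function.Surjective B) (h : A.ker ≤ B.ker) :
    finrank K W ≤ finrank K V := by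
  have hsurj : Function.Surjective (A.ker.liftQ B h ∘ₗ A.quotKerEquivRange.symm.toLinearMap) := by
    refine Function.Surjective.comp (g := A.ker.liftQ B h) (fun w => ?_)
      A.quotKerEquivRange.symm.surjective
    obtain ⟨v, rfl⟩ := hB w
    exact ⟨A.ker.mkQ v, rfl⟩
  exact (LinearMap.finrank_le_finrank_of_surjective hsurj).trans A.range.finrank_le

section Codimension

variable {E : Type*} [NormedAddCommGroup E] [NormedSpace ℝ E]
  {H : Type*} [TopologicalSpace H] {I : ModelWithCorners ℝ E H} [I.Boundaryless]
  {M : Type*} [TopologicalSpace M] [ChartedSpace H M] [IsManifold I ∞ M]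
  {E' : Type*} [NormedAddCommGroup E'] [NormedSpace ℝ E']
  {H' : Type*} [TopologicalSpace H'] {I' : ModelWithCorners ℝ E' H'}
  {M' : Type*} [TopologicalSpace M'] [ChartedSpace H' M']

theorem hasStrictFDerivAt_comp_extChartAt_symm {V : Type*} [NormedAddCommGroup V] [NormedSpace ℝ V]
    {F : M → V} {x : M} (hF : ContMDiffAt I 𝓘(ℝ, V) ∞ F x) :
    HasStrictFDerivAt (F ∘ (extChartAt I x).symm) (mvfderiv I F x) (extChartAt I x x) := by
  have hsymm : ContMDiffAt 𝓘(ℝ, E) I ∞ (extChartAt I x).symm (extChartAt I x x) :=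
    (contMDiffOn_extChartAt_symm x).contMDiffAt (extChartAt_target_mem_nhds x)
  have hcomp : ContDiffAt ℝ ∞ (F ∘ (extChartAt I x).symm) (extChartAt I x x) :=
    contMDiffAt_iff_contDiffAt.1 <|
      ContMDiffAt.comp _ (by rwa [extChartAt_to_inv]) hsymm
  have hder : mvfderiv I F x = fderiv ℝ (F ∘ (extChartAt I x).symm) (extChartAt I x x) := by
    change mfderiv I 𝓘(ℝ, V) F x = _
    rw [(hF.mdifferentiableAt (by simp)).mfderiv, I.range_eq_univ, fderivWithin_univ]
    rfl
  rw [hder]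
  exact hcomp.hasStrictFDerivAt (by simp)

variable [CompleteSpace E]

theorem ker_mvfderiv_le_ker_mvfderiv {V W : Type*} [NormedAddCommGroup V] [NormedSpace ℝ V]
    [CompleteSpace V] [NormedAddCommGroup W] [NormedSpace ℝ W] {F : M → V} {G : M → W} {x : M}
    (hF : ContMDiffAt I 𝓘(ℝ, V) ∞ F x) (hsurj : Function.Surjective (mvfderiv I F x))
    (hG : ContMDiffAt I 𝓘(ℝ, W) ∞ G x) (h : ∀ᶠ y in 𝓝 x, F y = F x → G y = G x) :
    (mvfderiv I F x : E →L[ℝ] V).ker ≤ (mvfderiv I G x : E →L[ℝ] W).ker := by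
  have hsymm := continuousAt_extChartAt_symm (I := I) x
  rw [ContinuousAt, extChartAt_to_inv] at hsymm
  refine ker_le_ker_of_eventually_eq_imp_eq (E := E) (hasStrictFDerivAt_comp_extChartAt_symm hF)
    hsurj (hasStrictFDerivAt_comp_extChartAt_symm hG) ?_
  simpa only [Function.comp_apply, extChartAt_to_inv] using hsymm.eventually h

theorem IsSubmanifoldOfCodim.le_of_eventually_mem {k k' : ℕ} {N : Set M} {N' : Set M'}
    (hN : IsSubmanifoldOfCodim I k N) (hN' : IsSubmanifoldOfCodim I' k' N') {f : M → M'} {x : M}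
    (hx : x ∈ N) (hf : ContMDiffAt I I' ∞ f x) (hsurj : Function.Surjective (mfderiv I I' f x))
    (h : ∀ᶠ y in 𝓝 x, y ∈ N → f y ∈ N') : k' ≤ k := by
  obtain ⟨U, F, hU, hxU, hF, hFsurj, hNU⟩ := hN.2 x hx
  obtain ⟨U', F', hU', hxU', hF', hFsurj', hNU'⟩ := hN'.2 (f x) (h.self_of_nhds hx)
  have hF'x : ContMDiffAt I' 𝓘(ℝ, EuclideanSpace ℝ (Fin k')) ∞ F' (f x) :=
    hF'.contMDiffAt (hU'.mem_nhds hxU')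
  have hsurj' : Function.Surjective (mvfderiv I (F' ∘ f) x) := by
    have hcomp := mfderiv_comp x (hF'x.mdifferentiableAt (by simp)) (hf.mdifferentiableAt (by simp))
    intro w
    obtain ⟨u, rfl⟩ := hFsurj' (f x) hxU' w
    obtain ⟨v, rfl⟩ := hsurj u
    exact ⟨v, congrArg (fun A => A v) hcomp⟩
  have hker : (mvfderiv I F x : E →L[ℝ] _).ker ≤ (mvfderiv I (F' ∘ f) x : E →L[ℝ] _).ker := by
    refine ker_mvfderiv_le_ker_mvfderiv (hF.contMDiffAt (hU.mem_nhds hxU)) (hFsurj x hxU)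
      (hF'x.comp x hf) ?_
    have hzero {y} (hy : y ∈ N) (hyU : y ∈ U) : F y = 0 := (hNU.le ⟨hy, hyU⟩).2
    have hzero' {y} (hy : y ∈ N') (hyU : y ∈ U') : F' y = 0 := (hNU'.le ⟨hy, hyU⟩).2
    filter_upwards [hU.mem_nhds hxU, hf.continuousAt.preimage_mem_nhds (hU'.mem_nhds hxU'), h]
      with y hyU hyU' hy hFy
    have hyN : y ∈ N := (hNU.ge ⟨hyU, hFy.trans (hzero hx hxU)⟩).1
    exact (hzero' (hy hyN) hyU').trans (hzero' (h.self_of_nhds hx) hxU').symm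
  have hfin := finrank_le_finrank_of_ker_le_ker (A := (mvfderiv I F x : E →L[ℝ] _).toLinearMap)
    (B := (mvfderiv I (F' ∘ f) x : E →L[ℝ] _).toLinearMap) hsurj' hker
  rwa [finrank_euclideanSpace_fin, finrank_euclideanSpace_fin] at hfin

end Codimension

section LocallyIsometric

variable {E : Type*} [NormedAddCommGroup E] [NormedSpace ℝ E]
  {H : Type*} [TopologicalSpace H] {I : ModelWithCorners ℝ E H}
  {M : Type*} [TopologicalSpace M] [ChartedSpace H M] [IsManifold I ∞ M] {g g' : RMetric I M}

theorem LocallyIsometric.exists_isIsometryNear (h : LocallyIsometric g g') (x : M) :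
    ∃ f : M → M, IsIsometryNear g g' f x := by
  obtain ⟨e, hx, he, -, hiso⟩ := h x
  have hsource := e.open_source.mem_nhds hx
  exact ⟨e, Filter.eventually_of_mem hsource fun y hy => he.contMDiffAt (e.open_source.mem_nhds hy),
    Filter.eventually_of_mem hsource hiso⟩

variable [FiniteDimensional ℝ E]

theorem IsIsometryNear.surjective_mfderiv {f : M → M} {x : M} (hf : IsIsometryNear g g' f x) :
    Function.Surjective (mfderiv I I f x) := by
  let f' : E →L[ℝ] E := mfderiv I I f x
  exact f'.toLinearMap.surjective_of_injective hf.injective_mfderiv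

theorem LocallyIsometric.le_of_isSubmanifoldOfCodim [I.Boundaryless] (h : LocallyIsometric g g')
    {s : ℝ} {k k' : ℕ} {N : Set M} (hN : IsSubmanifoldOfCodim I k N)
    (hNs : N ⊆ scalarCurvature g ⁻¹' {s})
    (hN' : IsSubmanifoldOfCodim I k' (scalarCurvature g' ⁻¹' {s})) : k' ≤ k := by
  obtain ⟨x, hx⟩ := hN.1
  obtain ⟨f, hf⟩ := h.exists_isIsometryNear x
  refine hN.le_of_eventually_mem hN' hx hf.smooth.self_of_nhds hf.surjective_mfderiv ?_
  filter_upwards [hf.eventually] with y hy hyN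
  exact (hy.scalarCurvature_eq rfl).symm.trans (hNs hyN)

end LocallyIsometric

section Submanifolds

variable {L : Submodule ℤ E2} [DiscreteTopology L]

theorem contMDiff_coe_fst : ContMDiff IST 𝓘(ℝ, E3) ∞ fun y : SphereTorus L => (y.1 : E3) :=
  have : Fact (finrank ℝ E3 = 2 + 1) := ⟨by simp⟩
  contMDiff_coe_sphere.comp contMDiff_fst

theorem exists_dSphere_eq (y : SphereTorus L) {X : E3} (hX : inner ℝ (y.1 : E3) X = 0) :
    ∃ v : TangentSpace IST y, dSphere L y v = X := by
  have : Fact (finrank ℝ E3 = 2 + 1) := ⟨by simp⟩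
  have h : X ∈ (ℝ ∙ (y.1 : E3))ᗮ := Submodule.mem_orthogonal_singleton_iff_inner_right.2 hX
  rw [← range_mvfderiv_subtypeVal (n := 2) y.1] at h
  obtain ⟨v, hv⟩ := h
  exact ⟨((v, 0) : E2 × E2), (dSphere_apply L y ((v, 0) : E2 × E2)).trans hv⟩

theorem inner_vec_three (p : E3) (a b c : ℝ) :
    inner ℝ p !₂[a, b, c] = a * p 0 + b * p 1 + c * p 2 := by
  simp [PiLp.inner_apply, Fin.sum_univ_three]

theorem isSubmanifoldOfCodim_of_linear {k : ℕ} (ℓ : Fin k → E3 →L[ℝ] ℝ)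
    {N : Set (SphereTorus L)} {V : Set E3} (hV : IsOpen V) (hne : N.Nonempty)
    (hNV : ∀ y ∈ N, (y.1 : E3) ∈ V)
    (hsurj : ∀ p : S2, (p : E3) ∈ V → ∀ r : Fin k → ℝ, ∃ X : E3, inner ℝ (p : E3) X = 0 ∧
      ∀ i, ℓ i X = r i)
    (hN : ∀ y : SphereTorus L, (y.1 : E3) ∈ V → (y ∈ N ↔ ∀ i, ℓ i y.1 = 0)) :
    IsSubmanifoldOfCodim IST k N := by
  let ℓ' : E3 →L[ℝ] EuclideanSpace ℝ (Fin k) :=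
    (EuclideanSpace.equiv (Fin k) ℝ).symm.toContinuousLinearMap ∘L ContinuousLinearMap.pi ℓ
  have hℓ' {X : E3} {r : EuclideanSpace ℝ (Fin k)} : ℓ' X = r ↔ ∀ i, ℓ i X = r i := PiLp.ext_iff
  refine ⟨hne, fun x hx => ⟨{y | (y.1 : E3) ∈ V}, fun y => ℓ' y.1,
    hV.preimage contMDiff_coe_fst.continuous, hNV x hx, ?_, fun y hy r => ?_, ?_⟩⟩
  · exact (ℓ'.contDiff.contMDiff.comp contMDiff_coe_fst).contMDiffOn
  · obtain ⟨X, hX, hr⟩ := hsurj y.1 hy r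
    obtain ⟨v, rfl⟩ := exists_dSphere_eq y hX
    have h := mfderiv_comp y (g := ℓ') ℓ'.mdifferentiableAt
      (contMDiff_coe_fst.mdifferentiableAt (by simp))
    rw [ContinuousLinearMap.mfderiv_eq] at h
    exact ⟨v, (congrArg (fun A => A v) h).trans (hℓ'.2 hr)⟩
  · ext y
    exact (and_congr_left fun hy => (hN y hy).trans (hℓ' (r := 0)).symm).trans and_comm

variable (L) in
theorem isSubmanifoldOfCodim_one :
    IsSubmanifoldOfCodim IST 1 ({p : S2 | p.1 0 = -p.1 2} ×ˢ (univ : Set (Torus L))) := by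
  refine isSubmanifoldOfCodim_of_linear (V := {X | (X 0 + X 2) ^ 2 < 2})
    ![EuclideanSpace.proj 0 + EuclideanSpace.proj 2] (isOpen_lt (by fun_prop) continuous_const)
    ⟨(pole, 0), by simp [pole], mem_univ _⟩ ?_ (fun p hp r => ?_) fun y _ => ?_
  · rintro y ⟨hy : y.1.1 0 = _, -⟩
    simp [hy]
  · -- the multiple of the tangential part of `(1, 0, 1)` with the prescribed value
    let s := p.1 0 + p.1 2
    let b := r 0 / (2 - s ^ 2)
    have hb : b * (2 - s ^ 2) = r 0 := div_mul_cancel₀ _ (sub_pos.2 hp).ne'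
    have hs := sum_sq_eq_one p
    refine ⟨!₂[b * (1 - s * p.1 0), b * (0 - s * p.1 1), b * (1 - s * p.1 2)], ?_, ?_⟩
    · rw [inner_vec_three]
      linear_combination (-b * s) * hs
    · rw [Fin.forall_fin_one, ← hb]
      change b * (1 - s * p.1 0) + b * (1 - s * p.1 2) = _
      ring
  · simp [eq_neg_iff_add_eq_zero]

variable (L) in
theorem isSubmanifoldOfCodim_two : IsSubmanifoldOfCodim IST 2
    ({p : S2 | p.1 = !₂[0, 1, 0] ∨ p.1 = !₂[0, -1, 0]} ×ˢ (univ : Set (Torus L))) := by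
  refine isSubmanifoldOfCodim_of_linear (V := {X | X 1 ≠ 0})
    ![EuclideanSpace.proj 0, EuclideanSpace.proj 2] (isOpen_ne_fun (by fun_prop) continuous_const)
    ⟨(pole, 0), .inl rfl, mem_univ _⟩ ?_ (fun p hp r => ?_) fun y _ => ?_
  · rintro y ⟨hy | hy, -⟩ <;> simp [hy]
  · refine ⟨!₂[r 0, -(r 0 * p.1 0 + r 1 * p.1 2) / p.1 1, r 1], ?_, by simp [Fin.forall_fin_two]⟩
    rw [inner_vec_three, div_mul_cancel₀ _ hp]
    ring
  · simp [Fin.forall_fin_two, eq_pole_or_eq_neg_pole_iff]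

end Submanifolds

end SphereTorusMetrics

end

open SphereTorusMetrics in
theorem proposition2p10 (L : Submodule ℤ (EuclideanSpace ℝ (Fin 2)))
    [DiscreteTopology L] [IsZLattice ℝ L] :
    -- the two metrics are isospectral
    Isospectral (metric L c₁) (metric L c₂) ∧
    -- the maximal scalar curvature equals 2 for both metrics
    IsGreatest (Set.range (scalarCurvature (metric L c₁))) 2 ∧
    IsGreatest (Set.range (scalarCurvature (metric L c₂))) 2 ∧
    -- the set where the first metric attains it, and a hypersurface contained in this set
    scalarCurvature (metric L c₁) ⁻¹' {2} =
      ({p : S2 | p.1 0 = -p.1 2} ∪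
        {p : S2 | p.1 = !₂[1 / √2, 0, 1 / √2] ∨ p.1 = !₂[-1 / √2, 0, -1 / √2]}) ×ˢ Set.univ ∧
    (∃ N ⊆ scalarCurvature (metric L c₁) ⁻¹' {2}, IsSubmanifoldOfCodim IST 1 N) ∧
    -- the set where the second metric attains it, which has codimension two
    scalarCurvature (metric L c₂) ⁻¹' {2} =
      {p : S2 | p.1 = !₂[0, 1, 0] ∨ p.1 = !₂[0, -1, 0]} ×ˢ Set.univ ∧
    IsSubmanifoldOfCodim IST 2 (scalarCurvature (metric L c₂) ⁻¹' {2}) ∧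
    -- the two manifolds are not locally isometric
    ¬ LocallyIsometric (metric L c₁) (metric L c₂) := by
  have hN : IsSubmanifoldOfCodim IST 1 ({p : S2 | p.1 0 = -p.1 2} ×ˢ Set.univ) :=
    isSubmanifoldOfCodim_one L
  have hNs : {p : S2 | p.1 0 = -p.1 2} ×ˢ Set.univ ⊆ scalarCurvature (metric L c₁) ⁻¹' {2} :=
    fun x hx => (scalarCurvature_c₁_eq_two_iff x).2 (.inl hx.1)
  have hN' : IsSubmanifoldOfCodim IST 2 (scalarCurvature (metric L c₂) ⁻¹' {2}) :=
    preimage_scalarCurvature_c₂ L ▸ isSubmanifoldOfCodim_two L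
  refine ⟨isospectral_of_rotations c₁_isSymm c₂_isSymm exists_intertwining_rotation,
    isGreatest_range_scalarCurvature_c₁ L, isGreatest_range_scalarCurvature_c₂ L,
    preimage_scalarCurvature_c₁ L, ⟨_, hNs, hN⟩, preimage_scalarCurvature_c₂ L, hN', fun h => ?_⟩
  have hcodim : 2 ≤ 1 := h.le_of_isSubmanifoldOfCodim hN hNs hN'
  omega
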